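/- **Notation.** A filter on $\mathbb Z^d$ is a finitely supported sequence $a:\mathbb Z^d\to\mathbb C$, with symbol $\widehat a(\omega)=\sum_{k}a(k)e^{-ik\cdot\omega}$. Let $M=\begin{bmatrix}1&1\\1&-1\end{bmatrix}$, and let $D_4$ be the group of the eight matrices $\pm\begin{bmatrix}1&0\\0&1\end{bmatrix},\pm\begin{bmatrix}1&0\\0&-1\end{bmatrix},\pm\begin{bmatrix}0&1\\1&0\end{bmatrix},\pm\begin{bmatrix}0&1\\-1&0\end{bmatrix}$. For $E\in D_4$ put $\varepsilon(E)=1$ if $E$ is diagonal and $\varepsilon(E)=-1$ otherwise. For functions, $\widehat f(\omega)=\int f(x)e^{-ix\cdot\omega}\,dx$, extended to $L_2(\mathbb R^2)$ by Plancherel. **Theorem 2.2.** Let $n\ge 1$, and let $a^I_{2n}$ be the filter on $\mathbb Z$ with $\widehat{a^I_{2n}}(\omega)=\cos^{2n}(\omega/2)\sum_{j=0}^{n-1}\binom{n-1+j}{j}\sin^{2j}(\omega/2)$. Let $a=a^{2D}_{2n,2n}$ be the filter on $\mathbb Z^2$ with $$\widehat a(\omega_1,\omega_2)=\tfrac12\big[\widehat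 u(\omega_1+\omega_2)+\widehat u(\omega_1-\omega_2)e^{-i\omega_2}\big],\qquad \widehat u(\omega)=\big(\widehat{a^I_{2n}}(\omega/2)-\widehat{a^I_{2n}}(\omega/2+\pi)\big)e^{-i\omega/2}.$$ Let $a^D_n$ be a real-valued filter on $\mathbb Z$ with $|\widehat{a^D_n}(\omega)|^2=\widehat{a^I_{2n}}(\omega)$ for all $\omega\in\mathbb R$ (a Daubechies filter), and define $b_2$ by $$\widehat{b_2}(\omega_1,\omega_2)=\tfrac12\big[\widehat v(\omega_1+\omega_2)+\widehat v(\omega_1-\omega_2)e^{-i\omega_2}\big],\qquad \widehat v(\omega)=2\,\widehat{a^D_n}(\omega/2)\,\widehat{a^D_n}(\omega/2+\pi).$$ Define $b_1,b_3$ by $b_1(k)=(-1)^{1+k_1+k_2}\overline{a(1-k_1,-k_2)}$ and $b_3(k)=(-1)^{1+k_1+k_2}\overline{b_2(1-k_1,-k_2)}$, $k\in\mathbb Z^2$. Then $\{a;b_1,b_2,b_3\}$ is a double canonical quincunx tight framelet filter bank, that is, for all $\omega\in\mathbb R^2$, $$|\widehat a(\omega)|^2+\sum_{\ell=1}^3|\widehat{b_\ell}(\omega)|^2=1,\qquad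 \overline{\widehat a(\omega)}\,\widehat a(\omega+(\pi,\pi))+\sum_{\ell=1}^3\overline{\widehat{b_\ell}(\omega)}\,\widehat{b_\ell}(\omega+(\pi,\pi))=0,$$ $$\widehat{b_1}(\omega)=e^{-i\omega_1}\overline{\widehat a(\omega+(\pi,\pi))},\qquad \widehat{b_3}(\omega)=e^{-i\omega_1}\overline{\widehat{b_2}(\omega+(\pi,\pi))}.$$ Moreover: (i) $a,b_1,b_2,b_3$ have real coefficients. With $\mathring c=(1/2,-1/2)$, $b_1(E(k-\mathring c)+\mathring c)=\varepsilon(E)\det(E)\,b_1(k)$ for all $k\in\mathbb Z^2$, $E\in D_4$. For all $k_1,k_2\in\mathbb Z$, $b_2(k_1,1-k_2)=b_2(k_1,k_2)$ and $b_3(k_1,-1-k_2)=-b_3(k_1,k_2)$. (ii) $b_1,b_2,b_3$ have at least $n$ vanishing moments: $\widehat{b_\ell}(\omega)=O(\|\omega\|^n)$ as $\omega\to0$. (iii) The supports of $b_1,b_2,b_3$ are no larger than that of $a$: each has at most as many points as $\operatorname{supp}a$; $\operatorname{supp}b_1\subseteq\operatorname{supp}a-(0,1)$; and if $a^D_n$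 is normalized so that $\operatorname{supp}a^D_n\subseteq[1-n,n]$, then $\operatorname{supp}b_2\subseteq\operatorname{supp}a$ and $\operatorname{supp}b_3\subseteq\operatorname{supp}a-(0,1)$. (iv) The product $\widehat\phi(\omega)=\prod_{j\ge1}\widehat a((M^\top)^{-j}\omega)$ converges for every $\omega\in\mathbb R^2$. There are $\phi,\psi_1,\psi_2,\psi_3\in L_2(\mathbb R^2)$ whose Fourier transforms are $\widehat\phi$ and $\widehat{\psi_\ell}(\omega)=\widehat{b_\ell}((M^\top)^{-1}\omega)\,\widehat\phi((M^\top)^{-1}\omega)$, $\ell=1,2,3$, and $\{\phi;\psi_1,\psi_2,\psi_3\}$ is a tight $M$-framelet: for all $f\in L_2(\mathbb R^2)$, $$\|f\|^2=\sum_{k\in\mathbb Z^2}|\langle f,\phi(\cdot-k)\rangle|^2+\sum_{j=0}^\infty\sum_{\ell=1}^3\sum_{k\in\mathbb Z^2}\big|\langle f,2^{j/2}\psi_\ell(M^j\cdot-k)\rangle\big|^2.$$ It is symmetric: with $c_\phi=(3/2,1/2)$ and $c_1=(1,1)$, for all $E\in D_4$ and almost every $x\in\mathbb R^2$, $$\phi(E(x-c_\phi)+c_\phi)=\phi(x),\quad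 \psi_1(E(x-c_1)+c_1)=\varepsilon(E)\,\psi_1(x),\quad \psi_2(x_2+1,x_1-1)=\psi_2(x_1,x_2),\quad \psi_3(x_2,x_1)=-\psi_3(x_1,x_2).$$ -/

import Mathlib

open scoped FourierTransform Matrix ComplexConjugate LaurentPolynomial
open MeasureTheory

namespace Quincunx

noncomputable section

/-! ### Filters and their symbols -/

/-- A one-dimensional filter: a finitely supported complex sequence on `ℤ`. -/
abbrev Filter1 := ℤ →₀ ℂ

/-- A two-dimensional filter: a finitely supported complex array on `ℤ²`. -/
abbrev Filter2 := (Fin 2 → ℤ) →₀ ℂ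

/-- The symbol `∑ k, p(k) exp(-i k ω)`. -/
def symbol1 (p : Filter1) (ω : ℝ) : ℂ :=
  p.sum fun k c => c * Complex.exp (-Complex.I * ((k : ℝ) * ω : ℝ))

/-- The symbol `∑ k, a(k) exp(-i k·ω)`. -/
def symbol2 (a : Filter2) (ω : Fin 2 → ℝ) : ℂ :=
  a.sum fun k c => c * Complex.exp (-Complex.I * (∑ i, (k i : ℝ) * ω i : ℝ))

/-! ### The one-dimensional interpolatory filter -/

/-- The trigonometric polynomial
`cos^{2n}(ω/2) ∑_{j<n} binom(n-1+j, j) sin^{2j}(ω/2)`. -/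
def interpolatorySymbol (n : ℕ) (ω : ℝ) : ℝ :=
  Real.cos (ω / 2) ^ (2 * n) *
    ∑ j ∈ Finset.range n, ((n - 1 + j).choose j : ℝ) * Real.sin (ω / 2) ^ (2 * j)

/-- The same expression written in `z = exp(-iω)`, with `cos²(ω/2) = (2 + z + z⁻¹)/4` and
`sin²(ω/2) = (2 - z - z⁻¹)/4`. -/
def interpolatoryPoly (n : ℕ) : ℂ[T;T⁻¹] :=
  (LaurentPolynomial.C (1 / 4) *
      (LaurentPolynomial.C 2 + LaurentPolynomial.T 1 + LaurentPolynomial.T (-1))) ^ n *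
    ∑ j ∈ Finset.range n, LaurentPolynomial.C ((n - 1 + j).choose j : ℂ) *
      (LaurentPolynomial.C (1 / 4) *
        (LaurentPolynomial.C 2 - LaurentPolynomial.T 1 - LaurentPolynomial.T (-1))) ^ j

/-- The interpolatory `2`-wavelet filter `a^I_{2n}`; its symbol is `interpolatorySymbol n`
(lemma `symbol1_interpolatory`). -/
def interpolatory (n : ℕ) : Filter1 := (interpolatoryPoly n).coeff

/-! ### The low-pass filter and the high-pass filters -/

lemma odd_injective : Function.Injective (fun j : ℤ => 2 * j - 1) :=
  fun x y h => by have h' : 2 * x - 1 = 2 * y - 1 := h; omega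

lemma even_injective : Function.Injective (fun j : ℤ => 2 * j) :=
  fun x y h => by have h' : 2 * x = 2 * y := h; omega

/-- The filter `u(j) = 2 a^I_{2n}(2j - 1)`, whose symbol is
`(a^I(ω/2) - a^I(ω/2 + π)) exp(-iω/2)` (lemma `symbol1_lowpassU`). -/
def lowpassU (n : ℕ) : Filter1 :=
  (2 : ℂ) • (interpolatory n).comapDomain (fun j : ℤ => 2 * j - 1)
    odd_injective.injOn

/-- The filter `∑_{j,m} p(j) p(m) (-1)^m δ_{j+m}`, with symbol `p(ω) p(ω + π)`. -/
def selfProduct (p : Filter1) : Filter1 :=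
  p.sum fun j c => p.sum fun m d => Finsupp.single (j + m) (c * (d * (-1) ^ m))

/-- The filter `v` with symbol `2 p(ω/2) p(ω/2 + π)` (lemma `symbol1_highpassV`). -/
def highpassV (p : Filter1) : Filter1 :=
  (2 : ℂ) • (selfProduct p).comapDomain (fun j : ℤ => 2 * j)
    even_injective.injOn

/-- The two-dimensional filter whose symbol is
`(p(ω₁ + ω₂) + p(ω₁ - ω₂) exp(-iω₂)) / 2` (lemma `symbol2_cross`). -/
def cross (p : Filter1) : Filter2 :=
  (1 / 2 : ℂ) • (p.mapDomain (fun j => ![j, j]) + p.mapDomain (fun j => ![j, 1 - j]))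

/-- The low-pass filter `a^{2D}_{2n,2n}`. -/
def lowpass (n : ℕ) : Filter2 := cross (lowpassU n)

/-- The high-pass filter `b₂` built from a one-dimensional filter `aD`. -/
def highpass (aD : Filter1) : Filter2 := cross (highpassV aD)

lemma mate_finite (a : Filter2) :
    (Function.support fun k : Fin 2 → ℤ =>
      (-1 : ℂ) ^ (1 + k 0 + k 1) * conj (a ![1 - k 0, -k 1])).Finite := by
  refine (a.support.finite_toSet.image fun m => (![1 - m 0, -m 1] : Fin 2 → ℤ)).subset ?_
  intro k hk
  refine ⟨![1 - k 0, -k 1], ?_, ?_⟩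
  · simp only [Finset.mem_coe, Finsupp.mem_support_iff]
    intro h
    exact hk (by simp [h])
  · ext i
    fin_cases i <;> simp

/-- The canonical partner `k ↦ (-1)^{1+k₁+k₂} conj a(1-k₁, -k₂)`, whose symbol is
`exp(-iω₁) conj a(ω + (π,π))`. -/
def mate (a : Filter2) : Filter2 :=
  Finsupp.ofSupportFinite (fun k => (-1 : ℂ) ^ (1 + k 0 + k 1) * conj (a ![1 - k 0, -k 1]))
    (mate_finite a)

/-! ### Tight framelet filter banks -/

/-- The dilation matrix `M_{√2}`. -/
def quincunxM : Matrix (Fin 2) (Fin 2) ℤ := !![1, 1; 1, -1]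

/-- An integer matrix viewed as a real one. -/
abbrev toReal (M : Matrix (Fin 2) (Fin 2) ℤ) : Matrix (Fin 2) (Fin 2) ℝ :=
  M.map (Int.cast : ℤ → ℝ)

/-- `Ω_M = [(Mᵀ)⁻¹ ℤ²] ∩ [0,1)²`. -/
def Omega (M : Matrix (Fin 2) (Fin 2) ℤ) : Set (Fin 2 → ℝ) :=
  {ξ | (∃ k : Fin 2 → ℤ, ξ = (toReal M)ᵀ⁻¹ *ᵥ fun i => (k i : ℝ)) ∧
    ∀ i, ξ i ∈ Set.Ico (0 : ℝ) 1}

/-- `{a; b₁, …, b_L}` is a tight `M`-framelet filter bank. -/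
def IsTightFilterBank (M : Matrix (Fin 2) (Fin 2) ℤ) {L : ℕ} (a : Filter2)
    (b : Fin L → Filter2) : Prop :=
  (∀ ω : Fin 2 → ℝ, ‖symbol2 a ω‖ ^ 2 + ∑ ℓ, ‖symbol2 (b ℓ) ω‖ ^ 2 = 1) ∧
  ∀ ξ ∈ Omega M, ξ ≠ 0 → ∀ ω : Fin 2 → ℝ,
    conj (symbol2 a ω) * symbol2 a (ω + (2 * Real.pi) • ξ) +
      ∑ ℓ, conj (symbol2 (b ℓ) ω) * symbol2 (b ℓ) (ω + (2 * Real.pi) • ξ) = 0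

/-- `b(ω) = exp(-iω₁) conj a(ω + (π,π))` on the level of symbols. -/
def IsCanonicalPair (a b : Filter2) : Prop :=
  ∀ ω : Fin 2 → ℝ, symbol2 b ω =
    Complex.exp (-Complex.I * (ω 0 : ℝ)) * conj (symbol2 a (ω + ![Real.pi, Real.pi]))

/-- `{a; b₁, b₂, b₃}` is a double canonical quincunx tight framelet filter bank. -/
def IsDoubleCanonical (a b₁ b₂ b₃ : Filter2) : Prop :=
  IsTightFilterBank quincunxM a ![b₁, b₂, b₃] ∧ IsCanonicalPair a b₁ ∧ IsCanonicalPair b₂ b₃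

/-- All coefficients are real. -/
def IsRealFilter {ι : Type*} (a : ι →₀ ℂ) : Prop := ∀ k, (a k).im = 0

/-- At least `n` vanishing moments: the symbol is `O(‖ω‖^n)` as `ω → 0`. -/
def HasVanishingMoments (b : Filter2) (n : ℕ) : Prop :=
  (fun ω : Fin 2 → ℝ => symbol2 b ω) =O[nhds 0] fun ω => ‖ω‖ ^ n

/-! ### The symmetry group -/

/-- The dihedral group `D₄`. -/
def D4 : Set (Matrix (Fin 2) (Fin 2) ℤ) :=
  {!![1, 0; 0, 1], -!![1, 0; 0, 1], !![1, 0; 0, -1], -!![1, 0; 0, -1],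
   !![0, 1; 1, 0], -!![0, 1; 1, 0], !![0, 1; -1, 0], -!![0, 1; -1, 0]}

/-- The sign character of `D₄` that is `1` on the diagonal matrices and `-1` on the others. -/
def diagSign (E : Matrix (Fin 2) (Fin 2) ℤ) : ℤ :=
  if E 0 1 = 0 ∧ E 1 0 = 0 then 1 else -1

/-- `b(E(k-c)+c) = χ(E) b(k)` for all `k ∈ ℤ²` and `E ∈ D₄`; the point `E(k-c)+c` is
required to lie in `ℤ²`. -/
def FilterSymmetric (b : Filter2) (χ : Matrix (Fin 2) (Fin 2) ℤ → ℤ) (c : Fin 2 → ℝ) : Prop :=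
  ∀ E ∈ D4, ∀ k : Fin 2 → ℤ, ∃ k' : Fin 2 → ℤ,
    (fun i => (k' i : ℝ)) = toReal E *ᵥ ((fun i => (k i : ℝ)) - c) + c ∧ b k' = (χ E : ℂ) * b k

/-! ### Functions on the plane -/

/-- The Euclidean plane. -/
abbrev Plane := EuclideanSpace ℝ (Fin 2)

/-- A real matrix acting on the plane. -/
def act (A : Matrix (Fin 2) (Fin 2) ℝ) (x : Plane) : Plane := WithLp.toLp 2 (A *ᵥ x.ofLp)

/-- An integer point of the plane. -/
def lattice (k : Fin 2 → ℤ) : Plane := WithLp.toLp 2 fun i => (k i : ℝ)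

/-- `f(E(x-c)+c) = χ(E) f(x)` for almost every `x`, for all `E ∈ D₄`. -/
def FunctionSymmetric (f : Plane → ℂ) (χ : Matrix (Fin 2) (Fin 2) ℤ → ℤ) (c : Plane) : Prop :=
  ∀ E ∈ D4, ∀ᵐ x : Plane, f (act (toReal E) (x - c) + c) = (χ E : ℂ) * f x

/-- `{φ; ψ₁, …, ψ_L}` is a tight `M`-framelet for `L₂(ℝ²)`. Both sides of the frame identity are
sums of nonnegative extended reals, and `⟨f, g⟩ = ∫ f conj g`. -/
def IsTightFramelet (M : Matrix (Fin 2) (Fin 2) ℤ) {L : ℕ} (φ : Plane → ℂ)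
    (ψ : Fin L → Plane → ℂ) : Prop :=
  MemLp φ 2 ∧ (∀ ℓ, MemLp (ψ ℓ) 2) ∧
  ∀ f : Plane → ℂ, MemLp f 2 →
    ∫⁻ x, ‖f x‖ₑ ^ 2 =
      (∑' k : Fin 2 → ℤ, ‖∫ x, f x * conj (φ (x - lattice k))‖ₑ ^ 2) +
      ∑' j : ℕ, ∑ ℓ, ∑' k : Fin 2 → ℤ,
        ‖∫ x, f x * conj ((((|M.det| : ℤ) : ℝ) ^ ((j : ℝ) / 2) : ℝ) *
          ψ ℓ (act (toReal M ^ j) x - lattice k))‖ₑ ^ 2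

/-- The `L₂` function `f` has Fourier transform `F` in the normalization
`f^(ω) = ∫ f(x) exp(-i x·ω) dx`, that is, `f^(2πξ) = 𝓕 f ξ`. -/
def HasFourierTransform (f : Lp ℂ 2 (volume : Measure Plane)) (F : (Fin 2 → ℝ) → ℂ) : Prop :=
  ∀ᵐ ξ : Plane, (𝓕 f : Lp ℂ 2 (volume : Measure Plane)) ξ = F ((2 * Real.pi) • ξ.ofLp)

/-- The factors `a((Mᵀ)^{-j} ω)`, `j ≥ 1` (the index is shifted by one). -/
def refinableFactor (M : Matrix (Fin 2) (Fin 2) ℤ) (a : Filter2) (ω : Fin 2 → ℝ) (j : ℕ) : ℂ :=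
  symbol2 a (((toReal M)ᵀ⁻¹ ^ (j + 1)) *ᵥ ω)

/-- `φ^(ω) = ∏_{j ≥ 1} a((Mᵀ)^{-j} ω)`. -/
def refinableHat (M : Matrix (Fin 2) (Fin 2) ℤ) (a : Filter2) (ω : Fin 2 → ℝ) : ℂ :=
  ∏' j : ℕ, refinableFactor M a ω j

/-- `ψ^(ω) = b((Mᵀ)⁻¹ ω) φ^((Mᵀ)⁻¹ ω)`. -/
def frameletHat (M : Matrix (Fin 2) (Fin 2) ℤ) (a b : Filter2) (ω : Fin 2 → ℝ) : ℂ :=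
  symbol2 b ((toReal M)ᵀ⁻¹ *ᵥ ω) * refinableHat M a ((toReal M)ᵀ⁻¹ *ᵥ ω)

/-! ### The symbols of the filters above -/

lemma symbol1_add (p q : Filter1) (ω : ℝ) :
    symbol1 (p + q) ω = symbol1 p ω + symbol1 q ω := by
  unfold symbol1
  exact Finsupp.sum_add_index' (by simp) (by intros; ring)

lemma symbol1_single (k : ℤ) (c : ℂ) (ω : ℝ) :
    symbol1 (Finsupp.single k c) ω = c * Complex.exp (-Complex.I * ((k : ℝ) * ω : ℝ)) := by
  unfold symbol1
  simp

lemma symbol1_smul (r : ℂ) (p : Filter1) (ω : ℝ) : symbol1 (r • p) ω = r * symbol1 p ω := by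
  unfold symbol1
  rw [Finsupp.sum_smul_index (by simp), Finsupp.mul_sum]
  simp [mul_assoc]

lemma symbol1_zero (ω : ℝ) : symbol1 0 ω = 0 := by simp [symbol1]

lemma exp_add_pi (k : ℤ) (ω : ℝ) :
    Complex.exp (-Complex.I * ((k : ℝ) * (ω + Real.pi) : ℝ)) =
      (-1) ^ k * Complex.exp (-Complex.I * ((k : ℝ) * ω : ℝ)) := by
  have h : (-1 : ℂ) ^ k = Complex.exp (-Complex.I * ((k : ℝ) * Real.pi : ℝ)) := by
    have h1 : (-1 : ℂ) = Complex.exp (-(Real.pi * Complex.I)) := by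
      rw [Complex.exp_neg, Complex.exp_pi_mul_I]; norm_num
    rw [h1, ← Complex.exp_int_mul]
    congr 1
    push_cast
    ring
  rw [h, ← Complex.exp_add]
  congr 1
  push_cast
  ring

/-- The unit `exp(-iω)`. -/
def expUnit (ω : ℝ) : ℂˣ := Units.mk0 (Complex.exp (-Complex.I * ω)) (Complex.exp_ne_zero _)

lemma symbol1_coeff (P : ℂ[T;T⁻¹]) (ω : ℝ) :
    symbol1 P.coeff ω = LaurentPolynomial.eval₂ (RingHom.id ℂ) (expUnit ω) P := by
  induction P using LaurentPolynomial.induction_on' with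
  | add p q hp hq => rw [map_add, ← hp, ← hq, ← symbol1_add]; rfl
  | C_mul_T k c =>
    rw [LaurentPolynomial.eval₂_C_mul_T, ← LaurentPolynomial.single_eq_C_mul_T,
      AddMonoidAlgebra.coeff_single, symbol1_single, Units.val_zpow_eq_zpow_val]
    simp only [expUnit, Units.val_mk0, RingHom.id_apply]
    rw [← Complex.exp_int_mul]
    congr 2
    push_cast
    ring

lemma symbol1_interpolatory (n : ℕ) (ω : ℝ) :
    symbol1 (interpolatory n) ω = interpolatorySymbol n ω := by
  have e1 : Complex.exp (-Complex.I * ω) = Complex.cos ω - Complex.sin ω * Complex.I := by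
    rw [show -Complex.I * (ω : ℂ) = (-ω : ℂ) * Complex.I by ring, Complex.exp_mul_I]
    simp [sub_eq_add_neg]
  have e2 : (Complex.exp (-Complex.I * ω))⁻¹ = Complex.cos ω + Complex.sin ω * Complex.I := by
    rw [← Complex.exp_neg, show -(-Complex.I * (ω : ℂ)) = (ω : ℂ) * Complex.I by ring,
      Complex.exp_mul_I]
  have e3 : (Complex.cos ω - Complex.sin ω * Complex.I)⁻¹ =
      Complex.cos ω + Complex.sin ω * Complex.I := by rw [← e1, e2]
  have hc : (Complex.cos ω : ℂ) = 2 * Complex.cos (ω / 2) ^ 2 - 1 := by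
    rw [← Complex.cos_two_mul]; congr 1; ring
  have hs : (Complex.sin (ω / 2) : ℂ) ^ 2 = 1 - Complex.cos (ω / 2) ^ 2 := by
    rw [← Complex.sin_sq_add_cos_sq (ω / 2 : ℂ)]; ring
  unfold interpolatory
  rw [symbol1_coeff]
  unfold interpolatoryPoly interpolatorySymbol
  simp only [map_mul, map_pow, map_sum, map_add, map_sub, LaurentPolynomial.eval₂_C,
    LaurentPolynomial.eval₂_T, RingHom.id_apply, zpow_one, zpow_neg, Units.val_inv_eq_inv_val,
    expUnit, Units.val_mk0, e1, e3]
  push_cast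
  congr 1
  · rw [pow_mul]; congr 1; rw [hc]; ring
  · refine Finset.sum_congr rfl fun j _ => ?_
    rw [pow_mul]; congr 2; rw [hs, hc]; ring

lemma exp_half_shift (j : ℤ) (ω : ℝ) :
    Complex.exp (-Complex.I * (((2 * j - 1 : ℤ) : ℝ) * (ω / 2) : ℝ)) *
      Complex.exp (-Complex.I * (ω / 2 : ℝ)) =
      Complex.exp (-Complex.I * ((j : ℝ) * ω : ℝ)) := by
  rw [← Complex.exp_add]
  congr 1
  push_cast
  ring

lemma symbol1_odd (p : Filter1) (ω : ℝ) :
    2 * symbol1 (p.comapDomain (fun j : ℤ => 2 * j - 1) odd_injective.injOn) ω =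
      (symbol1 p (ω / 2) - symbol1 p (ω / 2 + Real.pi)) *
        Complex.exp (-Complex.I * (ω / 2 : ℝ)) := by
  induction p using Finsupp.induction_linear with
  | zero => simp [symbol1_zero]
  | add f g hf hg =>
    rw [Finsupp.comapDomain_add_of_injective odd_injective, symbol1_add, symbol1_add, symbol1_add, mul_add,
      hf, hg]
    ring
  | single k c =>
    rw [symbol1_single, symbol1_single, exp_add_pi]
    rcases Int.even_or_odd' k with ⟨j, rfl | rfl⟩
    · have : Finsupp.comapDomain (fun j : ℤ => 2 * j - 1) (Finsupp.single (2 * j) c)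
          odd_injective.injOn = 0 := by
        ext i
        rw [Finsupp.comapDomain_apply, Finsupp.single_apply, if_neg (by omega)]
        rfl
      rw [this, symbol1_zero, zpow_mul]
      norm_num
    · have : Finsupp.comapDomain (fun j : ℤ => 2 * j - 1) (Finsupp.single (2 * j + 1) c)
          odd_injective.injOn =
          Finsupp.single (j + 1) c := by
        ext i
        rw [Finsupp.comapDomain_apply, Finsupp.single_apply, Finsupp.single_apply]
        congr 1
        exact propext ⟨fun h => by omega, fun h => by omega⟩
      have e : (-1 : ℂ) ^ (2 * j + 1) = -1 := by
        rw [zpow_add₀ (by norm_num), zpow_mul]; norm_num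
      rw [this, symbol1_single, e, ← exp_half_shift (j + 1) ω]
      rw [show 2 * (j + 1) - 1 = 2 * j + 1 by ring]
      ring

lemma symbol1_even (p : Filter1) (ω : ℝ) :
    2 * symbol1 (p.comapDomain (fun j : ℤ => 2 * j) even_injective.injOn) ω =
      symbol1 p (ω / 2) + symbol1 p (ω / 2 + Real.pi) := by
  induction p using Finsupp.induction_linear with
  | zero => simp [symbol1_zero]
  | add f g hf hg =>
    rw [Finsupp.comapDomain_add_of_injective even_injective, symbol1_add, symbol1_add, symbol1_add, mul_add,
      hf, hg]
    ring
  | single k c =>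
    rw [symbol1_single, symbol1_single, exp_add_pi]
    rcases Int.even_or_odd' k with ⟨j, rfl | rfl⟩
    · have : Finsupp.comapDomain (fun j : ℤ => 2 * j) (Finsupp.single (2 * j) c)
          even_injective.injOn =
          Finsupp.single j c := by
        ext i
        rw [Finsupp.comapDomain_apply, Finsupp.single_apply, Finsupp.single_apply]
        congr 1
        exact propext ⟨fun h => by omega, fun h => by omega⟩
      have e : (-1 : ℂ) ^ (2 * j) = 1 := by rw [zpow_mul]; norm_num
      rw [this, symbol1_single, e]
      rw [show (((2 * j : ℤ) : ℝ) * (ω / 2) : ℝ) = (j : ℝ) * ω by push_cast; ring]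
      ring
    · have : Finsupp.comapDomain (fun j : ℤ => 2 * j) (Finsupp.single (2 * j + 1) c)
          even_injective.injOn = 0 := by
        ext i
        rw [Finsupp.comapDomain_apply, Finsupp.single_apply, if_neg (by omega)]
        rfl
      have e : (-1 : ℂ) ^ (2 * j + 1) = -1 := by
        rw [zpow_add₀ (by norm_num), zpow_mul]; norm_num
      rw [this, symbol1_zero, e]
      ring

lemma symbol1_lowpassU (n : ℕ) (ω : ℝ) :
    symbol1 (lowpassU n) ω =
      ((interpolatorySymbol n (ω / 2) : ℂ) - interpolatorySymbol n (ω / 2 + Real.pi)) *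
        Complex.exp (-Complex.I * (ω / 2 : ℝ)) := by
  unfold lowpassU
  rw [symbol1_smul, symbol1_odd, symbol1_interpolatory, symbol1_interpolatory]

lemma symbol1_sum {ι : Type*} (s : Finset ι) (f : ι → Filter1) (ω : ℝ) :
    symbol1 (∑ i ∈ s, f i) ω = ∑ i ∈ s, symbol1 (f i) ω := by
  classical
  induction s using Finset.induction_on with
  | empty => simp [symbol1_zero]
  | insert i s hi ih => rw [Finset.sum_insert hi, Finset.sum_insert hi, symbol1_add, ih]

lemma symbol1_selfProduct (p : Filter1) (ω : ℝ) :
    symbol1 (selfProduct p) ω = symbol1 p ω * symbol1 p (ω + Real.pi) := by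
  unfold selfProduct Finsupp.sum
  rw [symbol1_sum]
  conv_rhs => unfold symbol1 Finsupp.sum
  rw [Finset.sum_mul_sum]
  refine Finset.sum_congr rfl fun j _ => ?_
  rw [symbol1_sum]
  refine Finset.sum_congr rfl fun m _ => ?_
  rw [symbol1_single]
  simp only [exp_add_pi]
  have : Complex.exp (-Complex.I * (((j + m : ℤ) : ℝ) * ω : ℝ)) =
      Complex.exp (-Complex.I * ((j : ℝ) * ω : ℝ)) *
        Complex.exp (-Complex.I * ((m : ℝ) * ω : ℝ)) := by
    rw [← Complex.exp_add]
    congr 1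
    push_cast
    ring
  rw [this]
  ring

lemma symbol1_two_pi (p : Filter1) (ω : ℝ) :
    symbol1 p (ω + Real.pi + Real.pi) = symbol1 p ω := by
  unfold symbol1
  refine Finset.sum_congr rfl fun k _ => ?_
  simp only [exp_add_pi]
  rw [← mul_assoc ((-1 : ℂ) ^ k), ← mul_zpow]
  norm_num

lemma symbol1_highpassV (p : Filter1) (ω : ℝ) :
    symbol1 (highpassV p) ω = 2 * symbol1 p (ω / 2) * symbol1 p (ω / 2 + Real.pi) := by
  unfold highpassV
  rw [symbol1_smul, symbol1_even, symbol1_selfProduct, symbol1_selfProduct, symbol1_two_pi]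
  ring

lemma symbol2_cross (p : Filter1) (ω : Fin 2 → ℝ) :
    symbol2 (cross p) ω =
      1 / 2 * (symbol1 p (ω 0 + ω 1) +
        symbol1 p (ω 0 - ω 1) * Complex.exp (-Complex.I * (ω 1 : ℝ))) := by
  unfold cross symbol2
  rw [Finsupp.sum_smul_index (by simp), Finsupp.sum_add_index' (by simp) (by intros; ring),
    Finsupp.sum_mapDomain_index (by simp) (by intros; ring),
    Finsupp.sum_mapDomain_index (by simp) (by intros; ring)]
  unfold symbol1
  rw [mul_add, Finsupp.sum_mul, Finsupp.mul_sum, Finsupp.mul_sum]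
  congr 1
  · refine Finset.sum_congr rfl fun k _ => ?_
    simp only [Fin.sum_univ_two, Matrix.cons_val_zero, Matrix.cons_val_one]
    rw [mul_assoc, mul_add (k : ℝ)]
  · refine Finset.sum_congr rfl fun k _ => ?_
    simp only [Fin.sum_univ_two, Matrix.cons_val_zero, Matrix.cons_val_one]
    rw [mul_assoc, mul_assoc, ← Complex.exp_add]
    congr 3
    push_cast
    ring

/-- The symbol of the canonical partner. -/
lemma isCanonicalPair_mate (a : Filter2) : IsCanonicalPair a (mate a) := by
  intro ω
  have hinv : ∀ k : Fin 2 → ℤ, (![1 - (![1 - k 0, -k 1] : Fin 2 → ℤ) 0,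
      -(![1 - k 0, -k 1] : Fin 2 → ℤ) 1] : Fin 2 → ℤ) = k := by
    intro k
    ext i
    fin_cases i <;> simp
  unfold symbol2 Finsupp.sum
  rw [map_sum, Finset.mul_sum]
  have hone : ∀ m : ℤ, ((-1 : ℂ) ^ m) ≠ 0 := fun m => zpow_ne_zero _ (by norm_num)
  refine Finset.sum_bij' (fun k _ => ![1 - k 0, -k 1]) (fun k _ => ![1 - k 0, -k 1]) ?_ ?_
    (fun k _ => hinv k) (fun k _ => hinv k) ?_
  · intro k hk
    rw [Finsupp.mem_support_iff] at hk ⊢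
    intro h
    exact hk (by simp [mate, Finsupp.ofSupportFinite_coe, h])
  · intro k hk
    rw [Finsupp.mem_support_iff] at hk ⊢
    intro h
    rw [mate, Finsupp.ofSupportFinite_coe, hinv] at h
    rcases mul_eq_zero.1 h with h | h
    · exact hone _ h
    · exact hk (by simpa using h)
  · intro k _
    have h1 : (mate a) k = (-1 : ℂ) ^ (1 + k 0 + k 1) * conj (a ![1 - k 0, -k 1]) := rfl
    rw [h1, map_mul, ← Complex.exp_conj]
    have h2 : (-1 : ℂ) ^ (1 + k 0 + k 1) =
        Complex.exp (Complex.I * (((1 - k 0 - k 1 : ℤ) : ℝ) * Real.pi : ℝ)) := by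
      have e : (-1 : ℂ) ^ (1 + k 0 + k 1) = (-1 : ℂ) ^ (1 - k 0 - k 1) := by
        rw [show 1 + k 0 + k 1 = (1 - k 0 - k 1) + 2 * (k 0 + k 1) by ring,
          zpow_add₀ (by norm_num), zpow_mul]
        norm_num
      rw [e]
      conv_lhs => rw [← Complex.exp_pi_mul_I]
      rw [← Complex.exp_int_mul]
      congr 1
      push_cast
      ring
    simp only [h2]
    rw [mul_comm (Complex.exp (Complex.I * _)), mul_assoc, ← Complex.exp_add,
      mul_left_comm, ← Complex.exp_add]
    congr 2
    simp [Fin.sum_univ_two]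
    ring

/-- The symbol of the low-pass filter. -/
lemma symbol2_lowpass (n : ℕ) (ω : Fin 2 → ℝ) :
    symbol2 (lowpass n) ω =
      1 / 2 * (symbol1 (lowpassU n) (ω 0 + ω 1) +
        symbol1 (lowpassU n) (ω 0 - ω 1) * Complex.exp (-Complex.I * (ω 1 : ℝ))) :=
  symbol2_cross _ _

/-- The symbol of the high-pass filter `b₂`. -/
lemma symbol2_highpass (aD : Filter1) (ω : Fin 2 → ℝ) :
    symbol2 (highpass aD) ω =
      1 / 2 * (symbol1 (highpassV aD) (ω 0 + ω 1) +
        symbol1 (highpassV aD) (ω 0 - ω 1) * Complex.exp (-Complex.I * (ω 1 : ℝ))) :=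
  symbol2_cross _ _

end

end Quincunx

/-!
The one-dimensional symbol `a^I` is a polynomial in `y = sin²(ω/2)` whose derivative is a multiple
of `y^{n-1} (1-y)^{n-1}` (`hasDerivAt_halfbandPoly`). Being symmetric under `y ↦ 1 - y`, this gives
the halfband identity `a^I(ω) + a^I(ω + π) = 1`; with `g = 2 a^I - 1`, it makes the low-pass symbol
a pure phase times the real function `(g((ω₁+ω₂)/2) + g((ω₁-ω₂)/2)) / 2` (`symbol2_lowpass_eq`).

*Filter bank.* By the parallelogram law, for `c = cross p` one has
`|c(ω)|² + |c(ω+(π,π))|² = (|p(ω₁+ω₂)|² + |p(ω₁-ω₂)|²) / 2`, and `|u|² + |v|² = 1` by the halfband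
identity. A canonical partner contributes the modulus at `ω + (π,π)` and cancels the cross term of
its parent, so the bank is tight. The derivative of `a^I` in `ω` is a multiple of `sin^{2n-1} ω`,
whose coefficients at the odd frequencies up to `2n-1` are all nonzero: hence `u` has the full
support `[1-n, n]`, while a spectral factor of `a^I` lives in a window of length `2n`,
which compares the supports.

*Framelets.* The unitary extension principle is proved on the Fourier side. The discrete framelet
transform of a tight bank is an isometry of `ℓ²(ℤ²)` (`IsParaunitary.sum_tsum_norm_sq_analysis`);
applied to the coefficients of `F` at level `J + 1`, it says that their energy is the sum of the
energies of the refinable and framelet coefficients at level `J` (`cascade`). If `F` has bounded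
support, Parseval's identity on the unit square computes the energy at a high level `J`, and this
tends to `‖F‖²`. Telescoping gives the frame identity for such `F`. Testing it on truncations of
`φ^` shows `φ^ ∈ L²`, and density extends it to all of `L²` (`frame_identity`).

*Symmetry.* Stripped of its phase, `φ^` is the limit of products of the real factors, each of which
is invariant under `D₄`, and the dilation normalizes `D₄`; so the limit is invariant
(`centredHat_toReal_mulVec`). The phases add up to the stated centres, and the remaining factors of
`ψ₁^, ψ₂^, ψ₃^` are explicit (`frameletHat_mate_lowpass`, `frameletHat_highpass`,
`frameletHat_mate_highpass`). The affine substitution rule for the Fourier transform on `L²`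
(`fourier_comp_affine`) turns this into symmetry of the functions.
-/

namespace Quincunx

noncomputable section

/-! ### The interpolatory symbol -/

/-- The polynomial `(1-y)^(m+1) ∑_{j ≤ m} binom(m+j, j) y^j`; the interpolatory symbol with
`n = m + 1` is its value at `y = sin²(ω/2)`. -/
def halfbandPoly (m : ℕ) (y : ℝ) : ℝ :=
  (1 - y) ^ (m + 1) * ∑ j ∈ Finset.range (m + 1), ((m + j).choose j : ℝ) * y ^ j

/-- With `S` the sum `∑_{j < N} binom(m+j, j) y^j`, the expression `(1 - y) S' - (m + 1) S` telescopes
to its boundary term. -/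
lemma choose_sum_telescope (m N : ℕ) (y : ℝ) :
    (1 - y) * ∑ j ∈ Finset.range N, ((m + j).choose j : ℝ) * (j * y ^ (j - 1)) -
      (m + 1) * ∑ j ∈ Finset.range N, ((m + j).choose j : ℝ) * y ^ j =
      -(N * (m + N).choose N) * y ^ (N - 1) := by
  induction N with
  | zero => simp
  | succ N ih =>
    rw [Finset.sum_range_succ, Finset.sum_range_succ]
    have h1 : ((N : ℝ) + 1) * ((m + (N + 1)).choose (N + 1) : ℝ) =
        (m + N + 1) * ((m + N).choose N : ℝ) := by
      have h2 : (((m + N + 1) * (m + N).choose N : ℕ) : ℝ) =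
        (((m + N + 1).choose (N + 1) * (N + 1) : ℕ) : ℝ) := by rw [Nat.add_one_mul_choose_eq]
      push_cast at h2
      rw [show m + (N + 1) = m + N + 1 by ring]
      linarith
    have h3 : (N : ℝ) * y ^ (N - 1) * y = N * y ^ N := by
      rcases N with _ | N
      · simp
      · simp only [Nat.add_sub_cancel]; ring
    simp only [Nat.add_sub_cancel]
    push_cast
    rw [h1]
    linear_combination ih - ((m + N).choose N : ℝ) * h3

/-- The derivative is symmetric under `y ↦ 1 - y`, which is the source of the halfband property, and
vanishes to order `m` at both ends. -/
lemma hasDerivAt_halfbandPoly (m : ℕ) (y : ℝ) :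
    HasDerivAt (halfbandPoly m)
      (-((m + 1) * (2 * m + 1).choose (m + 1)) * (y ^ m * (1 - y) ^ m)) y := by
  have h1 : HasDerivAt (fun y : ℝ => ∑ j ∈ Finset.range (m + 1), ((m + j).choose j : ℝ) * y ^ j)
      (∑ j ∈ Finset.range (m + 1), ((m + j).choose j : ℝ) * (j * y ^ (j - 1))) y :=
    HasDerivAt.fun_sum fun j _ => (hasDerivAt_pow j y).const_mul _
  have h2 : HasDerivAt (fun y : ℝ => (1 - y) ^ (m + 1)) (((m + 1 : ℕ) : ℝ) * (1 - y) ^ m * (-1)) y := by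
    have := ((hasDerivAt_id y).const_sub 1).fun_pow (m + 1)
    simpa using this
  have h := h2.mul h1
  convert! h using 1
  have := choose_sum_telescope m (m + 1) y
  rw [show m + (m + 1) = 2 * m + 1 by ring, Nat.add_sub_cancel] at this
  push_cast at this ⊢
  linear_combination -(1 - y) ^ m * this

lemma halfbandPoly_add (m : ℕ) (y : ℝ) : halfbandPoly m y + halfbandPoly m (1 - y) = 1 := by
  have hd : ∀ y, HasDerivAt (fun y => halfbandPoly m y + halfbandPoly m (1 - y)) 0 y := by
    intro y
    have h2 := (hasDerivAt_halfbandPoly m (1 - y)).comp y ((hasDerivAt_id y).const_sub 1)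
    have h := (hasDerivAt_halfbandPoly m y).add h2
    convert! h using 1
    ring
  have hc := is_const_of_deriv_eq_zero (fun y => (hd y).differentiableAt) (fun y => (hd y).deriv) y 0
  have h0 : halfbandPoly m 0 = 1 := by
    unfold halfbandPoly
    rw [Finset.sum_range_succ']
    simp
  have h1 : halfbandPoly m 1 = 0 := by simp [halfbandPoly]
  simpa [h0, h1] using hc

lemma interpolatorySymbol_eq (m : ℕ) (ω : ℝ) :
    interpolatorySymbol (m + 1) ω = halfbandPoly m (Real.sin (ω / 2) ^ 2) := by
  unfold interpolatorySymbol halfbandPoly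
  rw [pow_mul, Real.cos_sq']
  simp [pow_mul]

lemma interpolatorySymbol_add_pi (m : ℕ) (ω : ℝ) :
    interpolatorySymbol (m + 1) (ω + Real.pi) =
      halfbandPoly m (1 - Real.sin (ω / 2) ^ 2) := by
  rw [interpolatorySymbol_eq, add_div, Real.sin_add_pi_div_two, Real.cos_sq']

/-- The interpolatory filter is a halfband filter. -/
lemma interpolatorySymbol_add {n : ℕ} (hn : 0 < n) (ω : ℝ) :
    interpolatorySymbol n ω + interpolatorySymbol n (ω + Real.pi) = 1 := by
  obtain ⟨m, rfl⟩ := Nat.exists_eq_succ_of_ne_zero hn.ne'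
  rw [Nat.succ_eq_add_one, interpolatorySymbol_add_pi, interpolatorySymbol_eq, halfbandPoly_add]

lemma interpolatorySymbol_neg (n : ℕ) (ω : ℝ) :
    interpolatorySymbol n (-ω) = interpolatorySymbol n ω := by
  unfold interpolatorySymbol
  rw [neg_div, Real.cos_neg]
  simp [pow_mul]

lemma interpolatorySymbol_zero {n : ℕ} (hn : 0 < n) : interpolatorySymbol n 0 = 1 := by
  obtain ⟨m, rfl⟩ := Nat.exists_eq_succ_of_ne_zero hn.ne'
  unfold interpolatorySymbol
  rw [Finset.sum_range_succ']
  simp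

/-- The even function `2 a^I(ω) - 1`, equal to `a^I(ω) - a^I(ω + π)` by the halfband property. -/
def halfbandDiff (n : ℕ) (ω : ℝ) : ℝ := 2 * interpolatorySymbol n ω - 1

lemma halfbandDiff_neg (n : ℕ) (ω : ℝ) : halfbandDiff n (-ω) = halfbandDiff n ω := by
  simp [halfbandDiff, interpolatorySymbol_neg]

lemma halfbandDiff_add_pi {n : ℕ} (hn : 0 < n) (ω : ℝ) :
    halfbandDiff n (ω + Real.pi) = -halfbandDiff n ω := by
  have := interpolatorySymbol_add hn ω
  unfold halfbandDiff
  linarith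

lemma halfbandDiff_zero {n : ℕ} (hn : 0 < n) : halfbandDiff n 0 = 1 := by
  simp [halfbandDiff, interpolatorySymbol_zero hn]
  norm_num

lemma symbol1_lowpassU_eq {n : ℕ} (hn : 0 < n) (ω : ℝ) :
    symbol1 (lowpassU n) ω =
      (halfbandDiff n (ω / 2) : ℂ) * Complex.exp (-Complex.I * (ω / 2 : ℝ)) := by
  rw [symbol1_lowpassU]
  congr 1
  have := interpolatorySymbol_add hn (ω / 2)
  rw [← Complex.ofReal_sub]
  congr 1
  unfold halfbandDiff
  linarith

/-- The zero-phase factor of the low-pass symbol. -/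
def zeroPhase (n : ℕ) (ω : Fin 2 → ℝ) : ℝ :=
  (halfbandDiff n ((ω 0 + ω 1) / 2) + halfbandDiff n ((ω 0 - ω 1) / 2)) / 2

lemma symbol2_lowpass_eq {n : ℕ} (hn : 0 < n) (ω : Fin 2 → ℝ) :
    symbol2 (lowpass n) ω =
      Complex.exp (-Complex.I * ((ω 0 + ω 1) / 2 : ℝ)) * zeroPhase n ω := by
  rw [symbol2_lowpass, symbol1_lowpassU_eq hn, symbol1_lowpassU_eq hn, mul_assoc _ _ (Complex.exp _),
    ← Complex.exp_add]
  rw [show -Complex.I * (((ω 0 - ω 1) / 2 : ℝ) : ℂ) + -Complex.I * ((ω 1 : ℝ) : ℂ) =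
    -Complex.I * ((ω 0 + ω 1) / 2 : ℝ) by push_cast; ring]
  unfold zeroPhase
  push_cast
  ring

lemma symbol2_lowpass_zero {n : ℕ} (hn : 0 < n) : symbol2 (lowpass n) 0 = 1 := by
  rw [symbol2_lowpass_eq hn]
  simp [zeroPhase, halfbandDiff_zero hn]

lemma zeroPhase_add_pi {n : ℕ} (hn : 0 < n) (ω : Fin 2 → ℝ) :
    zeroPhase n (ω + ![Real.pi, Real.pi]) =
      (halfbandDiff n ((ω 0 - ω 1) / 2) - halfbandDiff n ((ω 0 + ω 1) / 2)) / 2 := by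
  unfold zeroPhase
  simp only [Pi.add_apply, Matrix.cons_val_zero, Matrix.cons_val_one]
  rw [show (ω 0 + Real.pi + (ω 1 + Real.pi)) / 2 = (ω 0 + ω 1) / 2 + Real.pi by ring,
    halfbandDiff_add_pi hn]
  rw [show (ω 0 + Real.pi - (ω 1 + Real.pi)) / 2 = (ω 0 - ω 1) / 2 by ring]
  ring

/-! ### The tight filter bank -/

lemma norm_exp_neg_I_mul (t : ℝ) : ‖Complex.exp (-Complex.I * (t : ℂ))‖ = 1 := by
  rw [show -Complex.I * (t : ℂ) = ((-t : ℝ) : ℂ) * Complex.I by push_cast; ring,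
    Complex.norm_exp_ofReal_mul_I]

lemma exp_neg_I_mul_add_pi (t : ℝ) :
    Complex.exp (-Complex.I * ((t + Real.pi : ℝ) : ℂ)) = -Complex.exp (-Complex.I * (t : ℂ)) := by
  have := exp_add_pi 1 t
  simpa using this

lemma symbol2_cross_add_pi (p : Filter1) (ω : Fin 2 → ℝ) :
    symbol2 (cross p) (ω + ![Real.pi, Real.pi]) =
      1 / 2 * (symbol1 p (ω 0 + ω 1) -
        symbol1 p (ω 0 - ω 1) * Complex.exp (-Complex.I * (ω 1 : ℝ))) := by
  rw [symbol2_cross]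
  simp only [Pi.add_apply, Matrix.cons_val_zero, Matrix.cons_val_one]
  rw [show ω 0 + Real.pi + (ω 1 + Real.pi) = ω 0 + ω 1 + Real.pi + Real.pi by ring, symbol1_two_pi,
    show ω 0 + Real.pi - (ω 1 + Real.pi) = ω 0 - ω 1 by ring, exp_neg_I_mul_add_pi]
  ring

lemma symbol2_add_pi_add_pi (a : Filter2) (ω : Fin 2 → ℝ) :
    symbol2 a (ω + ![Real.pi, Real.pi] + ![Real.pi, Real.pi]) = symbol2 a ω := by
  have h : ∀ k : Fin 2 → ℤ,
      Complex.exp (-Complex.I * (∑ i, (k i : ℝ) *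
        (ω + ![Real.pi, Real.pi] + ![Real.pi, Real.pi] : Fin 2 → ℝ) i : ℝ)) =
      Complex.exp (-Complex.I * (∑ i, (k i : ℝ) * ω i : ℝ)) := by
    intro k
    refine Complex.exp_eq_exp_iff_exists_int.2 ⟨-(k 0 + k 1), ?_⟩
    rw [Fin.sum_univ_two, Fin.sum_univ_two]
    simp only [Pi.add_apply, Matrix.cons_val_zero, Matrix.cons_val_one]
    push_cast
    ring
  unfold symbol2
  simp only [h]

/-- The two branches of `cross` change their relative sign under the shift by `(π, π)`, so the
parallelogram law applies. -/
lemma norm_sq_symbol2_cross (p : Filter1) (ω : Fin 2 → ℝ) :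
    ‖symbol2 (cross p) ω‖ ^ 2 + ‖symbol2 (cross p) (ω + ![Real.pi, Real.pi])‖ ^ 2 =
      (‖symbol1 p (ω 0 + ω 1)‖ ^ 2 + ‖symbol1 p (ω 0 - ω 1)‖ ^ 2) / 2 := by
  rw [symbol2_cross_add_pi, symbol2_cross, norm_mul, norm_mul]
  have h := parallelogram_law_with_norm ℂ (symbol1 p (ω 0 + ω 1))
    (symbol1 p (ω 0 - ω 1) * Complex.exp (-Complex.I * (ω 1 : ℝ)))
  rw [norm_mul (symbol1 p (ω 0 - ω 1)), norm_exp_neg_I_mul] at h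
  rw [show ‖(1 / 2 : ℂ)‖ = 1 / 2 by norm_num]
  linear_combination h / 4

lemma norm_sq_lowpassU_add_highpassV {n : ℕ} (hn : 0 < n) {aD : Filter1}
    (hD : ∀ ω : ℝ, ‖symbol1 aD ω‖ ^ 2 = interpolatorySymbol n ω) (ω : ℝ) :
    ‖symbol1 (lowpassU n) ω‖ ^ 2 + ‖symbol1 (highpassV aD) ω‖ ^ 2 = 1 := by
  rw [symbol1_lowpassU_eq hn, symbol1_highpassV, norm_mul, norm_mul, norm_mul, mul_pow, mul_pow,
    mul_pow, hD, hD, norm_exp_neg_I_mul, Complex.norm_real, Real.norm_eq_abs, sq_abs]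
  have := interpolatorySymbol_add hn (ω / 2)
  rw [show interpolatorySymbol n (ω / 2 + Real.pi) = 1 - interpolatorySymbol n (ω / 2) by linarith]
  unfold halfbandDiff
  norm_num
  ring

/-- The only nonzero element of `Ω_M` is `(1/2, 1/2)`. -/
lemma mem_Omega_quincunxM {ξ : Fin 2 → ℝ} (hξ : ξ ∈ Omega quincunxM) (h0 : ξ ≠ 0) :
    ξ = ![1 / 2, 1 / 2] := by
  obtain ⟨⟨k, hk⟩, hI⟩ := hξ
  have hdet : IsUnit ((toReal quincunxM)ᵀ).det := by
    simp [quincunxM, Matrix.det_fin_two]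
    norm_num
  have h2 : (toReal quincunxM)ᵀ *ᵥ ξ = fun i => (k i : ℝ) := by
    rw [hk, Matrix.mulVec_mulVec, Matrix.mul_nonsing_inv _ hdet, Matrix.one_mulVec]
  have e0 : ξ 0 + ξ 1 = k 0 := by
    have := congrFun h2 0
    simpa [quincunxM, Matrix.mulVec, dotProduct, Fin.sum_univ_two] using this
  have e1 : ξ 0 - ξ 1 = k 1 := by
    have := congrFun h2 1
    simpa [quincunxM, Matrix.mulVec, dotProduct, Fin.sum_univ_two, sub_eq_add_neg] using this
  have i0 := hI 0
  have i1 := hI 1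
  simp only [Set.mem_Ico] at i0 i1
  have b1 : k 1 < 1 := by exact_mod_cast (by linarith : (k 1 : ℝ) < 1)
  have b2 : -1 < k 1 := by exact_mod_cast (by push_cast; linarith : ((-1 : ℤ) : ℝ) < (k 1 : ℝ))
  have b3 : k 0 < 2 := by exact_mod_cast (by push_cast; linarith : (k 0 : ℝ) < (2 : ℤ))
  have b4 : -1 < k 0 := by exact_mod_cast (by push_cast; linarith : ((-1 : ℤ) : ℝ) < (k 0 : ℝ))
  have hk1 : k 1 = 0 := by omega
  have hk0 : k 0 ≠ 0 := by
    intro h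
    apply h0
    rw [h] at e0; rw [hk1] at e1
    push_cast at e0 e1
    ext i
    fin_cases i
    · change ξ 0 = 0; linarith
    · change ξ 1 = 0; linarith
  have hk0' : k 0 = 1 := by omega
  rw [hk0'] at e0; rw [hk1] at e1
  push_cast at e0 e1
  ext i
  fin_cases i
  · change ξ 0 = 1 / 2; linarith
  · change ξ 1 = 1 / 2; linarith

lemma two_pi_smul_half : (2 * Real.pi) • (![1 / 2, 1 / 2] : Fin 2 → ℝ) = ![Real.pi, Real.pi] := by
  ext i
  fin_cases i <;> (simp; ring)

/-- A pair of filters and their canonical partners form a double canonical tight filter bank as soon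
as the squared moduli of the two symbols and of their shifts by `(π, π)` add up to `1`. -/
lemma isDoubleCanonical_of_norm_sq {a b : Filter2}
    (h : ∀ ω : Fin 2 → ℝ, ‖symbol2 a ω‖ ^ 2 + ‖symbol2 a (ω + ![Real.pi, Real.pi])‖ ^ 2 +
      (‖symbol2 b ω‖ ^ 2 + ‖symbol2 b (ω + ![Real.pi, Real.pi])‖ ^ 2) = 1) :
    IsDoubleCanonical a (mate a) b (mate b) := by
  have hm : ∀ (c : Filter2) ω, conj (symbol2 (mate c) ω) *
      symbol2 (mate c) (ω + ![Real.pi, Real.pi]) =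
      -(conj (symbol2 c ω) * symbol2 c (ω + ![Real.pi, Real.pi])) := by
    intro c ω
    rw [isCanonicalPair_mate, isCanonicalPair_mate, symbol2_add_pi_add_pi]
    simp only [Pi.add_apply, Matrix.cons_val_zero]
    rw [exp_neg_I_mul_add_pi, map_mul, Complex.conj_conj]
    have : conj (Complex.exp (-Complex.I * (ω 0 : ℝ))) * Complex.exp (-Complex.I * (ω 0 : ℝ)) = 1 := by
      rw [← Complex.normSq_eq_conj_mul_self, Complex.normSq_eq_norm_sq, norm_exp_neg_I_mul]
      simp
    linear_combination -(symbol2 c (ω + ![Real.pi, Real.pi]) * conj (symbol2 c ω)) * this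
  refine ⟨⟨fun ω => ?_, fun ξ hξ h0 ω => ?_⟩, isCanonicalPair_mate a, isCanonicalPair_mate b⟩
  · rw [Fin.sum_univ_three]
    simp only [Matrix.cons_val_zero, Matrix.cons_val_one, Matrix.cons_val]
    rw [isCanonicalPair_mate a, isCanonicalPair_mate b, norm_mul, norm_mul, norm_exp_neg_I_mul,
      one_mul, one_mul, RCLike.norm_conj, RCLike.norm_conj]
    linarith [h ω]
  · rw [mem_Omega_quincunxM hξ h0, two_pi_smul_half, Fin.sum_univ_three]
    simp only [Matrix.cons_val_zero, Matrix.cons_val_one, Matrix.cons_val]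
    rw [hm, hm]
    ring

lemma isDoubleCanonical_lowpass_highpass {n : ℕ} (hn : 0 < n) {aD : Filter1}
    (hD : ∀ ω : ℝ, ‖symbol1 aD ω‖ ^ 2 = interpolatorySymbol n ω) :
    IsDoubleCanonical (lowpass n) (mate (lowpass n)) (highpass aD) (mate (highpass aD)) := by
  refine isDoubleCanonical_of_norm_sq fun ω => ?_
  unfold lowpass highpass
  rw [norm_sq_symbol2_cross, norm_sq_symbol2_cross]
  linear_combination (norm_sq_lowpassU_add_highpassV hn hD (ω 0 + ω 1) +
    norm_sq_lowpassU_add_highpassV hn hD (ω 0 - ω 1)) / 2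

/-! ### Uniqueness of symbols and correlations -/

/-- Finite combinations of distinct unitary characters vanish only trivially. -/
lemma eq_zero_of_sum_mul_exp_eq_zero {ι E : Type*} [AddCommGroup E] (L : ι → E →+ ℝ)
    (hL : ∀ k l, k ≠ l → ∃ ω, L k ω - L l ω = Real.pi) (a : ι →₀ ℂ)
    (h : ∀ ω, (a.sum fun k c => c * Complex.exp (-Complex.I * (L k ω : ℝ))) = 0) : a = 0 := by
  let χ : ι → (Multiplicative E →* ℂ) := fun k =>
    { toFun := fun ω => Complex.exp (-Complex.I * (L k ω.toAdd : ℝ))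
      map_one' := by simp
      map_mul' := fun x y => by
        rw [← Complex.exp_add, toAdd_mul, map_add]
        congr 1
        push_cast
        ring }
  have hχ : Function.Injective χ := by
    intro k l hkl
    by_contra hne
    obtain ⟨ω, hω⟩ := hL k l hne
    have h1 : Complex.exp (-Complex.I * (L k ω : ℝ)) = Complex.exp (-Complex.I * (L l ω : ℝ)) :=
      DFunLike.congr_fun hkl (Multiplicative.ofAdd ω)
    rw [show L k ω = L l ω + Real.pi by linarith, exp_neg_I_mul_add_pi] at h1
    have h2 := Complex.exp_ne_zero (-Complex.I * (L l ω : ℝ))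
    exact h2 (by linear_combination -h1 / 2)
  have hli := (linearIndependent_monoidHom (Multiplicative E) ℂ).comp χ hχ
  rw [linearIndependent_iff] at hli
  apply hli
  ext ω
  rw [Finsupp.linearCombination_apply, Finsupp.sum, Finset.sum_apply]
  exact h ω.toAdd

lemma symbol1_injective : Function.Injective symbol1 := by
  intro p q hpq
  rw [← sub_eq_zero]
  refine eq_zero_of_sum_mul_exp_eq_zero (fun k : ℤ => AddMonoidHom.mulLeft (k : ℝ)) ?_ _ ?_
  · intro k l hkl
    have : (k : ℝ) - l ≠ 0 := sub_ne_zero.2 (by exact_mod_cast hkl)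
    refine ⟨Real.pi / (k - l), ?_⟩
    simp only [AddMonoidHom.coe_mulLeft]
    field_simp
  · intro ω
    have h1 : symbol1 (p - q) ω = 0 := by
      rw [sub_eq_add_neg, symbol1_add, ← neg_one_smul ℂ, symbol1_smul, hpq]
      ring
    exact h1

/-- The linear form `ω ↦ k · ω`. -/
def dotHom (k : Fin 2 → ℤ) : (Fin 2 → ℝ) →+ ℝ :=
  AddMonoidHom.mk' (fun ω => ∑ i, (k i : ℝ) * ω i) fun x y => by
    simp only [Fin.sum_univ_two, Pi.add_apply]
    ring

lemma symbol2_add (a b : Filter2) (ω : Fin 2 → ℝ) :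
    symbol2 (a + b) ω = symbol2 a ω + symbol2 b ω := by
  unfold symbol2
  exact Finsupp.sum_add_index' (by simp) (by intros; ring)

lemma symbol2_smul (r : ℂ) (a : Filter2) (ω : Fin 2 → ℝ) :
    symbol2 (r • a) ω = r * symbol2 a ω := by
  unfold symbol2
  rw [Finsupp.sum_smul_index (by simp), Finsupp.mul_sum]
  simp [mul_assoc]

lemma symbol2_injective : Function.Injective symbol2 := by
  intro p q hpq
  rw [← sub_eq_zero]
  refine eq_zero_of_sum_mul_exp_eq_zero dotHom ?_ _ ?_
  · intro k l hkl
    obtain ⟨i, hi⟩ := Function.ne_iff.1 hkl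
    have : (k i : ℝ) - l i ≠ 0 := sub_ne_zero.2 (by exact_mod_cast hi)
    refine ⟨Pi.single i (Real.pi / (k i - l i)), ?_⟩
    simp only [dotHom, AddMonoidHom.mk'_apply, Pi.single_apply, mul_ite, mul_zero,
      Finset.sum_ite_eq', Finset.mem_univ, if_true]
    field_simp
  · intro ω
    have h1 : symbol2 (p - q) ω = 0 := by
      rw [sub_eq_add_neg, symbol2_add, ← neg_one_smul ℂ, symbol2_smul, hpq]
      ring
    exact h1

/-- The correlation `∑_{j,m} p(j) conj(q(m)) δ_{j-m}`, with symbol `p conj q`. -/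
def correlation {G : Type*} [AddCommGroup G] (p q : G →₀ ℂ) : G →₀ ℂ :=
  p.sum fun j c => q.sum fun m d => Finsupp.single (j - m) (c * conj d)

lemma correlation_sum_mul {G : Type*} [AddCommGroup G] (p q : G →₀ ℂ) (e : G → ℂ)
    (he : ∀ j m, e (j - m) = e j * conj (e m)) :
    ((correlation p q).sum fun k c => c * e k) =
      (p.sum fun k c => c * e k) * conj (q.sum fun k c => c * e k) := by
  unfold correlation
  rw [Finsupp.sum_sum_index (by simp) (by intros; ring)]
  simp only [Finsupp.sum_sum_index (h := fun k c => c * e k) (by simp) (by intros; ring)]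
  have h : ∀ j c m d, ((Finsupp.single (j - m) (c * conj d)).sum fun k c => c * e k) =
      c * e j * conj (d * e m) := by
    intro j c m d
    rw [Finsupp.sum_single_index (by simp), he, map_mul]
    ring
  simp only [h]
  unfold Finsupp.sum
  rw [map_sum, Finset.sum_mul_sum]

lemma symbol1_correlation (p q : Filter1) (ω : ℝ) :
    symbol1 (correlation p q) ω = symbol1 p ω * conj (symbol1 q ω) := by
  refine correlation_sum_mul p q _ fun j m => ?_
  rw [← Complex.exp_conj, ← Complex.exp_add]
  congr 1
  simp
  ring

lemma symbol2_correlation (p q : Filter2) (ω : Fin 2 → ℝ) :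
    symbol2 (correlation p q) ω = symbol2 p ω * conj (symbol2 q ω) := by
  refine correlation_sum_mul p q _ fun j m => ?_
  rw [← Complex.exp_conj, ← Complex.exp_add]
  congr 1
  simp [Fin.sum_univ_two]
  ring

/-! ### Coefficients, reality and symmetry of the filters -/

lemma cross_apply (p : Filter1) (k : Fin 2 → ℤ) :
    cross p k = 1 / 2 * ((if k 1 = k 0 then p (k 0) else 0) +
      (if k 1 = 1 - k 0 then p (k 0) else 0)) := by
  have h : ∀ g : ℤ → ℤ, (p.mapDomain (fun j => (![j, g j] : Fin 2 → ℤ))) k =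
      if k 1 = g (k 0) then p (k 0) else 0 := by
    intro g
    have hinj : Function.Injective (fun j => (![j, g j] : Fin 2 → ℤ)) := fun x y hxy => by
      simpa using congrFun hxy 0
    split_ifs with hk
    · have e : k = (fun j => (![j, g j] : Fin 2 → ℤ)) (k 0) := by
        ext i; fin_cases i
        · rfl
        · exact hk
      conv_lhs => rw [e]
      exact Finsupp.mapDomain_apply hinj _ _
    · refine Finsupp.mapDomain_of_notMem_range _ _ ?_
      rintro ⟨j, rfl⟩
      exact hk (by simp)
  unfold cross
  rw [Finsupp.smul_apply, Finsupp.add_apply, h (fun j => j), h (fun j => 1 - j), smul_eq_mul]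

lemma cross_vec_apply (p : Filter1) (k₁ k₂ : ℤ) :
    cross p ![k₁, k₂] = 1 / 2 * ((if k₂ = k₁ then p k₁ else 0) +
      (if k₂ = 1 - k₁ then p k₁ else 0)) :=
  cross_apply p ![k₁, k₂]

lemma cross_reflect_snd (p : Filter1) (k₁ k₂ : ℤ) : cross p ![k₁, 1 - k₂] = cross p ![k₁, k₂] := by
  rw [cross_vec_apply, cross_vec_apply, add_comm]
  congr 3
  · exact propext ⟨fun h => by omega, fun h => by omega⟩
  · exact propext ⟨fun h => by omega, fun h => by omega⟩

lemma cross_reflect_fst {p : Filter1} (hp : ∀ j, p (1 - j) = p j) (k₁ k₂ : ℤ) :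
    cross p ![1 - k₁, k₂] = cross p ![k₁, k₂] := by
  rw [cross_vec_apply, cross_vec_apply, add_comm, hp]
  congr 3
  exact propext ⟨fun h => by omega, fun h => by omega⟩

lemma cross_swap {p : Filter1} (hp : ∀ j, p (1 - j) = p j) (k₁ k₂ : ℤ) :
    cross p ![k₂, k₁] = cross p ![k₁, k₂] := by
  rw [cross_vec_apply, cross_vec_apply]
  congr 2
  · by_cases h : k₁ = k₂
    · rw [h]
    · rw [if_neg h, if_neg (Ne.symm h)]
  · by_cases h : k₁ = 1 - k₂
    · rw [if_pos h, if_pos (by omega), h, hp]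
    · rw [if_neg h, if_neg (by omega)]

lemma IsRealFilter.cross {p : Filter1} (hp : IsRealFilter p) : IsRealFilter (cross p) := by
  intro k
  rw [cross_apply]
  have h1 := hp (k 0)
  split_ifs <;> simp [h1]

lemma IsRealFilter.mate {a : Filter2} (ha : IsRealFilter a) : IsRealFilter (mate a) := by
  intro k
  have h1 : (Quincunx.mate a) k = (-1 : ℂ) ^ (1 + k 0 + k 1) * conj (a ![1 - k 0, -k 1]) := rfl
  rw [h1]
  have h2 := ha ![1 - k 0, -k 1]
  rcases Int.even_or_odd (1 + k 0 + k 1) with h | h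
  · rw [h.neg_one_zpow]; simp [h2]
  · rw [h.neg_one_zpow]; simp [h2]

lemma mate_apply (a : Filter2) (k₁ k₂ : ℤ) :
    mate a ![k₁, k₂] = (-1 : ℂ) ^ (1 + k₁ + k₂) * conj (a ![1 - k₁, -k₂]) := rfl

/-- A one-dimensional filter whose symbol is real and even has real coefficients and is
symmetric. -/
lemma symbol1_real_even {p : Filter1} {f : ℝ → ℝ} (hp : ∀ ω, symbol1 p ω = f ω)
    (hf : ∀ ω, f (-ω) = f ω) : IsRealFilter p ∧ ∀ j, p (-j) = p j := by
  have hexp : ∀ (k : ℤ) (ω : ℝ), Complex.exp (-Complex.I * (((-k : ℤ) : ℝ) * ω : ℝ)) =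
      Complex.exp (-Complex.I * ((k : ℝ) * (-ω) : ℝ)) := by
    intro k ω
    congr 2
    push_cast
    ring
  have hconj : ∀ (k : ℤ) (ω : ℝ), Complex.exp (-Complex.I * ((k : ℝ) * ω : ℝ)) =
      conj (Complex.exp (-Complex.I * ((k : ℝ) * (-ω) : ℝ))) := by
    intro k ω
    rw [← Complex.exp_conj]
    congr 1
    simp
  constructor
  · have h : p.mapRange conj (map_zero _) = p := by
      apply symbol1_injective
      ext ω
      have : symbol1 (p.mapRange conj (map_zero _)) ω = conj (symbol1 p (-ω)) := by
        unfold symbol1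
        rw [Finsupp.sum_mapRange_index (by simp)]
        unfold Finsupp.sum
        rw [map_sum]
        refine Finset.sum_congr rfl fun k _ => ?_
        rw [map_mul, ← hconj]
      rw [this, hp, hp, hf, Complex.conj_ofReal]
    intro k
    have := DFunLike.congr_fun h k
    rw [Finsupp.mapRange_apply] at this
    exact Complex.conj_eq_iff_im.1 this
  · have h : p.mapDomain (fun j => -j) = p := by
      apply symbol1_injective
      ext ω
      have : symbol1 (p.mapDomain (fun j => -j)) ω = symbol1 p (-ω) := by
        unfold symbol1
        rw [Finsupp.sum_mapDomain_index (by simp) (by intros; ring)]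
        simp only [hexp]
      rw [this, hp, hp, hf]
    intro j
    conv_lhs => rw [← h]
    exact Finsupp.mapDomain_apply neg_injective p j

lemma isRealFilter_interpolatory (n : ℕ) : IsRealFilter (interpolatory n) :=
  (symbol1_real_even (symbol1_interpolatory n) (interpolatorySymbol_neg n)).1

lemma interpolatory_neg (n : ℕ) (j : ℤ) : interpolatory n (-j) = interpolatory n j :=
  (symbol1_real_even (symbol1_interpolatory n) (interpolatorySymbol_neg n)).2 j

lemma lowpassU_apply (n : ℕ) (j : ℤ) : lowpassU n j = 2 * interpolatory n (2 * j - 1) := rfl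

lemma highpassV_apply (p : Filter1) (j : ℤ) : highpassV p j = 2 * selfProduct p (2 * j) := rfl

lemma isRealFilter_lowpassU (n : ℕ) : IsRealFilter (lowpassU n) := by
  intro j
  rw [lowpassU_apply]
  have := isRealFilter_interpolatory n (2 * j - 1)
  simp [this]

lemma lowpassU_reflect (n : ℕ) (j : ℤ) : lowpassU n (1 - j) = lowpassU n j := by
  rw [lowpassU_apply, lowpassU_apply, ← interpolatory_neg]
  congr 2
  ring

lemma selfProduct_apply (p : Filter1) (k : ℤ) :
    selfProduct p k = ∑ j ∈ p.support, ∑ m ∈ p.support,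
      if j + m = k then p j * (p m * (-1) ^ m) else 0 := by
  unfold selfProduct Finsupp.sum
  simp only [Finsupp.finsetSum_apply, Finsupp.single_apply]

lemma isRealFilter_highpassV {p : Filter1} (hp : IsRealFilter p) : IsRealFilter (highpassV p) := by
  intro j
  rw [highpassV_apply, selfProduct_apply]
  have : (∑ j' ∈ p.support, ∑ m ∈ p.support,
      if j' + m = 2 * j then p j' * (p m * (-1) ^ m) else 0).im = 0 := by
    rw [Complex.im_sum]
    refine Finset.sum_eq_zero fun i _ => ?_
    rw [Complex.im_sum]
    refine Finset.sum_eq_zero fun m _ => ?_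
    have h1 := hp i
    have h2 := hp m
    rcases Int.even_or_odd m with h | h
    · rw [h.neg_one_zpow]; split_ifs <;> simp [h1, h2]
    · rw [h.neg_one_zpow]; split_ifs <;> simp [h1, h2]
  simp [this]

lemma neg_one_zpow_of_even_sub {a b : ℤ} (h : Even (a - b)) : (-1 : ℂ) ^ a = (-1) ^ b := by
  rw [show a = a - b + b by ring, zpow_add₀ (by norm_num), h.neg_one_zpow, one_mul]

lemma neg_one_zpow_of_odd_sub {a b : ℤ} (h : Odd (a - b)) : (-1 : ℂ) ^ a = -(-1) ^ b := by
  rw [show a = a - b + b by ring, zpow_add₀ (by norm_num), h.neg_one_zpow]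
  ring_nf

lemma mate_reflect_snd {a : Filter2} (ha : ∀ k₁ k₂, a ![k₁, 1 - k₂] = a ![k₁, k₂]) (k₁ k₂ : ℤ) :
    mate a ![k₁, -1 - k₂] = -mate a ![k₁, k₂] := by
  rw [mate_apply, mate_apply, neg_one_zpow_of_odd_sub (b := 1 + k₁ + k₂) ⟨-k₂ - 1, by ring⟩,
    show -(-1 - k₂) = 1 - -k₂ by ring, ha]
  ring

lemma mate_reflect_fst {a : Filter2} (ha : ∀ k₁ k₂, a ![1 - k₁, k₂] = a ![k₁, k₂]) (k₁ k₂ : ℤ) :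
    mate a ![1 - k₁, k₂] = -mate a ![k₁, k₂] := by
  rw [mate_apply, mate_apply, neg_one_zpow_of_odd_sub (b := 1 + k₁ + k₂) ⟨-k₁, by ring⟩, ha]
  ring

lemma mate_swap {a : Filter2}
    (h₂ : ∀ k₁ k₂, a ![k₂, k₁] = a ![k₁, k₂]) (k₁ k₂ : ℤ) :
    mate a ![k₂ + 1, k₁ - 1] = mate a ![k₁, k₂] := by
  rw [mate_apply, mate_apply, neg_one_zpow_of_even_sub (b := 1 + k₁ + k₂) ⟨0, by ring⟩,
    show 1 - (k₂ + 1) = -k₂ by ring, show -(k₁ - 1) = 1 - k₁ by ring, h₂]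

lemma mulVec_two {R : Type*} [NonUnitalNonAssocSemiring R] (A : Matrix (Fin 2) (Fin 2) R)
    (x : Fin 2 → R) :
    A *ᵥ x = ![A 0 0 * x 0 + A 0 1 * x 1, A 1 0 * x 0 + A 1 1 * x 1] := by
  ext i
  fin_cases i <;> simp [Matrix.mulVec, dotProduct, Fin.sum_univ_two]

/-- The coordinate reflections and the swap generate `D₄`, so it suffices to know how a filter with
centre `(1/2, -1/2)` behaves under them. -/
lemma filterSymmetric_of_reflect_swap {b : Filter2}
    (h₁ : ∀ k₁ k₂, b ![1 - k₁, k₂] = -b ![k₁, k₂])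
    (h₂ : ∀ k₁ k₂, b ![k₁, -1 - k₂] = -b ![k₁, k₂])
    (h₃ : ∀ k₁ k₂, b ![k₂ + 1, k₁ - 1] = b ![k₁, k₂]) :
    FilterSymmetric b (fun E => diagSign E * E.det) ![1 / 2, -1 / 2] := by
  have h12 : ∀ k₁ k₂, b ![1 - k₁, -1 - k₂] = b ![k₁, k₂] := fun k₁ k₂ => by
    rw [h₁, h₂, neg_neg]
  have h31 : ∀ k₁ k₂, b ![k₂ + 1, -k₁] = -b ![k₁, k₂] := fun k₁ k₂ => by
    rw [← h₁, ← h₃ (1 - k₁) k₂, show 1 - k₁ - 1 = -k₁ by ring]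
  have h32 : ∀ k₁ k₂, b ![-k₂, k₁ - 1] = -b ![k₁, k₂] := fun k₁ k₂ => by
    rw [← h₂, ← h₃ k₁ (-1 - k₂), show -1 - k₂ + 1 = -k₂ by ring]
  have h312 : ∀ k₁ k₂, b ![-k₂, -k₁] = b ![k₁, k₂] := fun k₁ k₂ => by
    rw [← h12 k₁ k₂, ← h₃ (1 - k₁) (-1 - k₂), show -1 - k₂ + 1 = -k₂ by ring, show 1 - k₁ - 1 = -k₁ by ring]
  intro E hE k
  obtain ⟨k₁, k₂, rfl⟩ : ∃ k₁ k₂, k = ![k₁, k₂] := ⟨k 0, k 1, by ext i; fin_cases i <;> rfl⟩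
  have hp : ∀ l₁ l₂ : ℤ,
      (l₁ : ℝ) = E 0 0 * (k₁ - 1 / 2) + E 0 1 * (k₂ + 1 / 2) + 1 / 2 →
      (l₂ : ℝ) = E 1 0 * (k₁ - 1 / 2) + E 1 1 * (k₂ + 1 / 2) - 1 / 2 →
      (fun i => ((![l₁, l₂] : Fin 2 → ℤ) i : ℝ)) =
        toReal E *ᵥ ((fun i => ((![k₁, k₂] : Fin 2 → ℤ) i : ℝ)) - ![1 / 2, -1 / 2]) +
          ![1 / 2, -1 / 2] := by
    intro l₁ l₂ e₁ e₂
    rw [mulVec_two]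
    ext i
    fin_cases i
    · simp only [Fin.zero_eta, Matrix.cons_val_zero, e₁, Matrix.map_apply, Pi.sub_apply,
        Matrix.cons_val_one, Pi.add_apply]
      ring
    · simp only [Fin.mk_one, Matrix.cons_val_zero, e₂, Matrix.map_apply, Pi.sub_apply,
        Matrix.cons_val_one, Pi.add_apply]
      ring
  rcases hE with rfl | rfl | rfl | rfl | rfl | rfl | rfl | rfl
  · exact ⟨_, hp k₁ k₂ (by simp) (by simp), by simp [diagSign]⟩
  · exact ⟨_, hp (1 - k₁) (-1 - k₂) (by simp; ring) (by simp; ring),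
      by rw [h12]; simp [diagSign, Matrix.det_fin_two]⟩
  · exact ⟨_, hp k₁ (-1 - k₂) (by simp) (by simp; ring),
      by rw [h₂]; simp [diagSign, Matrix.det_fin_two]⟩
  · exact ⟨_, hp (1 - k₁) k₂ (by simp; ring) (by simp),
      by rw [h₁]; simp [diagSign, Matrix.det_fin_two]⟩
  · exact ⟨_, hp (k₂ + 1) (k₁ - 1) (by simp; ring) (by simp; ring),
      by rw [h₃]; simp [diagSign, Matrix.det_fin_two]⟩
  · exact ⟨_, hp (-k₂) (-k₁) (by simp) (by simp),
      by rw [h312]; simp [diagSign, Matrix.det_fin_two]⟩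
  · exact ⟨_, hp (k₂ + 1) (-k₁) (by simp; ring) (by simp),
      by rw [h31]; simp [diagSign, Matrix.det_fin_two]⟩
  · exact ⟨_, hp (-k₂) (k₁ - 1) (by simp) (by simp; ring),
      by rw [h32]; simp [diagSign, Matrix.det_fin_two]⟩

lemma filterSymmetric_mate_lowpass (n : ℕ) :
    FilterSymmetric (mate (lowpass n)) (fun E => diagSign E * E.det) ![1 / 2, -1 / 2] :=
  filterSymmetric_of_reflect_swap
    (mate_reflect_fst (cross_reflect_fst (lowpassU_reflect n)))
    (mate_reflect_snd (cross_reflect_snd _))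
    (mate_swap (cross_swap (lowpassU_reflect n)))

/-! ### Vanishing moments -/

lemma interpolatorySymbol_mem_Icc {n : ℕ} (hn : 0 < n) {aD : Filter1}
    (hD : ∀ ω : ℝ, ‖symbol1 aD ω‖ ^ 2 = interpolatorySymbol n ω) (ω : ℝ) :
    0 ≤ interpolatorySymbol n ω ∧ interpolatorySymbol n ω ≤ 1 := by
  have h1 := hD ω ▸ sq_nonneg ‖symbol1 aD ω‖
  have h2 := hD (ω + Real.pi) ▸ sq_nonneg ‖symbol1 aD (ω + Real.pi)‖
  have := interpolatorySymbol_add hn ω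
  exact ⟨h1, by linarith⟩

lemma exists_abs_interpolatorySymbol_le (n : ℕ) :
    ∃ K : ℝ, 0 ≤ K ∧ ∀ t, |interpolatorySymbol n (t / 2 + Real.pi)| ≤ K * |t| ^ (2 * n) := by
  refine ⟨∑ j ∈ Finset.range n, ((n - 1 + j).choose j : ℝ), by positivity, fun t => ?_⟩
  unfold interpolatorySymbol
  rw [abs_mul, mul_comm, abs_pow]
  refine mul_le_mul ?_ ?_ (by positivity) (by positivity)
  · refine (Finset.abs_sum_le_sum_abs _ _).trans (Finset.sum_le_sum fun j _ => ?_)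
    rw [abs_mul, Nat.abs_cast]
    refine mul_le_of_le_one_right (Nat.cast_nonneg _) ?_
    rw [abs_pow]
    exact pow_le_one₀ (abs_nonneg _) (Real.abs_sin_le_one _)
  · refine pow_le_pow_left₀ (abs_nonneg _) ?_ _
    rw [show (t / 2 + Real.pi) / 2 = t / 4 + Real.pi / 2 by ring, Real.cos_add_pi_div_two, abs_neg]
    refine Real.abs_sin_le_abs.trans ?_
    rw [abs_div, abs_of_pos (by norm_num : (0 : ℝ) < 4)]
    linarith [abs_nonneg t]

lemma exists_norm_highpassV_le {n : ℕ} (hn : 0 < n) {aD : Filter1}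
    (hD : ∀ ω : ℝ, ‖symbol1 aD ω‖ ^ 2 = interpolatorySymbol n ω) :
    ∃ K : ℝ, 0 ≤ K ∧ ∀ t, ‖symbol1 (highpassV aD) t‖ ≤ K * |t| ^ n := by
  obtain ⟨K, hK, h⟩ := exists_abs_interpolatorySymbol_le n
  refine ⟨2 * √K, by positivity, fun t => ?_⟩
  refine abs_le_of_sq_le_sq' ?_ (by positivity) |>.2
  rw [symbol1_highpassV, norm_mul, norm_mul, mul_pow, mul_pow, hD, hD, mul_pow, mul_pow,
    Real.sq_sqrt hK, ← pow_mul, mul_comm n 2]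
  have h1 := interpolatorySymbol_mem_Icc hn hD (t / 2)
  have h2 := (le_abs_self _).trans (h t)
  have h3 := interpolatorySymbol_mem_Icc hn hD (t / 2 + Real.pi)
  norm_num
  nlinarith [mul_le_mul_of_nonneg_right h1.2 h3.1]

lemma abs_add_le_two_mul_norm (ω : Fin 2 → ℝ) : |ω 0 + ω 1| ≤ 2 * ‖ω‖ := by
  have h0 := norm_le_pi_norm ω 0
  have h1 := norm_le_pi_norm ω 1
  rw [Real.norm_eq_abs] at h0 h1
  linarith [abs_add_le (ω 0) (ω 1)]

lemma abs_sub_le_two_mul_norm (ω : Fin 2 → ℝ) : |ω 0 - ω 1| ≤ 2 * ‖ω‖ := by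
  have h0 := norm_le_pi_norm ω 0
  have h1 := norm_le_pi_norm ω 1
  rw [Real.norm_eq_abs] at h0 h1
  linarith [abs_sub (ω 0) (ω 1)]

lemma hasVanishingMoments_of_bound {b : Filter2} {n : ℕ} {K : ℝ} (hK : 0 ≤ K)
    (h : ∀ ω : Fin 2 → ℝ, ‖ω‖ ≤ 1 → ‖symbol2 b ω‖ ≤ K * |ω 0 + ω 1| ^ n + K * |ω 0 - ω 1| ^ n) :
    HasVanishingMoments b n := by
  refine Asymptotics.IsBigO.of_bound (2 * K * 2 ^ n) ?_
  filter_upwards [Metric.closedBall_mem_nhds (0 : Fin 2 → ℝ) one_pos] with ω hω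
  rw [mem_closedBall_zero_iff] at hω
  refine (h ω hω).trans ?_
  have h1 : |ω 0 + ω 1| ^ n ≤ (2 * ‖ω‖) ^ n :=
    pow_le_pow_left₀ (abs_nonneg _) (abs_add_le_two_mul_norm ω) n
  have h2 : |ω 0 - ω 1| ^ n ≤ (2 * ‖ω‖) ^ n :=
    pow_le_pow_left₀ (abs_nonneg _) (abs_sub_le_two_mul_norm ω) n
  rw [norm_pow, norm_norm]
  rw [mul_pow] at h1 h2
  nlinarith [mul_le_mul_of_nonneg_left h1 hK, mul_le_mul_of_nonneg_left h2 hK]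

lemma norm_symbol2_mate (a : Filter2) (ω : Fin 2 → ℝ) :
    ‖symbol2 (mate a) ω‖ = ‖symbol2 a (ω + ![Real.pi, Real.pi])‖ := by
  rw [isCanonicalPair_mate, norm_mul, norm_exp_neg_I_mul, one_mul, RCLike.norm_conj]

/-- Since `|v(ω)|² = 4 a^I(ω/2) a^I(ω/2 + π)` vanishes to order `2n` at the origin, both `b₂` and its
partner inherit `n` vanishing moments; the shift by `(π, π)` only changes a sign in `cross`. -/
lemma hasVanishingMoments_highpass {n : ℕ} (hn : 0 < n) {aD : Filter1}
    (hD : ∀ ω : ℝ, ‖symbol1 aD ω‖ ^ 2 = interpolatorySymbol n ω) :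
    HasVanishingMoments (highpass aD) n ∧ HasVanishingMoments (mate (highpass aD)) n := by
  obtain ⟨K, hK, h⟩ := exists_norm_highpassV_le hn hD
  have key : ∀ ω : Fin 2 → ℝ, ‖symbol1 (highpassV aD) (ω 0 + ω 1)‖ + ‖symbol1 (highpassV aD)
      (ω 0 - ω 1) * Complex.exp (-Complex.I * (ω 1 : ℝ))‖ ≤
      K * |ω 0 + ω 1| ^ n + K * |ω 0 - ω 1| ^ n := by
    intro ω
    rw [norm_mul, norm_exp_neg_I_mul, mul_one]
    exact add_le_add (h _) (h _)
  constructor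
  · refine hasVanishingMoments_of_bound hK fun ω _ => le_trans ?_ (key ω)
    unfold highpass
    rw [symbol2_cross, norm_mul]
    have := norm_add_le (symbol1 (highpassV aD) (ω 0 + ω 1))
      (symbol1 (highpassV aD) (ω 0 - ω 1) * Complex.exp (-Complex.I * (ω 1 : ℝ)))
    rw [show ‖(1 / 2 : ℂ)‖ = 1 / 2 by norm_num]
    linarith [norm_nonneg (symbol1 (highpassV aD) (ω 0 + ω 1) +
      (symbol1 (highpassV aD) (ω 0 - ω 1) * Complex.exp (-Complex.I * (ω 1 : ℝ))))]
  · refine hasVanishingMoments_of_bound hK fun ω _ => le_trans ?_ (key ω)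
    rw [norm_symbol2_mate]
    unfold highpass
    rw [symbol2_cross_add_pi, norm_mul]
    have := norm_sub_le (symbol1 (highpassV aD) (ω 0 + ω 1))
      (symbol1 (highpassV aD) (ω 0 - ω 1) * Complex.exp (-Complex.I * (ω 1 : ℝ)))
    rw [show ‖(1 / 2 : ℂ)‖ = 1 / 2 by norm_num]
    linarith [norm_nonneg (symbol1 (highpassV aD) (ω 0 + ω 1) -
      (symbol1 (highpassV aD) (ω 0 - ω 1) * Complex.exp (-Complex.I * (ω 1 : ℝ))))]

lemma hasVanishingMoments_mate_lowpass {n : ℕ} (hn : 0 < n) :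
    HasVanishingMoments (mate (lowpass n)) n := by
  obtain ⟨K, hK, h⟩ := exists_abs_interpolatorySymbol_le n
  refine hasVanishingMoments_of_bound (K := K * 2 ^ n) (by positivity) fun ω hω => ?_
  rw [norm_symbol2_mate, symbol2_lowpass_eq hn, norm_mul, norm_exp_neg_I_mul, one_mul,
    zeroPhase_add_pi hn, Complex.norm_real, Real.norm_eq_abs]
  have e : (halfbandDiff n ((ω 0 - ω 1) / 2) - halfbandDiff n ((ω 0 + ω 1) / 2)) / 2 =
      interpolatorySymbol n ((ω 0 + ω 1) / 2 + Real.pi) -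
        interpolatorySymbol n ((ω 0 - ω 1) / 2 + Real.pi) := by
    have h1 := interpolatorySymbol_add hn ((ω 0 + ω 1) / 2)
    have h2 := interpolatorySymbol_add hn ((ω 0 - ω 1) / 2)
    unfold halfbandDiff
    linarith
  have hpow : ∀ t : ℝ, |t| ≤ 2 * ‖ω‖ → K * |t| ^ (2 * n) ≤ K * 2 ^ n * |t| ^ n := by
    intro t ht
    rw [two_mul, pow_add, mul_assoc]
    gcongr
    linarith
  rw [e]
  refine (abs_sub _ _).trans (add_le_add ?_ ?_)
  · exact (h _).trans (hpow _ (abs_add_le_two_mul_norm ω))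
  · exact (h _).trans (hpow _ (abs_sub_le_two_mul_norm ω))

/-! ### Supports -/

lemma hasDerivAt_interpolatorySymbol (m : ℕ) (ω : ℝ) :
    HasDerivAt (interpolatorySymbol (m + 1))
      (-((m + 1) * (2 * m + 1).choose (m + 1)) / 2 ^ (2 * m + 1) * Real.sin ω ^ (2 * m + 1)) ω := by
  have h1 : HasDerivAt (fun ω : ℝ => Real.sin (ω / 2) ^ 2)
      (Real.sin (ω / 2) * Real.cos (ω / 2)) ω := by
    have := (((hasDerivAt_id ω).div_const 2).sin).fun_pow 2
    convert! this using 1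
    simp
    ring
  have h2 := (hasDerivAt_halfbandPoly m (Real.sin (ω / 2) ^ 2)).comp ω h1
  rw [show interpolatorySymbol (m + 1) = halfbandPoly m ∘ fun ω => Real.sin (ω / 2) ^ 2 from
    funext (interpolatorySymbol_eq m)]
  convert! h2 using 1
  have e : Real.sin ω = 2 * (Real.sin (ω / 2) * Real.cos (ω / 2)) := by
    rw [← mul_assoc, ← Real.sin_two_mul]
    congr 1
    ring
  rw [e, ← Real.cos_sq', ← mul_pow, mul_pow 2, show Real.sin (ω / 2) ^ 2 * Real.cos (ω / 2) ^ 2 =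
    (Real.sin (ω / 2) * Real.cos (ω / 2)) ^ 2 by ring, ← pow_mul]
  field_simp
  ring

/-- The filter with symbol `(e^{iω} - e^{-iω})^N`. -/
def sinPowFilter (N : ℕ) : Filter1 :=
  ∑ r ∈ Finset.range (N + 1), Finsupp.single (2 * r - N : ℤ) ((-1) ^ r * (N.choose r : ℂ))

lemma symbol1_sinPowFilter (N : ℕ) (ω : ℝ) :
    symbol1 (sinPowFilter N) ω = (2 * Complex.I * Real.sin ω) ^ N := by
  have hs : 2 * Complex.I * (Real.sin ω : ℂ) =
      -Complex.exp (-Complex.I * ω) + Complex.exp (Complex.I * ω) := by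
    rw [Complex.ofReal_sin, Complex.sin]
    rw [show -(ω : ℂ) * Complex.I = -Complex.I * ω by ring, mul_comm (ω : ℂ) Complex.I]
    linear_combination (Complex.exp (-Complex.I * ω) - Complex.exp (Complex.I * ω)) * Complex.I_sq
  rw [hs, add_pow]
  unfold sinPowFilter
  rw [symbol1_sum]
  refine Finset.sum_congr rfl fun r hr => ?_
  have hr' : r ≤ N := by simpa [Nat.lt_succ_iff] using hr
  rw [symbol1_single, neg_pow (Complex.exp _), ← Complex.exp_nat_mul, ← Complex.exp_nat_mul,
    mul_assoc ((-1 : ℂ) ^ r) (Complex.exp _), ← Complex.exp_add]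
  rw [show (r : ℂ) * (-Complex.I * ω) + ((N - r : ℕ) : ℂ) * (Complex.I * ω) =
    -Complex.I * ((((2 * r - N : ℤ) : ℝ) * ω : ℝ) : ℂ) by
      push_cast [Nat.cast_sub hr']; ring]
  ring

lemma sinPowFilter_ne_zero_iff (N : ℕ) (k : ℤ) :
    sinPowFilter N k ≠ 0 ↔ ∃ r ≤ N, k = 2 * r - N := by
  unfold sinPowFilter
  rw [Finsupp.finsetSum_apply]
  constructor
  · intro h
    obtain ⟨r, hr, h0⟩ := Finset.exists_ne_zero_of_sum_ne_zero h
    refine ⟨r, by simpa [Nat.lt_succ_iff] using hr, ?_⟩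
    by_contra hk
    exact h0 (Finsupp.single_eq_of_ne hk)
  · rintro ⟨r, hr, rfl⟩
    rw [Finset.sum_eq_single r]
    · rw [Finsupp.single_eq_same]
      refine mul_ne_zero (pow_ne_zero _ (by norm_num)) ?_
      exact_mod_cast (Nat.choose_pos hr).ne'
    · intro s _ hs
      refine Finsupp.single_eq_of_ne fun h => hs ?_
      omega
    · intro h
      exact absurd (Finset.mem_range.2 (Nat.lt_succ_of_le hr)) h

lemma hasDerivAt_symbol1 (p : Filter1) (ω : ℝ) :
    HasDerivAt (symbol1 p)
      (p.sum fun k c => c * (-Complex.I * k * Complex.exp (-Complex.I * ((k : ℝ) * ω : ℝ)))) ω := by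
  unfold symbol1 Finsupp.sum
  refine HasDerivAt.fun_sum fun k _ => HasDerivAt.const_mul _ ?_
  have h1 : HasDerivAt (fun ω : ℝ => -Complex.I * (((k : ℝ) * ω : ℝ) : ℂ)) (-Complex.I * k) ω := by
    have := ((hasDerivAt_id ω).const_mul (k : ℝ)).ofReal_comp.const_mul (-Complex.I)
    simpa using this
  have := h1.cexp
  convert! this using 1
  ring

/-- The coefficients of the interpolatory filter are determined, away from the origin, by the fact
that the derivative of its symbol is a multiple of `sin^{2n-1}`. -/
lemma exists_mul_interpolatory_eq (m : ℕ) :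
    ∃ κ : ℂ, κ ≠ 0 ∧ ∀ k : ℤ, k * interpolatory (m + 1) k = κ * sinPowFilter (2 * m + 1) k := by
  set c : ℝ := -((m + 1) * (2 * m + 1).choose (m + 1)) / 2 ^ (2 * m + 1) with hc
  have hc0 : c ≠ 0 := by
    have h1 : (((2 * m + 1).choose (m + 1) : ℕ) : ℝ) ≠ 0 := by
      exact_mod_cast (Nat.choose_pos (by omega)).ne'
    have h2 : ((m : ℝ) + 1) ≠ 0 := by positivity
    rw [hc]
    exact div_ne_zero (neg_ne_zero.2 (mul_ne_zero h2 h1)) (by positivity)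
  have hI : (2 * Complex.I) ^ (2 * m + 1) ≠ 0 := pow_ne_zero _ (by simp)
  refine ⟨Complex.I * (c / (2 * Complex.I) ^ (2 * m + 1)), ?_, ?_⟩
  · exact mul_ne_zero Complex.I_ne_zero (div_ne_zero (by exact_mod_cast hc0) hI)
  let d : Filter1 := Finsupp.onFinset (interpolatory (m + 1)).support
    (fun k => -Complex.I * k * interpolatory (m + 1) k) fun k hk => by
      rw [Finsupp.mem_support_iff]
      exact fun h => hk (by simp [h])
  have hd : d = ((c : ℂ) / (2 * Complex.I) ^ (2 * m + 1)) • sinPowFilter (2 * m + 1) := by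
    apply symbol1_injective
    ext ω
    have h1 : symbol1 d ω = (interpolatory (m + 1)).sum fun k x =>
        x * (-Complex.I * k * Complex.exp (-Complex.I * ((k : ℝ) * ω : ℝ))) := by
      unfold symbol1
      rw [Finsupp.onFinset_sum _ (by simp)]
      refine Finset.sum_congr rfl fun k _ => ?_
      ring
    rw [h1, symbol1_smul, symbol1_sinPowFilter, mul_pow (2 * Complex.I), ← mul_assoc, div_mul_cancel₀ _ hI]
    have h2 := hasDerivAt_symbol1 (interpolatory (m + 1)) ω
    have h3 := (hasDerivAt_interpolatorySymbol m ω).ofReal_comp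
    rw [show symbol1 (interpolatory (m + 1)) = fun ω => (interpolatorySymbol (m + 1) ω : ℂ) from
      funext (symbol1_interpolatory (m + 1))] at h2
    rw [h2.unique h3, hc]
    push_cast
    ring
  intro k
  have hk := DFunLike.congr_fun hd k
  rw [Finsupp.smul_apply, smul_eq_mul] at hk
  have hk' : -Complex.I * k * interpolatory (m + 1) k =
      (c : ℂ) / (2 * Complex.I) ^ (2 * m + 1) * sinPowFilter (2 * m + 1) k := hk
  linear_combination Complex.I * hk' + (k : ℂ) * interpolatory (m + 1) k * Complex.I_sq

lemma interpolatory_eq_zero {n : ℕ} (hn : 0 < n) {k : ℤ} (hk : 2 * (n : ℤ) - 1 < k) :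
    interpolatory n k = 0 := by
  obtain ⟨m, rfl⟩ := Nat.exists_eq_succ_of_ne_zero hn.ne'
  obtain ⟨κ, -, h⟩ := exists_mul_interpolatory_eq m
  have h0 : sinPowFilter (2 * m + 1) k = 0 := by
    by_contra hne
    obtain ⟨r, hr, e⟩ := (sinPowFilter_ne_zero_iff _ _).1 hne
    push_cast at hk e
    omega
  have h1 := h k
  rw [h0, mul_zero] at h1
  refine (mul_eq_zero.1 h1).resolve_left ?_
  have : k ≠ 0 := by push_cast at hk; omega
  exact_mod_cast this

/-- The filter `u` has no gaps: its support is all of `[1 - n, n]`. -/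
lemma lowpassU_ne_zero_iff {n : ℕ} (hn : 0 < n) (j : ℤ) :
    lowpassU n j ≠ 0 ↔ 1 - (n : ℤ) ≤ j ∧ j ≤ n := by
  obtain ⟨m, rfl⟩ := Nat.exists_eq_succ_of_ne_zero hn.ne'
  obtain ⟨κ, hκ, h⟩ := exists_mul_interpolatory_eq m
  have h1 := h (2 * j - 1)
  have hk : ((2 * j - 1 : ℤ) : ℂ) ≠ 0 := by
    have : 2 * j - 1 ≠ 0 := by omega
    exact_mod_cast this
  have h2 : lowpassU (m + 1) j ≠ 0 ↔ sinPowFilter (2 * m + 1) (2 * j - 1) ≠ 0 := by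
    rw [lowpassU_apply, mul_ne_zero_iff]
    constructor
    · rintro ⟨-, h3⟩ h4
      rw [h4, mul_zero] at h1
      exact (mul_ne_zero hk h3) h1
    · intro h3
      refine ⟨by norm_num, fun h4 => ?_⟩
      rw [h4, mul_zero] at h1
      exact (mul_ne_zero hκ h3) h1.symm
  rw [Nat.succ_eq_add_one, h2, sinPowFilter_ne_zero_iff]
  constructor
  · rintro ⟨r, hr, e⟩
    push_cast at e ⊢
    omega
  · rintro ⟨h3, h4⟩
    push_cast at h3 h4
    exact ⟨(j + m).toNat, by omega, by push_cast; omega⟩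

lemma cross_ne_zero_iff (p : Filter1) (k : Fin 2 → ℤ) :
    cross p k ≠ 0 ↔ (k 1 = k 0 ∨ k 1 = 1 - k 0) ∧ p (k 0) ≠ 0 := by
  rw [cross_apply]
  by_cases h1 : k 1 = k 0
  · have h2 : k 1 ≠ 1 - k 0 := by omega
    rw [if_pos h1, if_neg h2]
    simp [h1]
  · by_cases h2 : k 1 = 1 - k 0
    · rw [if_neg h1, if_pos h2]
      simp [h2]
    · simp [h1, h2]

lemma card_support_cross (p : Filter1) : (cross p).support.card = 2 * p.support.card := by
  have h : (cross p).support = p.support.image (fun j => (![j, j] : Fin 2 → ℤ)) ∪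
      p.support.image (fun j => (![j, 1 - j] : Fin 2 → ℤ)) := by
    ext k
    rw [Finsupp.mem_support_iff, cross_ne_zero_iff, Finset.mem_union, Finset.mem_image,
      Finset.mem_image]
    constructor
    · rintro ⟨h | h, hp⟩
      · refine Or.inl ⟨k 0, Finsupp.mem_support_iff.2 hp, ?_⟩
        ext i; fin_cases i
        · rfl
        · exact h.symm
      · refine Or.inr ⟨k 0, Finsupp.mem_support_iff.2 hp, ?_⟩
        ext i; fin_cases i
        · rfl
        · exact h.symm
    · rintro (⟨j, hj, rfl⟩ | ⟨j, hj, rfl⟩)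
      · exact ⟨Or.inl rfl, Finsupp.mem_support_iff.1 hj⟩
      · exact ⟨Or.inr rfl, Finsupp.mem_support_iff.1 hj⟩
  rw [h, Finset.card_union_of_disjoint, Finset.card_image_of_injective,
    Finset.card_image_of_injective, two_mul]
  · intro x y hxy
    exact congrFun hxy 0
  · intro x y hxy
    exact congrFun hxy 0
  · rw [Finset.disjoint_left]
    intro k h1 h2
    obtain ⟨j, -, rfl⟩ := Finset.mem_image.1 h1
    obtain ⟨i, -, hi⟩ := Finset.mem_image.1 h2
    have e0 : i = j := congrFun hi 0
    have e1 : 1 - i = j := congrFun hi 1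
    omega

lemma mate_ne_zero_iff (a : Filter2) (k : Fin 2 → ℤ) :
    mate a k ≠ 0 ↔ a ![1 - k 0, -k 1] ≠ 0 := by
  have h1 : mate a k = (-1 : ℂ) ^ (1 + k 0 + k 1) * conj (a ![1 - k 0, -k 1]) := rfl
  rw [h1, mul_ne_zero_iff]
  have h2 : (-1 : ℂ) ^ (1 + k 0 + k 1) ≠ 0 := zpow_ne_zero _ (by norm_num)
  simp [h2]

lemma card_support_mate (a : Filter2) : (mate a).support.card = a.support.card := by
  refine Finset.card_bij' (fun k _ => ![1 - k 0, -k 1]) (fun k _ => ![1 - k 0, -k 1]) ?_ ?_ ?_ ?_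
  · intro k hk
    exact Finsupp.mem_support_iff.2 ((mate_ne_zero_iff a k).1 (Finsupp.mem_support_iff.1 hk))
  · intro k hk
    rw [Finsupp.mem_support_iff] at hk ⊢
    rw [mate_ne_zero_iff]
    convert! hk using 2
    ext i; fin_cases i <;> simp
  · intro k _
    ext i; fin_cases i <;> simp
  · intro k _
    ext i; fin_cases i <;> simp

lemma highpassV_support_bound {p : Filter1} {lo hi : ℤ} (h : ∀ k, p k ≠ 0 → lo ≤ k ∧ k ≤ hi)
    {j : ℤ} (hj : highpassV p j ≠ 0) : lo ≤ j ∧ j ≤ hi := by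
  rw [highpassV_apply, selfProduct_apply] at hj
  obtain ⟨i, hi', h1⟩ := Finset.exists_ne_zero_of_sum_ne_zero (right_ne_zero_of_mul hj)
  obtain ⟨m, hm, h2⟩ := Finset.exists_ne_zero_of_sum_ne_zero h1
  have h3 : i + m = 2 * j := by
    by_contra h4
    exact h2 (if_neg h4)
  have h4 := h i (Finsupp.mem_support_iff.1 hi')
  have h5 := h m (Finsupp.mem_support_iff.1 hm)
  omega

/-- The extreme correlation coefficient of a filter is a product of its two end coefficients, so a
spectral factor of the interpolatory filter occupies a window of length `2n`. -/
lemma exists_window {n : ℕ} (hn : 0 < n) {aD : Filter1}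
    (hD : ∀ ω : ℝ, ‖symbol1 aD ω‖ ^ 2 = interpolatorySymbol n ω) :
    ∃ lo : ℤ, ∀ k, aD k ≠ 0 → lo ≤ k ∧ k ≤ lo + (2 * n - 1) := by
  rcases aD.support.eq_empty_or_nonempty with h0 | h0
  · refine ⟨0, fun k hk => ?_⟩
    rw [← Finsupp.mem_support_iff, h0] at hk
    simp at hk
  set lo := aD.support.min' h0 with hlo
  set hi := aD.support.max' h0 with hhi
  have hlo_mem := aD.support.min'_mem h0
  have hhi_mem := aD.support.max'_mem h0
  have hle : ∀ k ∈ aD.support, lo ≤ k ∧ k ≤ hi :=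
    fun k hk => ⟨aD.support.min'_le k hk, aD.support.le_max' k hk⟩
  have hcorr : correlation aD aD = interpolatory n := by
    apply symbol1_injective
    ext ω
    rw [symbol1_correlation, symbol1_interpolatory, ← hD, Complex.mul_conj,
      Complex.normSq_eq_norm_sq]
  have hval : correlation aD aD (hi - lo) = aD hi * conj (aD lo) := by
    unfold correlation Finsupp.sum
    simp only [Finsupp.finsetSum_apply, Finsupp.single_apply]
    rw [Finset.sum_eq_single_of_mem hi hhi_mem, Finset.sum_eq_single_of_mem lo hlo_mem]
    · simp
    · intro m hm hne
      refine if_neg fun h => hne ?_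
      omega
    · intro j hj hne
      refine Finset.sum_eq_zero fun m hm => if_neg fun h => hne ?_
      have h1 := hle j hj
      have h2 := hle m hm
      omega
  have hwin : hi - lo ≤ 2 * n - 1 := by
    by_contra hlt
    rw [hcorr, interpolatory_eq_zero hn (by omega)] at hval
    have h1 := Finsupp.mem_support_iff.1 hhi_mem
    have h2 := Finsupp.mem_support_iff.1 hlo_mem
    have h3 : conj (aD lo) ≠ 0 := by simpa using h2
    exact mul_ne_zero h1 h3 hval.symm
  refine ⟨lo, fun k hk => ?_⟩
  have := hle k (Finsupp.mem_support_iff.2 hk)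
  omega

lemma card_support_highpassV_le {n : ℕ} (hn : 0 < n) {aD : Filter1}
    (hD : ∀ ω : ℝ, ‖symbol1 aD ω‖ ^ 2 = interpolatorySymbol n ω) :
    (highpassV aD).support.card ≤ (lowpassU n).support.card := by
  have h1 : (lowpassU n).support = Finset.Icc (1 - (n : ℤ)) n := by
    ext j
    rw [Finsupp.mem_support_iff, lowpassU_ne_zero_iff hn, Finset.mem_Icc]
  obtain ⟨lo, hlo⟩ := exists_window hn hD
  have h2 : (highpassV aD).support ⊆ Finset.Icc lo (lo + (2 * n - 1)) := by
    intro j hj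
    rw [Finset.mem_Icc]
    exact highpassV_support_bound hlo (Finsupp.mem_support_iff.1 hj)
  refine (Finset.card_le_card h2).trans ?_
  rw [h1, Int.card_Icc, Int.card_Icc]
  omega

lemma lowpass_reflect_ne_zero (n : ℕ) {k : Fin 2 → ℤ}
    (hk : lowpass n ![1 - k 0, -k 1] ≠ 0) : lowpass n (k + ![0, 1]) ≠ 0 := by
  unfold lowpass at hk ⊢
  rw [cross_reflect_fst (lowpassU_reflect n), ← cross_reflect_snd] at hk
  convert! hk using 2
  ext i; fin_cases i
  · simp
  · simp
    ring

lemma mate_lowpass_support (n : ℕ) (k : Fin 2 → ℤ) (hk : mate (lowpass n) k ≠ 0) :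
    lowpass n (k + ![0, 1]) ≠ 0 :=
  lowpass_reflect_ne_zero n ((mate_ne_zero_iff _ k).1 hk)

lemma highpass_support {n : ℕ} (hn : 0 < n) {aD : Filter1}
    (h : ∀ k : ℤ, aD k ≠ 0 → 1 - (n : ℤ) ≤ k ∧ k ≤ n) (k : Fin 2 → ℤ) (hk : highpass aD k ≠ 0) :
    lowpass n k ≠ 0 := by
  unfold highpass at hk
  unfold lowpass
  rw [cross_ne_zero_iff] at hk ⊢
  exact ⟨hk.1, (lowpassU_ne_zero_iff hn _).2 (highpassV_support_bound h hk.2)⟩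

/-! ### The discrete framelet transform on `ℓ²(ℤ²)` -/

lemma correlation_sum {G : Type*} [AddCommGroup G] (p q : G →₀ ℂ) (e : G → ℂ) :
    Finsupp.linearCombination ℂ e (correlation p q) =
      ∑ j ∈ p.support, ∑ m ∈ q.support, p j * conj (q m) * e (j - m) := by
  unfold correlation Finsupp.sum
  simp only [map_sum, Finsupp.linearCombination_single, smul_eq_mul]

/-- The filter `(-1)^{k₁+k₂} a(k)`, whose symbol is the shift of that of `a` by `(π, π)`. -/
def modulate (a : Filter2) : Filter2 :=
  Finsupp.onFinset a.support (fun k => (-1 : ℂ) ^ (k 0 + k 1) * a k) fun k hk => by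
    rw [Finsupp.mem_support_iff]
    exact fun h => hk (by simp [h])

lemma modulate_apply (a : Filter2) (k : Fin 2 → ℤ) :
    modulate a k = (-1 : ℂ) ^ (k 0 + k 1) * a k := rfl

lemma neg_one_zpow_ne_zero (m : ℤ) : (-1 : ℂ) ^ m ≠ 0 := zpow_ne_zero _ (by norm_num)

lemma support_modulate (a : Filter2) : (modulate a).support = a.support := by
  ext k
  simp [modulate_apply, neg_one_zpow_ne_zero]

lemma symbol2_modulate (a : Filter2) (ω : Fin 2 → ℝ) :
    symbol2 (modulate a) ω = symbol2 a (ω + ![Real.pi, Real.pi]) := by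
  unfold symbol2 Finsupp.sum
  rw [support_modulate]
  refine Finset.sum_congr rfl fun k _ => ?_
  rw [modulate_apply, mul_comm ((-1 : ℂ) ^ _)]
  beta_reduce
  rw [mul_assoc]
  congr 1
  have h := exp_add_pi (k 0 + k 1) 0
  have h1 : Complex.exp (-Complex.I * (((k 0 + k 1 : ℤ) : ℝ) * (0 + Real.pi) : ℝ)) =
      (-1) ^ (k 0 + k 1) := by simpa using h
  rw [← h1, ← Complex.exp_add]
  congr 1
  simp only [Fin.sum_univ_two, Pi.add_apply, Matrix.cons_val_zero, Matrix.cons_val_one]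
  push_cast
  ring

lemma conj_neg_one_zpow (m : ℤ) : conj ((-1 : ℂ) ^ m) = (-1) ^ m := by
  rw [map_zpow₀]
  simp

/-- The coset `M ℤ² + m` consists of the points `p` with `p₁ + p₂ - m₁ - m₂` even. -/
lemma mem_range_quincunxM {m p : Fin 2 → ℤ} (h : Even (m 0 + m 1 + (p 0 + p 1))) :
    ∃ k : Fin 2 → ℤ, quincunxM *ᵥ k + m = p := by
  obtain ⟨r, hr⟩ := h
  refine ⟨![r - (m 0 + m 1), p 0 - r + m 1], ?_⟩
  rw [mulVec_two]
  ext i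
  fin_cases i
  · simp [quincunxM]
    ring
  · simp [quincunxM]
    omega

lemma quincunxM_add_injective (m : Fin 2 → ℤ) :
    Function.Injective fun k : Fin 2 → ℤ => quincunxM *ᵥ k + m := by
  intro k l h
  have h' := add_right_cancel h
  rw [mulVec_two, mulVec_two] at h'
  have h0 := congrFun h' 0
  have h1 := congrFun h' 1
  simp [quincunxM] at h0 h1
  ext i
  fin_cases i
  · change k 0 = l 0; omega
  · change k 1 = l 1; omega

/-- Summation over the coset `M ℤ² + m`, by averaging over the two characters of `ℤ² / M ℤ²`. -/
lemma hasSum_coset {g : (Fin 2 → ℤ) → ℂ} (hg : Summable g) (m : Fin 2 → ℤ) :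
    HasSum (fun k : Fin 2 → ℤ => 2 * g (quincunxM *ᵥ k + m))
      ((∑' p, g p) + (-1) ^ (m 0 + m 1) * ∑' p, (-1) ^ (p 0 + p 1) * g p) := by
  have hg' : Summable fun p : Fin 2 → ℤ => (-1 : ℂ) ^ (p 0 + p 1) * g p := by
    refine Summable.of_norm_bounded hg.norm fun p => ?_
    rw [norm_mul, norm_zpow]
    simp
  have h1 := hg.hasSum.add (hg'.hasSum.mul_left ((-1 : ℂ) ^ (m 0 + m 1)))
  rw [← (quincunxM_add_injective m).hasSum_iff] at h1
  · convert! h1 using 2 with k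
    simp only [Function.comp_apply, ← mul_assoc]
    rw [← zpow_add₀ (by norm_num), Even.neg_one_zpow]
    · ring
    · rw [mulVec_two]
      refine ⟨m 0 + m 1 + k 0, ?_⟩
      simp [quincunxM]
      ring
  · intro p hp
    have hodd : Odd (m 0 + m 1 + (p 0 + p 1)) := by
      rw [← Int.not_even_iff_odd]
      intro h
      exact hp (mem_range_quincunxM h)
    rw [← mul_assoc, ← zpow_add₀ (by norm_num), hodd.neg_one_zpow]
    ring

/-- One channel `k ↦ √2 ∑_m conj(b(m)) x(Mk + m)` of the discrete framelet transform. -/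
def analysis (b : Filter2) (x : (Fin 2 → ℤ) → ℂ) (k : Fin 2 → ℤ) : ℂ :=
  (√2 : ℝ) * ∑ m ∈ b.support, conj (b m) * x (quincunxM *ᵥ k + m)

lemma summable_mul_conj_shift {x : (Fin 2 → ℤ) → ℂ} (hx : Summable fun k => ‖x k‖ ^ 2)
    (r : Fin 2 → ℤ) : Summable fun p => x p * conj (x (p + r)) := by
  have h2 : Summable fun p => ‖x (p + r)‖ ^ 2 := (Equiv.addRight r).summable_iff.2 hx
  refine Summable.of_norm_bounded (hx.add h2) fun p => ?_
  rw [norm_mul, RCLike.norm_conj]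
  nlinarith [sq_nonneg (‖x p‖ - ‖x (p + r)‖), sq_nonneg ‖x p‖, sq_nonneg ‖x (p + r)‖]

/-- The energy of one channel, as a sum of two linear functionals of the autocorrelation of `b` and of
its correlation with the modulated filter. -/
lemma hasSum_norm_sq_analysis (b : Filter2) {x : (Fin 2 → ℤ) → ℂ}
    (hx : Summable fun k => ‖x k‖ ^ 2) :
    HasSum (fun k => ((‖analysis b x k‖ ^ 2 : ℝ) : ℂ))
      (Finsupp.linearCombination ℂ (fun r => ∑' p, x p * conj (x (p + r))) (correlation b b) +
        Finsupp.linearCombination ℂ (fun r => ∑' p, (-1) ^ (p 0 + p 1) * (x p * conj (x (p + r))))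
          (correlation b (modulate b))) := by
  have h1 : ∀ j m : Fin 2 → ℤ, HasSum
      (fun k => b j * conj (b m) * (2 * (x (quincunxM *ᵥ k + m) * conj (x (quincunxM *ᵥ k + j)))))
      (b j * conj (b m) * ((∑' p, x p * conj (x (p + (j - m)))) +
        (-1) ^ (m 0 + m 1) * ∑' p, (-1) ^ (p 0 + p 1) * (x p * conj (x (p + (j - m)))))) := by
    intro j m
    refine HasSum.mul_left _ ?_
    have := hasSum_coset (summable_mul_conj_shift hx (j - m)) m
    convert! this using 6
    abel
  have h2 := hasSum_sum (s := b.support) fun j _ => hasSum_sum (s := b.support) fun m _ => h1 j m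
  convert! h2 using 1
  · ext k
    rw [Complex.ofReal_pow, ← Complex.conj_mul', analysis, map_mul, Complex.conj_ofReal,
      mul_mul_mul_comm, ← Complex.ofReal_mul, Real.mul_self_sqrt zero_le_two, map_sum,
      Finset.sum_mul_sum, Finset.mul_sum]
    refine Finset.sum_congr rfl fun j _ => ?_
    rw [Finset.mul_sum]
    refine Finset.sum_congr rfl fun m _ => ?_
    rw [map_mul, Complex.conj_conj]
    push_cast
    ring
  · rw [correlation_sum, correlation_sum, support_modulate, ← Finset.sum_add_distrib]
    refine Finset.sum_congr rfl fun j _ => ?_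
    rw [← Finset.sum_add_distrib]
    refine Finset.sum_congr rfl fun m _ => ?_
    rw [modulate_apply, map_mul, conj_neg_one_zpow]
    ring

/-- A tight filter bank for the quincunx lattice, written with all filters on the same footing. -/
def IsParaunitary {ι : Type*} [Fintype ι] (h : ι → Filter2) : Prop :=
  (∀ ω : Fin 2 → ℝ, ∑ i, ‖symbol2 (h i) ω‖ ^ 2 = 1) ∧
  ∀ ω : Fin 2 → ℝ, ∑ i, conj (symbol2 (h i) ω) * symbol2 (h i) (ω + ![Real.pi, Real.pi]) = 0

lemma symbol2_sum {ι : Type*} (s : Finset ι) (f : ι → Filter2) (ω : Fin 2 → ℝ) :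
    symbol2 (∑ i ∈ s, f i) ω = ∑ i ∈ s, symbol2 (f i) ω := by
  classical
  induction s using Finset.induction_on with
  | empty => simp [symbol2]
  | insert i s hi ih => rw [Finset.sum_insert hi, Finset.sum_insert hi, symbol2_add, ih]

/-- The two conditions of a tight filter bank, in terms of coefficients. -/
lemma IsParaunitary.sum_correlation {ι : Type*} [Fintype ι] {h : ι → Filter2}
    (hh : IsParaunitary h) :
    ∑ i, correlation (h i) (h i) = Finsupp.single 0 1 ∧
      ∑ i, correlation (h i) (modulate (h i)) = 0 := by
  constructor
  · apply symbol2_injective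
    ext ω
    rw [symbol2_sum]
    simp only [symbol2_correlation, Complex.mul_conj, Complex.normSq_eq_norm_sq]
    rw [← Complex.ofReal_sum, hh.1 ω]
    simp [symbol2]
  · apply symbol2_injective
    ext ω
    rw [symbol2_sum]
    simp only [symbol2_correlation, symbol2_modulate]
    have := congrArg conj (hh.2 ω)
    rw [map_sum, map_zero] at this
    rw [show symbol2 0 ω = 0 by simp [symbol2], ← this]
    refine Finset.sum_congr rfl fun i _ => ?_
    rw [map_mul, Complex.conj_conj]

/-- The discrete framelet transform is an isometry of `ℓ²`. -/
lemma IsParaunitary.sum_tsum_norm_sq_analysis {ι : Type*} [Fintype ι] {h : ι → Filter2}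
    (hh : IsParaunitary h) {x : (Fin 2 → ℤ) → ℂ} (hx : Summable fun k => ‖x k‖ ^ 2) :
    (∀ i, Summable fun k => ‖analysis (h i) x k‖ ^ 2) ∧
      ∑ i, ∑' k, ‖analysis (h i) x k‖ ^ 2 = ∑' k, ‖x k‖ ^ 2 := by
  have hs : ∀ i, Summable fun k => ‖analysis (h i) x k‖ ^ 2 := fun i =>
    Complex.summable_ofReal.1 (hasSum_norm_sq_analysis (h i) hx).summable
  refine ⟨hs, ?_⟩
  apply Complex.ofReal_injective
  rw [Complex.ofReal_sum]
  simp only [Complex.ofReal_tsum]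
  rw [Finset.sum_congr rfl fun i _ => (hasSum_norm_sq_analysis (h i) hx).tsum_eq,
    Finset.sum_add_distrib, ← map_sum, ← map_sum, hh.sum_correlation.1, hh.sum_correlation.2]
  simp [Complex.mul_conj']

/-! ### The refinable function on the Fourier side -/

/-- The matrix `(Mᵀ)⁻¹ = M / 2`. -/
def halfM : Matrix (Fin 2) (Fin 2) ℝ := !![1 / 2, 1 / 2; 1 / 2, -1 / 2]

lemma toReal_quincunxM : toReal quincunxM = !![1, 1; 1, -1] := by
  ext i j
  fin_cases i <;> fin_cases j <;> simp [quincunxM]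

lemma toReal_quincunxM_transpose_inv : (toReal quincunxM)ᵀ⁻¹ = halfM := by
  apply Matrix.inv_eq_right_inv
  rw [toReal_quincunxM]
  ext i j
  fin_cases i <;> fin_cases j <;> norm_num [halfM, Matrix.mul_apply, Fin.sum_univ_two]

lemma halfM_mulVec (ω : Fin 2 → ℝ) : halfM *ᵥ ω = ![(ω 0 + ω 1) / 2, (ω 0 - ω 1) / 2] := by
  rw [mulVec_two]
  ext i
  fin_cases i
  · simp [halfM]; ring
  · simp [halfM]; ring

/-- The squared Euclidean length. -/
def sqLength (ω : Fin 2 → ℝ) : ℝ := ω 0 ^ 2 + ω 1 ^ 2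

lemma sqLength_halfM_pow (j : ℕ) (ω : Fin 2 → ℝ) :
    sqLength (halfM ^ j *ᵥ ω) = (1 / 2) ^ j * sqLength ω := by
  induction j with
  | zero => simp
  | succ j ih =>
    rw [pow_succ', ← Matrix.mulVec_mulVec, pow_succ' (1 / 2 : ℝ), mul_assoc, ← ih, halfM_mulVec]
    simp [sqLength]
    ring

lemma abs_apply_le_sqrt_sqLength (ω : Fin 2 → ℝ) (i : Fin 2) : |ω i| ≤ √(sqLength ω) := by
  apply Real.abs_le_sqrt
  unfold sqLength
  fin_cases i
  · simp [sq_nonneg]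
  · simp [sq_nonneg]

lemma sqrt_sqLength_halfM_pow (j : ℕ) (ω : Fin 2 → ℝ) :
    √(sqLength (halfM ^ j *ᵥ ω)) = √(1 / 2) ^ j * √(sqLength ω) := by
  rw [sqLength_halfM_pow, Real.sqrt_mul (by positivity)]
  congr 1
  rw [Real.sqrt_eq_iff_mul_self_eq (by positivity) (by positivity), ← mul_pow,
    Real.mul_self_sqrt (by positivity)]

/-- A normalized symbol is Lipschitz at the origin. -/
lemma exists_norm_symbol2_sub_one_le {a : Filter2} (ha : symbol2 a 0 = 1) :
    ∃ C : ℝ, 0 ≤ C ∧ ∀ ω, ‖symbol2 a ω - 1‖ ≤ C * √(sqLength ω) := by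
  refine ⟨∑ k ∈ a.support, ‖a k‖ * (|(k 0 : ℝ)| + |(k 1 : ℝ)|), by positivity, fun ω => ?_⟩
  rw [← ha]
  unfold symbol2 Finsupp.sum
  rw [← Finset.sum_sub_distrib, Finset.sum_mul]
  refine (norm_sum_le _ _).trans (Finset.sum_le_sum fun k _ => ?_)
  have h1 : ‖Complex.exp (-Complex.I * (∑ i, (k i : ℝ) * ω i : ℝ)) - 1‖ ≤
      (|(k 0 : ℝ)| + |(k 1 : ℝ)|) * √(sqLength ω) := by
    have h2 := Real.norm_exp_I_mul_ofReal_sub_one_le (x := -∑ i, (k i : ℝ) * ω i)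
    rw [show Complex.I * ((-∑ i, (k i : ℝ) * ω i : ℝ) : ℂ) =
      -Complex.I * (∑ i, (k i : ℝ) * ω i : ℝ) by push_cast; ring] at h2
    refine h2.trans ?_
    rw [Real.norm_eq_abs, abs_neg, Fin.sum_univ_two, add_mul]
    refine (abs_add_le _ _).trans (add_le_add ?_ ?_)
    · rw [abs_mul]
      exact mul_le_mul_of_nonneg_left (abs_apply_le_sqrt_sqLength ω 0) (abs_nonneg _)
    · rw [abs_mul]
      exact mul_le_mul_of_nonneg_left (abs_apply_le_sqrt_sqLength ω 1) (abs_nonneg _)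
  have h3 : a k * Complex.exp (-Complex.I * (∑ i, (k i : ℝ) * (0 : Fin 2 → ℝ) i : ℝ)) = a k := by
    simp
  beta_reduce
  rw [h3, ← mul_sub_one, norm_mul, mul_assoc]
  exact mul_le_mul_of_nonneg_left h1 (norm_nonneg _)

lemma refinableFactor_eq (a : Filter2) (ω : Fin 2 → ℝ) (j : ℕ) :
    refinableFactor quincunxM a ω j = symbol2 a (halfM ^ (j + 1) *ᵥ ω) := by
  unfold refinableFactor
  rw [toReal_quincunxM_transpose_inv]

lemma sqrt_half_lt_one : √(1 / 2 : ℝ) < 1 := by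
  rw [Real.sqrt_lt' one_pos]
  norm_num

/-- The deviations of the factors from `1` decay geometrically. -/
lemma exists_sum_norm_refinableFactor_le {a : Filter2} (ha : symbol2 a 0 = 1) :
    ∃ C : ℝ, 0 ≤ C ∧ ∀ ω, (Summable fun j => ‖refinableFactor quincunxM a ω j - 1‖) ∧
      ∀ s : Finset ℕ, ∑ j ∈ s, ‖refinableFactor quincunxM a ω j - 1‖ ≤ C * √(sqLength ω) := by
  obtain ⟨C, hC, h⟩ := exists_norm_symbol2_sub_one_le ha
  have hg : Summable fun j : ℕ => √(1 / 2 : ℝ) ^ j :=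
    summable_geometric_of_lt_one (Real.sqrt_nonneg _) sqrt_half_lt_one
  have hb : ∀ ω j, ‖refinableFactor quincunxM a ω j - 1‖ ≤
      C * √(sqLength ω) * √(1 / 2 : ℝ) ^ j := by
    intro ω j
    rw [refinableFactor_eq]
    refine (h _).trans ?_
    rw [sqrt_sqLength_halfM_pow, mul_assoc, mul_comm (√(1 / 2) ^ (j + 1))]
    gcongr 2
    exact pow_le_pow_of_le_one (Real.sqrt_nonneg _) sqrt_half_lt_one.le (Nat.le_succ j)
  refine ⟨C * ∑' j : ℕ, √(1 / 2 : ℝ) ^ j, by positivity, fun ω => ⟨?_, fun s => ?_⟩⟩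
  · exact Summable.of_nonneg_of_le (fun _ => norm_nonneg _) (hb ω) (hg.mul_left _)
  · refine (Finset.sum_le_sum fun j _ => hb ω j).trans ?_
    rw [← Finset.mul_sum, mul_assoc, mul_assoc, mul_comm (∑' j : ℕ, √(1 / 2 : ℝ) ^ j)]
    gcongr
    exact hg.sum_le_tsum _ fun _ _ => by positivity

lemma multipliable_refinableFactor {a : Filter2} (ha : symbol2 a 0 = 1) (ω : Fin 2 → ℝ) :
    Multipliable (refinableFactor quincunxM a ω) := by
  obtain ⟨C, -, h⟩ := exists_sum_norm_refinableFactor_le ha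
  have := multipliable_one_add_of_summable (h ω).1
  simpa using this

lemma tendsto_prod_refinableFactor {a : Filter2} (ha : symbol2 a 0 = 1) (ω : Fin 2 → ℝ) :
    Filter.Tendsto (fun n => ∏ j ∈ Finset.range n, refinableFactor quincunxM a ω j) Filter.atTop
      (nhds (refinableHat quincunxM a ω)) :=
  (multipliable_refinableFactor ha ω).hasProd.tendsto_prod_nat

/-- The refinement equation `φ^(ω) = a((Mᵀ)⁻¹ω) φ^((Mᵀ)⁻¹ω)`. -/
lemma refinableHat_eq {a : Filter2} (ha : symbol2 a 0 = 1) (ω : Fin 2 → ℝ) :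
    refinableHat quincunxM a ω = symbol2 a (halfM *ᵥ ω) * refinableHat quincunxM a (halfM *ᵥ ω) := by
  have hs : ∀ j, refinableFactor quincunxM a ω (j + 1) =
      refinableFactor quincunxM a (halfM *ᵥ ω) j := by
    intro j
    rw [refinableFactor_eq, refinableFactor_eq, pow_succ, Matrix.mulVec_mulVec]
  have hm := multipliable_refinableFactor ha (halfM *ᵥ ω)
  have h0 : refinableFactor quincunxM a ω 0 = symbol2 a (halfM *ᵥ ω) := by
    rw [refinableFactor_eq, zero_add, pow_one]
  unfold refinableHat
  rw [tprod_eq_zero_mul' (by simpa only [hs] using hm), h0]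
  simp only [hs]

lemma norm_refinableHat_le_one {a : Filter2} (ha : symbol2 a 0 = 1) (h1 : ∀ ω, ‖symbol2 a ω‖ ≤ 1)
    (ω : Fin 2 → ℝ) : ‖refinableHat quincunxM a ω‖ ≤ 1 := by
  refine le_of_tendsto (tendsto_prod_refinableFactor ha ω).norm (Filter.Eventually.of_forall ?_)
  intro n
  rw [norm_prod]
  exact Finset.prod_le_one (fun _ _ => norm_nonneg _) fun _ _ => h1 _

lemma continuous_symbol2 (a : Filter2) : Continuous (symbol2 a) := by
  unfold symbol2 Finsupp.sum
  fun_prop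

lemma measurable_refinableHat {a : Filter2} (ha : symbol2 a 0 = 1) :
    Measurable (refinableHat quincunxM a) := by
  refine measurable_of_tendsto_metrizable (f := fun n ω =>
    ∏ j ∈ Finset.range n, refinableFactor quincunxM a ω j) (fun n => ?_)
    (tendsto_pi_nhds.2 fun ω => tendsto_prod_refinableFactor ha ω)
  refine Finset.measurable_fun_prod _ fun j _ => ?_
  unfold refinableFactor
  exact ((continuous_symbol2 a).comp (Continuous.matrix_mulVec continuous_const
    continuous_id)).measurable

/-- `φ^` tends to `1` along every orbit of the contraction `(Mᵀ)⁻¹`. -/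
lemma tendsto_refinableHat_halfM_pow {a : Filter2} (ha : symbol2 a 0 = 1) (ω : Fin 2 → ℝ) :
    Filter.Tendsto (fun J : ℕ => refinableHat quincunxM a (halfM ^ J *ᵥ ω)) Filter.atTop
      (nhds 1) := by
  obtain ⟨C, hC, h⟩ := exists_sum_norm_refinableFactor_le ha
  have hb : ∀ ω, ‖refinableHat quincunxM a ω - 1‖ ≤ Real.exp (C * √(sqLength ω)) - 1 := by
    intro ω
    refine le_of_tendsto ((tendsto_prod_refinableFactor ha ω).sub_const 1).norm
      (Filter.Eventually.of_forall fun n => ?_)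
    have := Finset.norm_prod_one_add_sub_one_le (Finset.range n)
      fun j => refinableFactor quincunxM a ω j - 1
    simp only [add_sub_cancel] at this
    refine this.trans ?_
    gcongr
    exact (h ω).2 _
  rw [tendsto_iff_norm_sub_tendsto_zero]
  refine squeeze_zero (fun _ => norm_nonneg _) (fun J => hb _) ?_
  have h1 : Filter.Tendsto (fun J : ℕ => √(sqLength (halfM ^ J *ᵥ ω))) Filter.atTop (nhds 0) := by
    simp only [sqrt_sqLength_halfM_pow]
    have := (tendsto_pow_atTop_nhds_zero_of_lt_one (Real.sqrt_nonneg _) sqrt_half_lt_one).mul_const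
      (√(sqLength ω))
    simpa using this
  have h2 := ((Real.continuous_exp.tendsto _).comp (h1.const_mul C)).sub_const 1
  simpa using h2

/-! ### Linear changes of variables on the plane -/

lemma act_mul (A B : Matrix (Fin 2) (Fin 2) ℝ) (x : Plane) : act (A * B) x = act A (act B x) := by
  unfold act
  rw [Matrix.mulVec_mulVec]

lemma act_one (x : Plane) : act 1 x = x := by simp [act]

lemma act_sub (A : Matrix (Fin 2) (Fin 2) ℝ) (x y : Plane) :
    act A (x - y) = act A x - act A y := map_sub (Matrix.toLpLin 2 2 A) x y

lemma act_inv_act {A : Matrix (Fin 2) (Fin 2) ℝ} (hA : A.det ≠ 0) (x : Plane) :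
    act A⁻¹ (act A x) = x := by
  rw [← act_mul, Matrix.nonsing_inv_mul _ (isUnit_iff_ne_zero.2 hA), act_one]

lemma act_act_inv {A : Matrix (Fin 2) (Fin 2) ℝ} (hA : A.det ≠ 0) (x : Plane) :
    act A (act A⁻¹ x) = x := by
  rw [← act_mul, Matrix.mul_nonsing_inv _ (isUnit_iff_ne_zero.2 hA), act_one]

/-- An invertible matrix as a continuous linear automorphism of the plane. -/
def actEquiv (A : Matrix (Fin 2) (Fin 2) ℝ) (hA : A.det ≠ 0) : Plane ≃L[ℝ] Plane :=
  (LinearEquiv.ofLinearMap (Matrix.toLpLin 2 2 A) (Matrix.toLpLin 2 2 A⁻¹)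
    (LinearMap.ext fun x => act_act_inv hA x)
    (LinearMap.ext fun x => act_inv_act hA x)).toContinuousLinearEquiv

lemma actEquiv_apply {A : Matrix (Fin 2) (Fin 2) ℝ} (hA : A.det ≠ 0) (x : Plane) :
    actEquiv A hA x = act A x := rfl

lemma det_toLpLin (A : Matrix (Fin 2) (Fin 2) ℝ) :
    LinearMap.det (Matrix.toLpLin 2 2 A) = A.det := by
  rw [Matrix.toLpLin_eq_toLin, LinearMap.det_toLin]

lemma continuous_act (A : Matrix (Fin 2) (Fin 2) ℝ) : Continuous (act A) :=
  (Matrix.toLpLin 2 2 A).continuous_of_finiteDimensional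

lemma measurableEmbedding_affine {A : Matrix (Fin 2) (Fin 2) ℝ} (hA : A.det ≠ 0) (b : Plane) :
    MeasurableEmbedding fun x => act A x + b :=
  ((actEquiv A hA).toHomeomorph.trans (Homeomorph.addRight b)).measurableEmbedding

/-- An affine map scales Lebesgue measure by the inverse of its determinant. -/
lemma map_affine {A : Matrix (Fin 2) (Fin 2) ℝ} (hA : A.det ≠ 0) (b : Plane) :
    Measure.map (fun x => act A x + b) (volume : Measure Plane) =
      ENNReal.ofReal |A.det⁻¹| • (volume : Measure Plane) := by
  have h1 : Measure.map (act A) (volume : Measure Plane) =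
      ENNReal.ofReal |A.det⁻¹| • (volume : Measure Plane) := by
    have := Measure.map_linearMap_addHaar_eq_smul_addHaar (volume : Measure Plane)
      (f := Matrix.toLpLin 2 2 A) (by rwa [det_toLpLin])
    rwa [det_toLpLin] at this
  have h2 : (fun x => act A x + b) = (fun x => x + b) ∘ act A := rfl
  rw [h2, ← Measure.map_map (measurable_add_const b) (continuous_act A).measurable, h1,
    Measure.map_smul, map_add_right_eq_self]

lemma quasiMeasurePreserving_affine {A : Matrix (Fin 2) (Fin 2) ℝ} (hA : A.det ≠ 0) (b : Plane) :
    Measure.QuasiMeasurePreserving (fun x : Plane => act A x + b) := by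
  refine ⟨(measurableEmbedding_affine hA b).measurable, ?_⟩
  rw [map_affine hA]
  exact Measure.smul_absolutelyContinuous

lemma integral_comp_affine {A : Matrix (Fin 2) (Fin 2) ℝ} (hA : A.det ≠ 0) (b : Plane)
    {E : Type*} [NormedAddCommGroup E] [NormedSpace ℝ E] (f : Plane → E) :
    ∫ x, f (act A x + b) = |A.det⁻¹| • ∫ x, f x := by
  rw [← (measurableEmbedding_affine hA b).integral_map (μ := volume) f, map_affine hA,
    integral_smul_measure, ENNReal.toReal_ofReal (abs_nonneg _)]

lemma integral_comp_act {A : Matrix (Fin 2) (Fin 2) ℝ} (hA : A.det ≠ 0)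
    {E : Type*} [NormedAddCommGroup E] [NormedSpace ℝ E] (f : Plane → E) :
    ∫ x, f (act A x) = |A.det⁻¹| • ∫ x, f x := by
  simpa using integral_comp_affine hA 0 f

lemma inner_act (A : Matrix (Fin 2) (Fin 2) ℝ) (x y : Plane) :
    inner ℝ (act A x) y = inner ℝ x (act Aᵀ y) := by
  simp only [act, EuclideanSpace.inner_eq_star_dotProduct, star_trivial]
  rw [Matrix.dotProduct_mulVec, Matrix.mulVec_transpose]

/-! ### The Fourier transform of an affine substitution -/

lemma eLpNorm_comp_affine {A : Matrix (Fin 2) (Fin 2) ℝ} (hA : A.det ≠ 0) (b : Plane)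
    {f : Plane → ℂ} (hf : AEStronglyMeasurable f) :
    eLpNorm (fun x => f (act A x + b)) 2 volume =
      ENNReal.ofReal |A.det⁻¹| ^ (1 / 2 : ℝ) * eLpNorm f 2 volume := by
  have h := eLpNorm_map_measure (μ := (volume : Measure Plane)) (p := 2) (g := f)
    (f := fun x => act A x + b)
    (by rw [map_affine hA]; exact hf.smul_measure _)
    (measurableEmbedding_affine hA b).measurable.aemeasurable
  rw [map_affine hA, eLpNorm_smul_measure_of_ne_top (by simp)] at h
  rw [show (fun x => f (act A x + b)) = f ∘ fun x => act A x + b from rfl, ← h, smul_eq_mul]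
  norm_num

lemma memLp_comp_affine {A : Matrix (Fin 2) (Fin 2) ℝ} (hA : A.det ≠ 0) (b : Plane)
    {f : Plane → ℂ} (hf : MemLp f 2) : MemLp (fun x => f (act A x + b)) 2 := by
  refine ⟨hf.1.comp_quasiMeasurePreserving (quasiMeasurePreserving_affine hA b), ?_⟩
  rw [eLpNorm_comp_affine hA b hf.1]
  exact ENNReal.mul_lt_top (ENNReal.rpow_lt_top_of_nonneg (by norm_num) ENNReal.ofReal_ne_top) hf.2

lemma memLp_mul_of_bound {f w : Plane → ℂ} (hf : MemLp f 2) (hw : Measurable w) {K : ℝ}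
    (hK : ∀ x, ‖w x‖ ≤ K) : MemLp (fun x => w x * f x) 2 :=
  hf.of_le_mul (c := K) (hw.aestronglyMeasurable.mul hf.1) <| Filter.Eventually.of_forall fun x => by
    rw [norm_mul]
    exact mul_le_mul_of_nonneg_right (hK x) (norm_nonneg _)

/-- The weighted substitution `f ↦ w · f(A · + b)` on `L²`, for a bounded weight `w`. -/
def weightedSubst {A : Matrix (Fin 2) (Fin 2) ℝ} (hA : A.det ≠ 0) (b : Plane) {w : Plane → ℂ}
    (hw : Measurable w) {K : ℝ} (hK : ∀ x, ‖w x‖ ≤ K)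
    (f : Lp ℂ 2 (volume : Measure Plane)) : Lp ℂ 2 (volume : Measure Plane) :=
  (memLp_mul_of_bound (memLp_comp_affine hA b (Lp.memLp f)) hw hK).toLp _

lemma coeFn_weightedSubst {A : Matrix (Fin 2) (Fin 2) ℝ} (hA : A.det ≠ 0) (b : Plane)
    {w : Plane → ℂ} (hw : Measurable w) {K : ℝ} (hK : ∀ x, ‖w x‖ ≤ K)
    (f : Lp ℂ 2 (volume : Measure Plane)) :
    weightedSubst hA b hw hK f =ᵐ[volume] fun x => w x * f (act A x + b) :=
  MemLp.coeFn_toLp _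

lemma continuous_weightedSubst {A : Matrix (Fin 2) (Fin 2) ℝ} (hA : A.det ≠ 0) (b : Plane)
    {w : Plane → ℂ} (hw : Measurable w) {K : ℝ} (hK : ∀ x, ‖w x‖ ≤ K) :
    Continuous (weightedSubst hA b hw hK) := by
  have hc : ENNReal.ofReal |A.det⁻¹| ^ (1 / 2 : ℝ) ≠ ⊤ :=
    ENNReal.rpow_ne_top_of_nonneg (by norm_num) ENNReal.ofReal_ne_top
  suffices h : LipschitzWith (K.toNNReal * (ENNReal.ofReal |A.det⁻¹| ^ (1 / 2 : ℝ)).toNNReal)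
      (weightedSubst hA b hw hK) from h.continuous
  intro f g
  rw [Lp.edist_def, Lp.edist_def]
  have h1 : (weightedSubst hA b hw hK f - weightedSubst hA b hw hK g : Plane → ℂ) =ᵐ[volume]
      fun x => w x * (f - g : Plane → ℂ) (act A x + b) := by
    filter_upwards [coeFn_weightedSubst hA b hw hK f, coeFn_weightedSubst hA b hw hK g] with x h2 h3
    rw [Pi.sub_apply, h2, h3, Pi.sub_apply]
    ring
  rw [eLpNorm_congr_ae h1]
  refine (eLpNorm_le_mul_eLpNorm_of_ae_le_mul (c := K)
    (g := fun x => (f - g : Plane → ℂ) (act A x + b)) (Filter.Eventually.of_forall fun x => ?_)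
    2).trans ?_
  · rw [norm_mul]
    exact mul_le_mul_of_nonneg_right (hK x) (norm_nonneg _)
  · rw [eLpNorm_comp_affine hA b ((Lp.aestronglyMeasurable f).sub (Lp.aestronglyMeasurable g)),
      ← mul_assoc]
    gcongr
    rw [ENNReal.coe_mul, ENNReal.coe_toNNReal hc]
    rfl

/-- The factor `exp(2πi t)` of unit modulus. -/
def unitExp (t : ℝ) : ℂ := Complex.exp ((2 * Real.pi * t : ℝ) * Complex.I)

lemma norm_unitExp (t : ℝ) : ‖unitExp t‖ = 1 := Complex.norm_exp_ofReal_mul_I _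

lemma unitExp_add (s t : ℝ) : unitExp (s + t) = unitExp s * unitExp t := by
  unfold unitExp
  rw [← Complex.exp_add]
  congr 1
  push_cast
  ring

lemma conj_unitExp (t : ℝ) : conj (unitExp t) = unitExp (-t) := by
  unfold unitExp
  rw [← Complex.exp_conj, map_mul, Complex.conj_ofReal, Complex.conj_I]
  congr 1
  push_cast
  ring

@[fun_prop]
lemma continuous_unitExp : Continuous unitExp := by
  unfold unitExp
  fun_prop

lemma fourier_comp_affine_of_function {A : Matrix (Fin 2) (Fin 2) ℝ} (hA : A.det ≠ 0) (b : Plane)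
    (f : Plane → ℂ) (ξ : Plane) :
    𝓕 (fun x => f (act A x + b)) ξ =
      (|A.det⁻¹| : ℝ) * unitExp (inner ℝ (act A⁻¹ b) ξ) * 𝓕 f (act (A⁻¹)ᵀ ξ) := by
  rw [Real.fourier_eq', Real.fourier_eq']
  have h := integral_comp_affine hA b fun y =>
    unitExp (-inner ℝ (act A⁻¹ (y - b)) ξ) * f y
  have e1 : ∀ x, Complex.exp (((-2 * Real.pi * inner ℝ x ξ : ℝ) : ℂ) * Complex.I) •
      f (act A x + b) =
      unitExp (-inner ℝ (act A⁻¹ (act A x + b - b)) ξ) * f (act A x + b) := by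
    intro x
    rw [add_sub_cancel_right, act_inv_act hA, smul_eq_mul]
    unfold unitExp
    congr 3
    push_cast
    ring
  simp only [e1]
  rw [h, Complex.real_smul, mul_assoc]
  congr 1
  rw [← integral_const_mul]
  refine integral_congr_ae (Filter.Eventually.of_forall fun y => ?_)
  beta_reduce
  rw [smul_eq_mul, ← mul_assoc, act_sub, inner_sub_left, inner_act, neg_sub, sub_eq_add_neg,
    unitExp_add]
  congr 2
  unfold unitExp
  congr 2
  push_cast
  ring

/-- The Fourier transform on `L²` turns `f(A · + b)` into
`|det A|⁻¹ exp(2πi ⟨A⁻¹ b, ξ⟩) f^(A^{-T} ξ)`: both sides are continuous in `f`, and they agree on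
Schwartz functions. -/
lemma fourier_comp_affine {A : Matrix (Fin 2) (Fin 2) ℝ} (hA : A.det ≠ 0) (b : Plane)
    (f g : Lp ℂ 2 (volume : Measure Plane)) (hg : g =ᵐ[volume] fun x => f (act A x + b)) :
    (𝓕 g : Lp ℂ 2 (volume : Measure Plane)) =ᵐ[volume] fun ξ =>
      (|A.det⁻¹| : ℝ) * unitExp (inner ℝ (act A⁻¹ b) ξ) *
        (𝓕 f : Lp ℂ 2 (volume : Measure Plane)) (act (A⁻¹)ᵀ ξ) := by
  have hA' : ((A⁻¹)ᵀ).det ≠ 0 := by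
    rw [Matrix.det_transpose, Matrix.det_nonsing_inv, Ring.inverse_eq_inv']
    exact inv_ne_zero hA
  have hw : Measurable fun ξ : Plane =>
      ((|A.det⁻¹| : ℝ) : ℂ) * unitExp (inner ℝ (act A⁻¹ b) ξ) := by
    apply Continuous.measurable
    fun_prop
  have hK : ∀ ξ : Plane, ‖((|A.det⁻¹| : ℝ) : ℂ) * unitExp (inner ℝ (act A⁻¹ b) ξ)‖ ≤ |A.det⁻¹| := by
    intro ξ
    rw [norm_mul, norm_unitExp, mul_one, Complex.norm_real, Real.norm_eq_abs, abs_abs]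
  have h1 : Measurable fun _ : Plane => (1 : ℂ) := measurable_const
  have hK1 : ∀ _ : Plane, ‖(1 : ℂ)‖ ≤ 1 := by simp
  have key : ∀ f : Lp ℂ 2 (volume : Measure Plane),
      (𝓕 (weightedSubst hA b h1 hK1 f) : Lp ℂ 2 (volume : Measure Plane)) =
        weightedSubst hA' 0 hw hK (𝓕 f) := by
    intro f
    refine DenseRange.induction_on (p := fun f : Lp ℂ 2 (volume : Measure Plane) =>
      (𝓕 (weightedSubst hA b h1 hK1 f) : Lp ℂ 2 (volume : Measure Plane)) =
        weightedSubst hA' 0 hw hK (𝓕 f))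
      (SchwartzMap.denseRange_toLpCLM (p := 2) (E := Plane) (F := ℂ) (μ := volume)
        ENNReal.ofNat_ne_top) f ?_ ?_
    · refine isClosed_eq ?_ ?_
      · exact (ContinuousFourier.continuous_fourier).comp (continuous_weightedSubst hA b h1 hK1)
      · exact (continuous_weightedSubst hA' 0 hw hK).comp (ContinuousFourier.continuous_fourier)
    · intro s
      rw [SchwartzMap.toLpCLM_apply]
      let s' : SchwartzMap Plane ℂ := SchwartzMap.compCLMOfContinuousLinearEquiv ℂ (actEquiv A hA)
        (SchwartzMap.compSubConstCLM ℂ (-b) s)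
      have hs' : ⇑s' = fun x => s (act A x + b) := by
        ext x
        change s (actEquiv A hA x - -b) = _
        rw [sub_neg_eq_add, actEquiv_apply]
      have e1 : weightedSubst hA b h1 hK1 (s.toLp 2) = s'.toLp 2 := by
        apply Lp.ext
        filter_upwards [coeFn_weightedSubst hA b h1 hK1 (s.toLp 2), s'.coeFn_toLp 2 volume,
          (quasiMeasurePreserving_affine hA b).ae (s.coeFn_toLp 2 volume)] with x h2 h3 h4
        rw [h2, h3, h4, hs', one_mul]
      rw [e1, SchwartzMap.toLp_fourier_eq, SchwartzMap.toLp_fourier_eq]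
      apply Lp.ext
      filter_upwards [coeFn_weightedSubst hA' 0 hw hK ((𝓕 s).toLp 2), (𝓕 s').coeFn_toLp 2 volume,
        (quasiMeasurePreserving_affine hA' 0).ae ((𝓕 s).coeFn_toLp 2 volume)] with ξ h2 h3 h4
      rw [h2, h3, h4, SchwartzMap.fourier_coe, SchwartzMap.fourier_coe, hs',
        fourier_comp_affine_of_function hA b s ξ, add_zero]
  have hg' : g = weightedSubst hA b h1 hK1 f := by
    apply Lp.ext
    filter_upwards [hg, coeFn_weightedSubst hA b h1 hK1 f] with x h2 h3
    rw [h2, h3, one_mul]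
  rw [hg', key]
  filter_upwards [coeFn_weightedSubst hA' 0 hw hK (𝓕 f)] with ξ h2
  rw [h2, add_zero]

/-! ### Parseval's identity on the unit square -/

-- The torus carries its normalized Haar measure as `volume`.
attribute [local instance] instMeasureSpaceUnitAddCircle

/-- The half-open unit square centred at the origin, in coordinates. -/
def unitSquare : Set (Fin 2 → ℝ) := {x | ∀ i, x i ∈ Set.Ioc (-1 / 2 : ℝ) (-1 / 2 + 1)}

lemma measurableSet_unitSquare : MeasurableSet unitSquare :=
  MeasurableSet.univ_pi' fun _ => measurableSet_Ioc

lemma mFourier_neg_apply (k : Fin 2 → ℤ) (x : Fin 2 → ℝ) :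
    UnitAddTorus.mFourier (-k) (fun i => (x i : UnitAddCircle)) =
      unitExp (-∑ i, (k i : ℝ) * x i) := by
  unfold UnitAddTorus.mFourier unitExp
  simp only [ContinuousMap.coe_mk, Fin.prod_univ_two, fourier_coe_apply, ← Complex.exp_add,
    Fin.sum_univ_two, Pi.neg_apply]
  congr 1
  push_cast
  ring

/-- The coordinates in the unit square of a point of the torus. -/
def torusCoords (t : UnitAddTorus (Fin 2)) : Fin 2 → ℝ :=
  (UnitAddTorus.measurableEquivPiIoc (fun _ => (-1 / 2 : ℝ)) t).1

lemma torusCoords_coe {x : Fin 2 → ℝ} (hx : x ∈ unitSquare) :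
    torusCoords (fun i => (x i : UnitAddCircle)) = x := by
  have h := (UnitAddTorus.measurableEquivPiIoc (fun _ : Fin 2 => (-1 / 2 : ℝ))).apply_symm_apply
    ⟨x, hx⟩
  rw [UnitAddTorus.coe_symm_measurableEquivPiIoc_apply] at h
  exact congrArg Subtype.val h

lemma measurePreserving_torusCoords :
    MeasurePreserving torusCoords volume (volume.restrict unitSquare) :=
  (measurePreserving_subtype_coe measurableSet_unitSquare).comp
    (UnitAddTorus.measurePreserving_equivPiIoc fun _ : Fin 2 => (-1 / 2 : ℝ))

lemma memLp_comp_torusCoords {H : (Fin 2 → ℝ) → ℂ} (hH : MemLp H 2) :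
    MemLp (fun t => H (torusCoords t)) 2 :=
  (hH.restrict unitSquare).comp_measurePreserving measurePreserving_torusCoords

lemma hasSum_sq_integral_unitSquare {H : (Fin 2 → ℝ) → ℂ} (hH : MemLp H 2)
    (hsupp : ∀ x, x ∉ unitSquare → H x = 0) :
    HasSum (fun k : Fin 2 → ℤ => ‖∫ x, H x * unitExp (∑ i, (k i : ℝ) * x i)‖ ^ 2)
      (∫ x, ‖H x‖ ^ 2) := by
  set f := (memLp_comp_torusCoords hH).toLp with hf
  have hfae : f =ᵐ[volume] fun t => H (torusCoords t) := MemLp.coeFn_toLp _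
  have h := UnitAddTorus.hasSum_sq_mFourierCoeff f
  have h1 : ∀ k, UnitAddTorus.mFourierCoeff f k =
      ∫ x, H x * unitExp (∑ i, ((-k) i : ℝ) * x i) := by
    intro k
    have e1 : UnitAddTorus.mFourierCoeff f k =
        UnitAddTorus.mFourierCoeff (fun t => H (torusCoords t)) k := by
      unfold UnitAddTorus.mFourierCoeff
      refine integral_congr_ae ?_
      filter_upwards [hfae] with t ht
      rw [ht]
    rw [e1, UnitAddTorus.mFourierCoeff_eq_integral _ _ fun _ => (-1 / 2 : ℝ)]
    rw [← setIntegral_eq_integral_of_forall_compl_eq_zero (s := unitSquare)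
      (f := fun x => H x * unitExp (∑ i, ((-k) i : ℝ) * x i)) (fun x hx => by
        rw [hsupp x hx, zero_mul])]
    refine setIntegral_congr_fun measurableSet_unitSquare fun x hx => ?_
    rw [torusCoords_coe hx, mFourier_neg_apply, smul_eq_mul, mul_comm]
    congr 2
    simp [Fin.sum_univ_two]
  have h2 : ∫ t, ‖f t‖ ^ 2 = ∫ x, ‖H x‖ ^ 2 := by
    have e1 : ∫ t, ‖f t‖ ^ 2 = ∫ t, ‖H (torusCoords t)‖ ^ 2 := by
      refine integral_congr_ae ?_
      filter_upwards [hfae] with t ht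
      rw [ht]
    rw [e1, UnitAddTorus.integral_preimage _ fun _ => (-1 / 2 : ℝ)]
    rw [← setIntegral_eq_integral_of_forall_compl_eq_zero (s := unitSquare)
      (f := fun x => ‖H x‖ ^ 2) (fun x hx => by rw [hsupp x hx, norm_zero]; norm_num)]
    refine setIntegral_congr_fun measurableSet_unitSquare fun x hx => ?_
    rw [torusCoords_coe hx]
  rw [h2] at h
  rw [← (Equiv.neg (Fin 2 → ℤ)).hasSum_iff]
  convert! h using 2 with k
  rw [Function.comp_apply, Equiv.neg_apply, h1]

/-- Parseval's identity for a square integrable function on the plane that vanishes off the unit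
square. -/
lemma hasSum_sq_integral_plane {G : Plane → ℂ} (hG : MemLp G 2)
    (hsupp : ∀ ξ : Plane, ξ.ofLp ∉ unitSquare → G ξ = 0) :
    HasSum (fun k : Fin 2 → ℤ => ‖∫ ξ, G ξ * unitExp (inner ℝ (lattice k) ξ)‖ ^ 2)
      (∫ ξ, ‖G ξ‖ ^ 2) := by
  have hmp := PiLp.volume_preserving_toLp (Fin 2)
  have hemb : MeasurableEmbedding (WithLp.toLp 2 : (Fin 2 → ℝ) → Plane) :=
    (MeasurableEquiv.toLp 2 (Fin 2 → ℝ)).measurableEmbedding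
  have h := hasSum_sq_integral_unitSquare (hG.comp_measurePreserving hmp) fun x hx => hsupp _ hx
  convert! h using 1
  · ext k
    rw [← hmp.integral_comp hemb]
    congr 3
    ext x
    simp only [Function.comp_apply]
    congr 2
    simp [lattice, PiLp.inner_apply, Fin.sum_univ_two]
    ring
  · rw [← hmp.integral_comp hemb]
    rfl

/-! ### The framelet system on the Fourier side -/

/-- The function `ξ ↦ φ^(2πξ)`. -/
def phiHat (a : Filter2) (ξ : Plane) : ℂ := refinableHat quincunxM a ((2 * Real.pi) • ξ.ofLp)

/-- The function `ξ ↦ ψ^(2πξ)` for the framelet with mask `c`. -/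
def psiHat (a c : Filter2) (ξ : Plane) : ℂ := frameletHat quincunxM a c ((2 * Real.pi) • ξ.ofLp)

lemma act_halfM (ξ : Plane) : act halfM ξ = !₂[(ξ 0 + ξ 1) / 2, (ξ 0 - ξ 1) / 2] := by
  unfold act
  rw [halfM_mulVec]

lemma psiHat_eq (a c : Filter2) (ξ : Plane) :
    psiHat a c ξ = symbol2 c ((2 * Real.pi) • (act halfM ξ).ofLp) * phiHat a (act halfM ξ) := by
  unfold psiHat frameletHat phiHat act
  rw [toReal_quincunxM_transpose_inv, Matrix.mulVec_smul]

lemma psiHat_self {a : Filter2} (ha : symbol2 a 0 = 1) : psiHat a a = phiHat a := by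
  ext ξ
  unfold psiHat frameletHat phiHat
  rw [toReal_quincunxM_transpose_inv, ← refinableHat_eq ha]

/-- The Fourier transform of `2^{J/2} f(M^J · - k)`, in terms of the Fourier transform `h`
of `f`. -/
def fourierAtom (J : ℕ) (k : Fin 2 → ℤ) (h : Plane → ℂ) (ξ : Plane) : ℂ :=
  (((√2)⁻¹ ^ J : ℝ) : ℂ) * unitExp (-inner ℝ (lattice k) (act (halfM ^ J) ξ)) *
    h (act (halfM ^ J) ξ)

/-- The coefficient of `F` with respect to `fourierAtom J k h`. -/
def frameCoef (F h : Plane → ℂ) (J : ℕ) (k : Fin 2 → ℤ) : ℂ :=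
  ∫ ξ, F ξ * conj (fourierAtom J k h ξ)

lemma inner_plane (x y : Plane) : inner ℝ x y = x 0 * y 0 + x 1 * y 1 := by
  simp [PiLp.inner_apply, Fin.sum_univ_two]
  ring

lemma lattice_apply (k : Fin 2 → ℤ) (i : Fin 2) : lattice k i = k i := rfl

lemma lattice_add (k l : Fin 2 → ℤ) : lattice (k + l) = lattice k + lattice l := by
  ext i
  simp [lattice_apply]

lemma symbol2_two_pi_smul (c : Filter2) (η : Plane) :
    symbol2 c ((2 * Real.pi) • η.ofLp) =
      ∑ m ∈ c.support, c m * unitExp (-inner ℝ (lattice m) η) := by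
  unfold symbol2 Finsupp.sum
  refine Finset.sum_congr rfl fun m _ => ?_
  beta_reduce
  congr 1
  unfold unitExp
  congr 1
  rw [inner_plane, Fin.sum_univ_two, lattice_apply, lattice_apply]
  simp only [Pi.smul_apply, smul_eq_mul]
  push_cast
  ring

/-- The matrices `Mᵀ` and `halfM` are inverse to each other. -/
lemma inner_lattice_quincunxM (k : Fin 2 → ℤ) (ζ : Plane) :
    inner ℝ (lattice (quincunxM *ᵥ k)) (act halfM ζ) = inner ℝ (lattice k) ζ := by
  rw [inner_plane, inner_plane, act_halfM, mulVec_two]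
  simp only [lattice_apply, quincunxM, Matrix.of_apply, Matrix.cons_val_zero, Matrix.cons_val_one,
    Matrix.cons_val']
  simp
  ring

lemma act_halfM_pow_succ (J : ℕ) (ξ : Plane) :
    act (halfM ^ (J + 1)) ξ = act halfM (act (halfM ^ J) ξ) := by
  rw [pow_succ', act_mul]

lemma sqrt_two_mul_inv : √2 * (√2)⁻¹ = 1 := mul_inv_cancel₀ (by positivity)

/-- The atoms of each level are finite combinations of the refinable atoms of the next one. -/
lemma fourierAtom_psiHat (a c : Filter2) (J : ℕ) (k : Fin 2 → ℤ) (ξ : Plane) :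
    fourierAtom J k (psiHat a c) ξ =
      (√2 : ℝ) * ∑ m ∈ c.support, c m *
        fourierAtom (J + 1) (quincunxM *ᵥ k + m) (phiHat a) ξ := by
  unfold fourierAtom
  rw [psiHat_eq, symbol2_two_pi_smul, ← act_halfM_pow_succ]
  simp only [lattice_add, inner_add_left, neg_add, unitExp_add]
  have h : inner ℝ (lattice (quincunxM *ᵥ k)) (act (halfM ^ (J + 1)) ξ) =
      inner ℝ (lattice k) (act (halfM ^ J) ξ) := by
    rw [act_halfM_pow_succ, inner_lattice_quincunxM]
  rw [h, Finset.sum_mul, Finset.mul_sum, Finset.mul_sum]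
  refine Finset.sum_congr rfl fun m _ => ?_
  have h2 : ((√2 : ℝ) : ℂ) * (((√2)⁻¹ ^ (J + 1) : ℝ) : ℂ) = (((√2)⁻¹ ^ J : ℝ) : ℂ) := by
    rw [← Complex.ofReal_mul, pow_succ', ← mul_assoc, sqrt_two_mul_inv, one_mul]
  rw [← h2]
  ring

lemma measurable_act (A : Matrix (Fin 2) (Fin 2) ℝ) : Measurable (act A) :=
  (continuous_act A).measurable

lemma measurable_phiHat {a : Filter2} (ha : symbol2 a 0 = 1) : Measurable (phiHat a) :=
  (measurable_refinableHat ha).comp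
    ((by fun_prop : Continuous fun ξ : Plane => (2 * Real.pi) • ξ.ofLp).measurable)

lemma norm_phiHat_le_one {a : Filter2} (ha : symbol2 a 0 = 1) (h1 : ∀ ω, ‖symbol2 a ω‖ ≤ 1)
    (ξ : Plane) : ‖phiHat a ξ‖ ≤ 1 := norm_refinableHat_le_one ha h1 _

lemma measurable_fourierAtom (J : ℕ) (k : Fin 2 → ℤ) {h : Plane → ℂ} (hh : Measurable h) :
    Measurable (fourierAtom J k h) := by
  unfold fourierAtom
  refine Measurable.mul ?_ (hh.comp (measurable_act _))
  refine measurable_const.mul (continuous_unitExp.measurable.comp ?_)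
  exact (Continuous.neg (continuous_const.inner (continuous_act _))).measurable

lemma norm_fourierAtom_le (J : ℕ) (k : Fin 2 → ℤ) {h : Plane → ℂ} (hh : ∀ ξ, ‖h ξ‖ ≤ 1)
    (ξ : Plane) : ‖fourierAtom J k h ξ‖ ≤ (√2)⁻¹ ^ J := by
  unfold fourierAtom
  rw [norm_mul, norm_mul, norm_unitExp, mul_one, Complex.norm_real, Real.norm_eq_abs,
    abs_of_nonneg (by positivity)]
  exact mul_le_of_le_one_right (by positivity) (hh _)

lemma integrable_mul_conj_fourierAtom (J : ℕ) (k : Fin 2 → ℤ) {F h : Plane → ℂ}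
    (hF : Integrable F) (hm : Measurable h) (hh : ∀ ξ, ‖h ξ‖ ≤ 1) :
    Integrable fun ξ => F ξ * conj (fourierAtom J k h ξ) := by
  refine hF.mul_bdd (c := (√2)⁻¹ ^ J) ?_ (Filter.Eventually.of_forall fun ξ => ?_)
  · exact (Complex.continuous_conj.measurable.comp
      (measurable_fourierAtom J k hm)).aestronglyMeasurable
  · rw [RCLike.norm_conj]
    exact norm_fourierAtom_le J k hh ξ

/-- The framelet coefficients at level `J` arise from the refinable ones at level `J + 1` by one channel
of the discrete framelet transform. -/
lemma frameCoef_psiHat {a : Filter2} (ha : symbol2 a 0 = 1) (h1 : ∀ ω, ‖symbol2 a ω‖ ≤ 1)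
    (c : Filter2) {F : Plane → ℂ} (hF : Integrable F) (J : ℕ) (k : Fin 2 → ℤ) :
    frameCoef F (psiHat a c) J k = analysis c (frameCoef F (phiHat a) (J + 1)) k := by
  have hi : ∀ l, Integrable fun ξ => F ξ * conj (fourierAtom (J + 1) l (phiHat a) ξ) := fun l =>
    integrable_mul_conj_fourierAtom (J + 1) l hF (measurable_phiHat ha) (norm_phiHat_le_one ha h1)
  unfold frameCoef analysis
  simp only [fourierAtom_psiHat, map_mul, map_sum, Complex.conj_ofReal]
  simp only [← integral_const_mul]
  rw [← integral_finsetSum _ fun m _ => (hi _).const_mul _, ← integral_const_mul]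
  refine integral_congr_ae (Filter.Eventually.of_forall fun ξ => ?_)
  beta_reduce
  rw [Finset.mul_sum, Finset.mul_sum, Finset.mul_sum]
  refine Finset.sum_congr rfl fun m _ => ?_
  ring

/-- One step of the cascade: the energy at level `J + 1` splits among the channels at
level `J`. -/
lemma sum_tsum_frameCoef {ι : Type*} [Fintype ι] {a : Filter2} (ha : symbol2 a 0 = 1)
    (h1 : ∀ ω, ‖symbol2 a ω‖ ≤ 1) {c : ι → Filter2} (hc : IsParaunitary c) {F : Plane → ℂ}
    (hF : Integrable F) (J : ℕ) (hs : Summable fun k => ‖frameCoef F (phiHat a) (J + 1) k‖ ^ 2) :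
    (∀ i, Summable fun k => ‖frameCoef F (psiHat a (c i)) J k‖ ^ 2) ∧
      ∑ i, ∑' k, ‖frameCoef F (psiHat a (c i)) J k‖ ^ 2 =
        ∑' k, ‖frameCoef F (phiHat a) (J + 1) k‖ ^ 2 := by
  simp only [frameCoef_psiHat ha h1 _ hF]
  exact hc.sum_tsum_norm_sq_analysis hs

lemma det_halfM : halfM.det = -1 / 2 := by
  rw [Matrix.det_fin_two]
  norm_num [halfM]

lemma det_halfM_pow_ne_zero (J : ℕ) : (halfM ^ J).det ≠ 0 := by
  rw [Matrix.det_pow, det_halfM]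
  exact pow_ne_zero _ (by norm_num)

lemma abs_det_halfM_pow_inv (J : ℕ) : |(halfM ^ J).det⁻¹| = 2 ^ J := by
  rw [Matrix.det_pow, det_halfM, abs_inv, abs_pow, ← inv_pow]
  norm_num

lemma norm_plane (x : Plane) : ‖x‖ = √(sqLength x.ofLp) := by
  rw [EuclideanSpace.norm_eq, Fin.sum_univ_two]
  simp [sqLength]

lemma norm_act_halfM_pow (J : ℕ) (x : Plane) : ‖act (halfM ^ J) x‖ = √(1 / 2) ^ J * ‖x‖ := by
  rw [norm_plane, norm_plane]
  exact sqrt_sqLength_halfM_pow J x.ofLp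

lemma mem_unitSquare_of_norm_lt {x : Plane} (hx : ‖x‖ < 1 / 2) : x.ofLp ∈ unitSquare := by
  intro i
  have h := (abs_apply_le_sqrt_sqLength x.ofLp i).trans_lt (norm_plane x ▸ hx)
  rw [abs_lt] at h
  constructor <;> linarith [h.1, h.2]

/-- At a level where the dilated spectrum of `F` fits into the unit square, Parseval's identity
computes the energy of the refinable coefficients. -/
lemma hasSum_frameCoef_phiHat {a : Filter2} (ha : symbol2 a 0 = 1) (h1 : ∀ ω, ‖symbol2 a ω‖ ≤ 1)
    {F : Plane → ℂ} (hF : MemLp F 2) {R : ℝ} (hR : ∀ ξ, R < ‖ξ‖ → F ξ = 0) {J : ℕ}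
    (hJ : √(1 / 2) ^ J * R < 1 / 2) :
    HasSum (fun k => ‖frameCoef F (phiHat a) J k‖ ^ 2)
      (∫ ξ, ‖F ξ‖ ^ 2 * ‖phiHat a (act (halfM ^ J) ξ)‖ ^ 2) := by
  have hd := det_halfM_pow_ne_zero J
  have hd' : ((halfM ^ J)⁻¹).det ≠ 0 := by
    rw [Matrix.det_nonsing_inv, Ring.inverse_eq_inv']
    exact inv_ne_zero hd
  set G : Plane → ℂ := fun η => ((√2 ^ J : ℝ) : ℂ) *
    (conj (phiHat a η) * F (act (halfM ^ J)⁻¹ η)) with hG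
  have hGm : MemLp G 2 := by
    refine MemLp.const_mul ?_ _
    refine memLp_mul_of_bound (K := 1) ?_
      (Complex.continuous_conj.measurable.comp (measurable_phiHat ha)) fun η => ?_
    · simpa using memLp_comp_affine hd' 0 hF
    · rw [RCLike.norm_conj]
      exact norm_phiHat_le_one ha h1 η
  have hGs : ∀ η : Plane, η.ofLp ∉ unitSquare → G η = 0 := by
    intro η hη
    have h2 : F (act (halfM ^ J)⁻¹ η) = 0 := by
      apply hR
      by_contra hle
      push Not at hle
      apply hη
      apply mem_unitSquare_of_norm_lt
      calc ‖η‖ = ‖act (halfM ^ J) (act (halfM ^ J)⁻¹ η)‖ := by rw [act_act_inv hd]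
        _ = √(1 / 2) ^ J * ‖act (halfM ^ J)⁻¹ η‖ := norm_act_halfM_pow _ _
        _ ≤ √(1 / 2) ^ J * R := by gcongr
        _ < 1 / 2 := hJ
    simp [hG, h2]
  -- After the substitution `η = halfM ^ J ξ` the coefficients of `F` are Fourier coefficients of `G`.
  have hs2 : (√2 ^ J) * (√2 ^ J) = (2 : ℝ) ^ J := by
    rw [← mul_pow, Real.mul_self_sqrt zero_le_two]
  have hcoef : ∀ k, frameCoef F (phiHat a) J k =
      ∫ η, G η * unitExp (inner ℝ (lattice k) η) := by
    intro k
    have h3 := integral_comp_act hd fun η => F (act (halfM ^ J)⁻¹ η) *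
      conj ((((√2)⁻¹ ^ J : ℝ) : ℂ) * unitExp (-inner ℝ (lattice k) η) * phiHat a η)
    simp only [act_inv_act hd] at h3
    unfold frameCoef fourierAtom
    rw [h3, abs_det_halfM_pow_inv, Complex.real_smul, ← integral_const_mul]
    refine integral_congr_ae (Filter.Eventually.of_forall fun η => ?_)
    beta_reduce
    rw [map_mul, map_mul, conj_unitExp, neg_neg, Complex.conj_ofReal, hG, ← hs2]
    beta_reduce
    have h4 : ((√2 ^ J : ℝ) : ℂ) * (((√2)⁻¹ ^ J : ℝ) : ℂ) = 1 := by
      rw [← Complex.ofReal_mul, ← mul_pow, sqrt_two_mul_inv, one_pow, Complex.ofReal_one]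
    rw [Complex.ofReal_mul]
    linear_combination ((√2 ^ J : ℝ) : ℂ) * F (act (halfM ^ J)⁻¹ η) *
      unitExp (inner ℝ (lattice k) η) * conj (phiHat a η) * h4
  have hint : ∫ ξ, ‖F ξ‖ ^ 2 * ‖phiHat a (act (halfM ^ J) ξ)‖ ^ 2 = ∫ η, ‖G η‖ ^ 2 := by
    have h3 := integral_comp_act hd fun η => ‖F (act (halfM ^ J)⁻¹ η)‖ ^ 2 * ‖phiHat a η‖ ^ 2
    simp only [act_inv_act hd] at h3
    rw [h3, abs_det_halfM_pow_inv, smul_eq_mul, ← integral_const_mul]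
    refine integral_congr_ae (Filter.Eventually.of_forall fun η => ?_)
    beta_reduce
    rw [hG]
    beta_reduce
    rw [norm_mul, norm_mul, RCLike.norm_conj, Complex.norm_real, Real.norm_eq_abs,
      abs_of_nonneg (by positivity), mul_pow, sq (√2 ^ J), hs2]
    ring
  rw [hint]
  simp only [hcoef]
  exact hasSum_sq_integral_plane hGm hGs

lemma integrable_of_memLp_of_bounded_support {F : Plane → ℂ} (hF : MemLp F 2) {R : ℝ}
    (hR : ∀ ξ, R < ‖ξ‖ → F ξ = 0) : Integrable F := by
  have h : IntegrableOn F (Metric.closedBall 0 R) := by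
    have : IsFiniteMeasure (volume.restrict (Metric.closedBall (0 : Plane) R)) :=
      ⟨by rw [Measure.restrict_apply_univ]; exact measure_closedBall_lt_top⟩
    exact (hF.restrict (Metric.closedBall 0 R)).integrable one_le_two
  refine (integrableOn_iff_integrable_of_support_subset fun ξ hξ => ?_).1 h
  rw [mem_closedBall_zero_iff]
  by_contra hlt
  exact hξ (hR ξ (not_le.1 hlt))

lemma tendsto_phiHat_halfM_pow {a : Filter2} (ha : symbol2 a 0 = 1) (ξ : Plane) :
    Filter.Tendsto (fun J : ℕ => phiHat a (act (halfM ^ J) ξ)) Filter.atTop (nhds 1) := by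
  have h := tendsto_refinableHat_halfM_pow ha ((2 * Real.pi) • ξ.ofLp)
  simp only [Matrix.mulVec_smul] at h
  exact h

/-- As the level grows, the energy of the refinable coefficients tends to the full energy. -/
lemma tendsto_integral_phiHat {a : Filter2} (ha : symbol2 a 0 = 1) (h1 : ∀ ω, ‖symbol2 a ω‖ ≤ 1)
    {F : Plane → ℂ} (hF : MemLp F 2) :
    Filter.Tendsto (fun J : ℕ => ∫ ξ, ‖F ξ‖ ^ 2 * ‖phiHat a (act (halfM ^ J) ξ)‖ ^ 2) Filter.atTop
      (nhds (∫ ξ, ‖F ξ‖ ^ 2)) := by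
  have hF2 := (memLp_two_iff_integrable_sq_norm hF.1).1 hF
  refine tendsto_integral_of_dominated_convergence (fun ξ => ‖F ξ‖ ^ 2) (fun J => ?_) hF2
    (fun J => Filter.Eventually.of_forall fun ξ => ?_) (Filter.Eventually.of_forall fun ξ => ?_)
  · exact hF2.1.mul
      (((measurable_phiHat ha).comp (measurable_act _)).norm.pow_const 2).aestronglyMeasurable
  · rw [Real.norm_eq_abs, abs_of_nonneg (by positivity)]
    exact mul_le_of_le_one_right (by positivity)
      (pow_le_one₀ (norm_nonneg _) (norm_phiHat_le_one ha h1 _))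
  · have := ((tendsto_phiHat_halfM_pow ha ξ).norm.pow 2).const_mul (‖F ξ‖ ^ 2)
    simpa using this

/-! ### The unitary extension principle -/

section Frame

variable {H I : Type*} [NormedAddCommGroup H] [InnerProductSpace ℂ H]

/-- A Parseval identity that holds on a dense set holds everywhere, because both sides are squared
norms of continuous linear maps. -/
lemma tsum_enorm_inner_sq_of_dense {e : I → H} {D : Set H} (hD : Dense D)
    (h : ∀ f ∈ D, ∑' i, ‖inner ℂ (e i) f‖ₑ ^ 2 = ‖f‖ₑ ^ 2) (f : H) :
    ∑' i, ‖inner ℂ (e i) f‖ₑ ^ 2 = ‖f‖ₑ ^ 2 := by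
  have conv : ∀ f : H, ∀ i, ‖inner ℂ (e i) f‖ₑ ^ 2 = ENNReal.ofReal (‖inner ℂ (e i) f‖ ^ 2) := by
    intro f i
    rw [ENNReal.ofReal_pow (norm_nonneg _), ofReal_norm]
  have conv' : ∀ f : H, ‖f‖ₑ ^ 2 = ENNReal.ofReal (‖f‖ ^ 2) := by
    intro f
    rw [ENNReal.ofReal_pow (norm_nonneg _), ofReal_norm]
  have bessel : ∀ f : H, ∀ s : Finset I, ∑ i ∈ s, ‖inner ℂ (e i) f‖ ^ 2 ≤ ‖f‖ ^ 2 := by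
    intro f s
    have hcl : IsClosed {f : H | ∑ i ∈ s, ‖inner ℂ (e i) f‖ ^ 2 ≤ ‖f‖ ^ 2} :=
      isClosed_le (by fun_prop) (by fun_prop)
    refine hcl.closure_subset_iff.2 (fun f hf => ?_) (hD f)
    have h1 : ∑ i ∈ s, ‖inner ℂ (e i) f‖ₑ ^ 2 ≤ ‖f‖ₑ ^ 2 := h f hf ▸ ENNReal.sum_le_tsum s
    simp only [conv, conv'] at h1
    rw [← ENNReal.ofReal_sum_of_nonneg fun _ _ => by positivity] at h1
    exact (ENNReal.ofReal_le_ofReal_iff (by positivity)).1 h1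
  have hsum : ∀ f : H, Summable fun i => ‖inner ℂ (e i) f‖ ^ 2 := fun f =>
    summable_of_sum_le (fun _ => by positivity) (bessel f)
  have hmem : ∀ f : H, Memℓp (fun i => inner ℂ (e i) f) 2 := fun f =>
    memℓp_gen (by simpa using hsum f)
  let T₀ : H →ₗ[ℂ] lp (fun _ : I => ℂ) 2 :=
    { toFun := fun f => ⟨fun i => inner ℂ (e i) f, hmem f⟩
      map_add' := fun f g => by ext i; exact inner_add_right _ _ _
      map_smul' := fun c f => by ext i; exact inner_smul_right _ _ _ }
  have hT₀ : ∀ f, ‖T₀ f‖ ^ 2 = ∑' i, ‖inner ℂ (e i) f‖ ^ 2 := by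
    intro f
    have := lp.norm_rpow_eq_tsum (p := 2) (by norm_num) (T₀ f)
    have h2 : ‖T₀ f‖ ^ 2 = ∑' i, ‖T₀ f i‖ ^ 2 := by simpa using this
    exact h2
  let T : H →L[ℂ] lp (fun _ : I => ℂ) 2 := T₀.mkContinuous 1 fun f => by
    rw [one_mul, ← sq_le_sq₀ (norm_nonneg _) (norm_nonneg _), hT₀]
    exact (hsum f).tsum_le_of_sum_le (bessel f)
  have hT : ∀ f, ENNReal.ofReal (‖T f‖ ^ 2) = ∑' i, ‖inner ℂ (e i) f‖ₑ ^ 2 := by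
    intro f
    simp only [conv]
    rw [← ENNReal.ofReal_tsum_of_nonneg (fun _ => by positivity) (hsum f)]
    exact congrArg ENNReal.ofReal (hT₀ f)
  have hclosed : IsClosed {f : H | ‖T f‖ ^ 2 = ‖f‖ ^ 2} :=
    isClosed_eq (T.continuous.norm.pow 2) (continuous_norm.pow 2)
  have hall : ‖T f‖ ^ 2 = ‖f‖ ^ 2 := by
    refine hclosed.closure_subset_iff.2 (fun g hg => ?_) (hD f)
    have h2 := h g hg
    rw [← hT, conv', ENNReal.ofReal_eq_ofReal_iff (by positivity) (by positivity)] at h2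
    exact h2
  rw [← hT, conv', hall]

end Frame

/-- The refinable coefficients gain energy from level `J` to level `J + 1` by exactly the energy
of the framelet coefficients at level `J`. -/
lemma cascade {L : ℕ} {a : Filter2} {b : Fin L → Filter2} (ha : symbol2 a 0 = 1)
    (h1 : ∀ ω, ‖symbol2 a ω‖ ≤ 1)
    (hc : IsParaunitary fun i : Option (Fin L) => i.elim a b) {F : Plane → ℂ}
    (hF : Integrable F) (J : ℕ) (hs : Summable fun k => ‖frameCoef F (phiHat a) (J + 1) k‖ ^ 2) :
    (Summable fun k => ‖frameCoef F (phiHat a) J k‖ ^ 2) ∧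
      (∀ ℓ, Summable fun k => ‖frameCoef F (psiHat a (b ℓ)) J k‖ ^ 2) ∧
      ∑' k, ‖frameCoef F (phiHat a) (J + 1) k‖ ^ 2 =
        ∑' k, ‖frameCoef F (phiHat a) J k‖ ^ 2 +
          ∑ ℓ, ∑' k, ‖frameCoef F (psiHat a (b ℓ)) J k‖ ^ 2 := by
  obtain ⟨h2, h3⟩ := sum_tsum_frameCoef ha h1 hc hF J hs
  rw [Fintype.sum_option] at h3
  refine ⟨?_, fun ℓ => h2 (some ℓ), ?_⟩
  · have := h2 none
    simpa only [Option.elim_none, psiHat_self ha] using this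
  · simpa only [Option.elim_none, Option.elim_some, psiHat_self ha] using h3.symm

lemma enorm_sq_eq_ofReal (z : ℂ) : ‖z‖ₑ ^ 2 = ENNReal.ofReal (‖z‖ ^ 2) := by
  rw [ENNReal.ofReal_pow (norm_nonneg _), ofReal_norm]

lemma tsum_enorm_sq {I : Type*} {c : I → ℂ} (hs : Summable fun i => ‖c i‖ ^ 2) :
    ∑' i, ‖c i‖ₑ ^ 2 = ENNReal.ofReal (∑' i, ‖c i‖ ^ 2) := by
  simp only [enorm_sq_eq_ofReal]
  exact (ENNReal.ofReal_tsum_of_nonneg (fun _ => by positivity) hs).symm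

lemma lintegral_enorm_sq {F : Plane → ℂ} (hF : MemLp F 2) :
    ∫⁻ ξ, ‖F ξ‖ₑ ^ 2 = ENNReal.ofReal (∫ ξ, ‖F ξ‖ ^ 2) := by
  simp only [enorm_sq_eq_ofReal]
  exact (ofReal_integral_eq_lintegral_ofReal ((memLp_two_iff_integrable_sq_norm hF.1).1 hF)
    (Filter.Eventually.of_forall fun _ => by positivity)).symm

/-- The frame identity for functions with bounded spectrum. -/
lemma frame_identity_of_bounded {L : ℕ} {a : Filter2} {b : Fin L → Filter2}
    (ha : symbol2 a 0 = 1) (h1 : ∀ ω, ‖symbol2 a ω‖ ≤ 1)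
    (hc : IsParaunitary fun i : Option (Fin L) => i.elim a b) {F : Plane → ℂ}
    (hF : MemLp F 2) {R : ℝ} (hR : ∀ ξ, R < ‖ξ‖ → F ξ = 0) :
    ∑' k, ‖frameCoef F (phiHat a) 0 k‖ₑ ^ 2 +
      ∑' J, ∑ ℓ, ∑' k, ‖frameCoef F (psiHat a (b ℓ)) J k‖ₑ ^ 2 = ∫⁻ ξ, ‖F ξ‖ₑ ^ 2 := by
  have hF1 := integrable_of_memLp_of_bounded_support hF hR
  have hev : ∀ᶠ J : ℕ in Filter.atTop, √(1 / 2) ^ J * R < 1 / 2 := by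
    have := (tendsto_pow_atTop_nhds_zero_of_lt_one (Real.sqrt_nonneg _)
      sqrt_half_lt_one).mul_const R
    rw [zero_mul] at this
    exact this.eventually_lt_const (by norm_num)
  -- Summability is known at high levels and descends along the cascade.
  have hdown : ∀ n J, (Summable fun k => ‖frameCoef F (phiHat a) (J + n) k‖ ^ 2) →
      Summable fun k => ‖frameCoef F (phiHat a) J k‖ ^ 2 := by
    intro n
    induction n with
    | zero => exact fun J h => h
    | succ n ih => exact fun J h => ih J (cascade ha h1 hc hF1 (J + n) h).1
  have hsum : ∀ J, Summable fun k => ‖frameCoef F (phiHat a) J k‖ ^ 2 := by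
    intro J
    obtain ⟨N, hN⟩ := Filter.eventually_atTop.1 hev
    exact hdown N J (hasSum_frameCoef_phiHat ha h1 hF hR (hN _ (Nat.le_add_left N J))).summable
  -- `s` is the energy of the refinable coefficients and `t` that of the framelet coefficients.
  set s : ℕ → ENNReal := fun J => ∑' k, ‖frameCoef F (phiHat a) J k‖ₑ ^ 2 with hsdef
  set t : ℕ → ENNReal := fun J => ∑ ℓ, ∑' k, ‖frameCoef F (psiHat a (b ℓ)) J k‖ₑ ^ 2 with ht
  have hstep : ∀ J, s (J + 1) = s J + t J := by
    intro J
    obtain ⟨-, h3, h4⟩ := cascade ha h1 hc hF1 J (hsum (J + 1))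
    simp only [hsdef, ht, tsum_enorm_sq (hsum _), tsum_enorm_sq (h3 _)]
    rw [h4, ENNReal.ofReal_add (tsum_nonneg fun _ => by positivity)
      (Finset.sum_nonneg fun _ _ => tsum_nonneg fun _ => by positivity),
      ENNReal.ofReal_sum_of_nonneg fun _ _ => tsum_nonneg fun _ => by positivity]
  have hsum_t : ∀ J, s J = s 0 + ∑ j ∈ Finset.range J, t j := by
    intro J
    induction J with
    | zero => simp
    | succ J ih => rw [hstep, ih, Finset.sum_range_succ, add_assoc]
  have hlim1 : Filter.Tendsto s Filter.atTop (nhds (s 0 + ∑' J, t J)) :=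
    ((ENNReal.tendsto_nat_tsum t).const_add (s 0)).congr fun J => (hsum_t J).symm
  have hlim2 : Filter.Tendsto s Filter.atTop (nhds (∫⁻ ξ, ‖F ξ‖ₑ ^ 2)) := by
    rw [lintegral_enorm_sq hF]
    refine (ENNReal.tendsto_ofReal (tendsto_integral_phiHat ha h1 hF)).congr' ?_
    filter_upwards [hev] with J hJ
    simp only [hsdef, tsum_enorm_sq (hsum _)]
    rw [(hasSum_frameCoef_phiHat ha h1 hF hR hJ).tsum_eq]
  exact tendsto_nhds_unique hlim1 hlim2

lemma fourierAtom_zero (h : Plane → ℂ) : fourierAtom 0 0 h = h := by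
  ext ξ
  have h0 : lattice 0 = 0 := by ext i; simp [lattice_apply]
  simp [fourierAtom, h0, act_one, unitExp]

/-- The refinable function is square integrable: testing the Bessel inequality on the truncation
of `φ^` to a ball bounds the energy of `φ^` in that ball by `1`. -/
lemma memLp_phiHat {L : ℕ} {a : Filter2} {b : Fin L → Filter2}
    (ha : symbol2 a 0 = 1) (h1 : ∀ ω, ‖symbol2 a ω‖ ≤ 1)
    (hc : IsParaunitary fun i : Option (Fin L) => i.elim a b) : MemLp (phiHat a) 2 := by
  have hm := measurable_phiHat ha
  have hloc : ∀ R : ℝ, IntegrableOn (fun ξ => ‖phiHat a ξ‖ ^ 2) (Metric.closedBall 0 R) := by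
    intro R
    refine Integrable.mono' (g := fun _ => (1 : ℝ)) ?_ (hm.norm.pow_const 2).aestronglyMeasurable
      (Filter.Eventually.of_forall fun ξ => ?_)
    · exact (integrable_const_iff_isFiniteMeasure one_ne_zero).2
        ⟨by rw [Measure.restrict_apply_univ]; exact measure_closedBall_lt_top⟩
    · rw [Real.norm_eq_abs, abs_of_nonneg (by positivity)]
      exact pow_le_one₀ (norm_nonneg _) (norm_phiHat_le_one ha h1 ξ)
  have hbound : ∀ R : ℝ, ∫ ξ in Metric.closedBall 0 R, ‖phiHat a ξ‖ ^ 2 ≤ 1 := by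
    intro R
    set F : Plane → ℂ := (Metric.closedBall 0 R).indicator (phiHat a) with hFdef
    have hFsq : ∀ ξ, ‖F ξ‖ ^ 2 =
        (Metric.closedBall (0 : Plane) R).indicator (fun ξ => ‖phiHat a ξ‖ ^ 2) ξ := by
      intro ξ
      by_cases hξ : ξ ∈ Metric.closedBall (0 : Plane) R <;> simp [hFdef, hξ]
    have hFm : AEStronglyMeasurable F :=
      (hm.indicator Metric.isClosed_closedBall.measurableSet).aestronglyMeasurable
    have hF : MemLp F 2 := by
      rw [memLp_two_iff_integrable_sq_norm hFm]
      simp only [hFsq]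
      exact (hloc R).integrable_indicator Metric.isClosed_closedBall.measurableSet
    have hR : ∀ ξ, R < ‖ξ‖ → F ξ = 0 := by
      intro ξ hξ
      exact Set.indicator_of_notMem (by simpa using hξ) _
    have hI : ∫ ξ, ‖F ξ‖ ^ 2 = ∫ ξ in Metric.closedBall 0 R, ‖phiHat a ξ‖ ^ 2 := by
      simp only [hFsq]
      exact integral_indicator Metric.isClosed_closedBall.measurableSet
    have hcoef : frameCoef F (phiHat a) 0 0 = ((∫ ξ, ‖F ξ‖ ^ 2 : ℝ) : ℂ) := by
      unfold frameCoef
      rw [fourierAtom_zero, ← integral_complex_ofReal]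
      refine integral_congr_ae (Filter.Eventually.of_forall fun ξ => ?_)
      by_cases hξ : ξ ∈ Metric.closedBall (0 : Plane) R
      · simp [hFdef, hξ, Complex.mul_conj']
      · simp [hFdef, hξ]
    have hid := frame_identity_of_bounded ha h1 hc hF hR
    rw [lintegral_enorm_sq hF] at hid
    -- With `I = ∫ ‖F‖²`, a single term of the frame identity gives `I² ≤ I`.
    have hle : ‖frameCoef F (phiHat a) 0 0‖ₑ ^ 2 ≤ ENNReal.ofReal (∫ ξ, ‖F ξ‖ ^ 2) := by
      rw [← hid]
      exact (ENNReal.le_tsum (f := fun k => ‖frameCoef F (phiHat a) 0 k‖ₑ ^ 2) 0).trans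
        le_self_add
    have hnn : 0 ≤ ∫ ξ, ‖F ξ‖ ^ 2 := integral_nonneg fun _ => by positivity
    rw [enorm_sq_eq_ofReal, ENNReal.ofReal_le_ofReal_iff hnn, hcoef, Complex.norm_real,
      Real.norm_eq_abs, abs_of_nonneg hnn] at hle
    rw [← hI]
    nlinarith
  rw [memLp_two_iff_integrable_sq_norm hm.aestronglyMeasurable]
  refine (aecover_closedBall (x := (0 : Plane)) tendsto_natCast_atTop_atTop
    ).integrable_of_integral_norm_bounded 1 (fun n => hloc n) (Filter.Eventually.of_forall fun n => ?_)
  simpa using hbound n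

lemma memLp_fourierAtom (J : ℕ) (k : Fin 2 → ℤ) {h : Plane → ℂ} (hh : MemLp h 2) :
    MemLp (fourierAtom J k h) 2 := by
  have h1 : Measurable fun ξ : Plane => (((√2)⁻¹ ^ J : ℝ) : ℂ) *
      unitExp (-inner ℝ (lattice k) (act (halfM ^ J) ξ)) := by
    refine measurable_const.mul (continuous_unitExp.measurable.comp ?_)
    exact (Continuous.neg (continuous_const.inner (continuous_act _))).measurable
  have h2 := memLp_mul_of_bound (K := (√2)⁻¹ ^ J)
    (memLp_comp_affine (det_halfM_pow_ne_zero J) 0 hh) h1 fun ξ => by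
      rw [norm_mul, norm_unitExp, mul_one, Complex.norm_real, Real.norm_eq_abs,
        abs_of_nonneg (by positivity)]
  simp only [add_zero] at h2
  exact h2

lemma inner_toLp {g : Plane → ℂ} (hg : MemLp g 2) (F : Lp ℂ 2 (volume : Measure Plane)) :
    inner ℂ (hg.toLp g) F = ∫ ξ, F ξ * conj (g ξ) := by
  rw [L2.inner_def]
  refine integral_congr_ae ?_
  filter_upwards [hg.coeFn_toLp] with ξ h
  rw [h, RCLike.inner_apply]

lemma inner_toLp_fourierAtom (J : ℕ) (k : Fin 2 → ℤ) {h : Plane → ℂ} (hh : MemLp h 2)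
    (F : Lp ℂ 2 (volume : Measure Plane)) :
    inner ℂ ((memLp_fourierAtom J k hh).toLp (fourierAtom J k h)) F = frameCoef F h J k :=
  inner_toLp _ _

lemma frameCoef_congr {F G : Plane → ℂ} (h : F =ᵐ[volume] G) (g : Plane → ℂ) (J : ℕ)
    (k : Fin 2 → ℤ) : frameCoef F g J k = frameCoef G g J k := by
  refine integral_congr_ae ?_
  filter_upwards [h] with ξ hξ
  rw [hξ]

lemma enorm_sq_eq_lintegral (F : Lp ℂ 2 (volume : Measure Plane)) :
    ‖F‖ₑ ^ 2 = ∫⁻ ξ, ‖F ξ‖ₑ ^ 2 := by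
  rw [Lp.enorm_def, eLpNorm_eq_lintegral_rpow_enorm_toReal (by norm_num) (by norm_num)]
  rw [← ENNReal.rpow_natCast, ← ENNReal.rpow_mul]
  norm_num

/-- The square integrable functions on the plane with a representative of bounded support. -/
def boundedSupport : Set (Lp ℂ 2 (volume : Measure Plane)) :=
  {F | ∃ (g : Plane → ℂ) (R : ℝ), F =ᵐ[volume] g ∧ ∀ ξ, R < ‖ξ‖ → g ξ = 0}

lemma dense_boundedSupport : Dense boundedSupport := by
  intro F
  rw [EMetric.mem_closure_iff]
  intro ε hε
  obtain ⟨δ, hδ, hδε⟩ := exists_between hε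
  obtain ⟨g, hgs, hg, -, hg2⟩ :=
    (Lp.memLp F).exists_hasCompactSupport_eLpNorm_sub_le ENNReal.ofNat_ne_top hδ.ne'
  refine ⟨hg2.toLp g, ?_, lt_of_le_of_lt ?_ hδε⟩
  · obtain ⟨R, hR⟩ := hgs.isCompact.isBounded.subset_closedBall 0
    refine ⟨g, R, hg2.coeFn_toLp, fun ξ hξ => image_eq_zero_of_notMem_tsupport fun hmem => ?_⟩
    have := hR hmem
    rw [mem_closedBall_zero_iff] at this
    exact absurd hξ (not_lt.2 this)
  · rw [Lp.edist_def]
    refine le_of_eq_of_le (eLpNorm_congr_ae ?_) hg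
    filter_upwards [hg2.coeFn_toLp] with ξ h
    rw [Pi.sub_apply, Pi.sub_apply, h]

lemma memLp_psiHat {a : Filter2} (c : Filter2) (hc : ∀ ω, ‖symbol2 c ω‖ ≤ 1)
    (hφ : MemLp (phiHat a) 2) : MemLp (psiHat a c) 2 := by
  have h1 : Measurable fun ξ : Plane => symbol2 c ((2 * Real.pi) • (act halfM ξ).ofLp) := by
    refine ((continuous_symbol2 c).comp ?_).measurable
    exact ((PiLp.continuous_ofLp 2 _).comp (continuous_act halfM)).const_smul (2 * Real.pi)
  have hd : halfM.det ≠ 0 := by simpa using det_halfM_pow_ne_zero 1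
  have h2 := memLp_mul_of_bound (memLp_comp_affine hd 0 hφ) h1 fun ξ => hc _
  simp only [add_zero, ← psiHat_eq] at h2
  exact h2

lemma IsParaunitary.norm_symbol2_le_one {ι : Type*} [Fintype ι] {c : ι → Filter2}
    (hc : IsParaunitary c) (i : ι) (ω : Fin 2 → ℝ) : ‖symbol2 (c i) ω‖ ≤ 1 := by
  have h := Finset.single_le_sum (f := fun i => ‖symbol2 (c i) ω‖ ^ 2)
    (fun _ _ => by positivity) (Finset.mem_univ i)
  rw [hc.1 ω] at h
  exact (sq_le_one_iff₀ (norm_nonneg _)).1 h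

/-- The unitary extension principle, on the Fourier side. -/
lemma frame_identity {L : ℕ} {a : Filter2} {b : Fin L → Filter2} (ha : symbol2 a 0 = 1)
    (hc : IsParaunitary fun i : Option (Fin L) => i.elim a b)
    (F : Lp ℂ 2 (volume : Measure Plane)) :
    ∑' k, ‖frameCoef F (phiHat a) 0 k‖ₑ ^ 2 +
      ∑' J, ∑ ℓ, ∑' k, ‖frameCoef F (psiHat a (b ℓ)) J k‖ₑ ^ 2 = ∫⁻ ξ, ‖F ξ‖ₑ ^ 2 := by
  have h1 : ∀ ω, ‖symbol2 a ω‖ ≤ 1 := hc.norm_symbol2_le_one none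
  have hφ := memLp_phiHat ha h1 hc
  have hψ : ∀ ℓ, MemLp (psiHat a (b ℓ)) 2 := fun ℓ =>
    memLp_psiHat _ (hc.norm_symbol2_le_one (some ℓ)) hφ
  let e : (Fin 2 → ℤ) ⊕ (ℕ × Fin L × (Fin 2 → ℤ)) → Lp ℂ 2 (volume : Measure Plane) :=
    Sum.elim (fun k => (memLp_fourierAtom 0 k hφ).toLp _)
      fun p => (memLp_fourierAtom p.1 p.2.2 (hψ p.2.1)).toLp _
  have he : ∀ F, ∑' i, ‖inner ℂ (e i) F‖ₑ ^ 2 = ∑' k, ‖frameCoef F (phiHat a) 0 k‖ₑ ^ 2 +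
      ∑' J, ∑ ℓ, ∑' k, ‖frameCoef F (psiHat a (b ℓ)) J k‖ₑ ^ 2 := by
    intro F
    rw [ENNReal.summable.tsum_sum ENNReal.summable, ENNReal.tsum_prod']
    congr 1
    · exact tsum_congr fun k => by rw [← inner_toLp_fourierAtom 0 k hφ F]; rfl
    · refine tsum_congr fun J => ?_
      rw [ENNReal.tsum_prod', tsum_fintype]
      refine Finset.sum_congr rfl fun ℓ _ => tsum_congr fun k => ?_
      rw [← inner_toLp_fourierAtom J k (hψ ℓ) F]
      rfl
  rw [← he, ← enorm_sq_eq_lintegral]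
  refine tsum_enorm_inner_sq_of_dense dense_boundedSupport ?_ F
  rintro G ⟨g, R, hGg, hR⟩
  rw [he, enorm_sq_eq_lintegral]
  simp only [frameCoef_congr hGg]
  rw [frame_identity_of_bounded ha h1 hc ((memLp_congr_ae hGg).1 (Lp.memLp G)) hR]
  refine lintegral_congr_ae ?_
  filter_upwards [hGg] with ξ h
  rw [h]

/-! ### The framelet system in the plane -/

lemma det_toReal_quincunxM_pow (J : ℕ) : (toReal quincunxM ^ J).det = (-2) ^ J := by
  rw [Matrix.det_pow, toReal_quincunxM, Matrix.det_fin_two]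
  norm_num

lemma toReal_quincunxM_pow_inv_transpose (J : ℕ) : ((toReal quincunxM ^ J)⁻¹)ᵀ = halfM ^ J := by
  rw [Matrix.transpose_nonsing_inv, Matrix.transpose_pow, ← toReal_quincunxM_transpose_inv,
    Matrix.inv_pow']

/-- The coefficients of `f` with respect to the framelet system, computed on the Fourier side. The
normalization `√2ᴶ` times the Jacobian `2⁻ᴶ` is the factor `√2⁻ᴶ` of `fourierAtom`. -/
lemma integral_conj_framelet (ψ : Lp ℂ 2 (volume : Measure Plane)) {h : Plane → ℂ}
    (hψ : (𝓕 ψ : Lp ℂ 2 (volume : Measure Plane)) =ᵐ[volume] h) {f : Plane → ℂ}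
    (hf : MemLp f 2) (J : ℕ) (k : Fin 2 → ℤ) :
    ∫ x, f x * conj (((√2 ^ J : ℝ) : ℂ) * ψ (act (toReal quincunxM ^ J) x - lattice k)) =
      frameCoef (𝓕 (hf.toLp f) : Lp ℂ 2 (volume : Measure Plane)) h J k := by
  have hA : (toReal quincunxM ^ J).det ≠ 0 := by
    rw [det_toReal_quincunxM_pow]
    exact pow_ne_zero _ (by norm_num)
  have hgm := memLp_comp_affine hA (-lattice k) (Lp.memLp ψ)
  have e1 : ∫ x, f x * conj (((√2 ^ J : ℝ) : ℂ) * ψ (act (toReal quincunxM ^ J) x - lattice k)) =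
      ((√2 ^ J : ℝ) : ℂ) * inner ℂ (hgm.toLp _) (hf.toLp f) := by
    rw [inner_toLp, ← integral_const_mul]
    refine integral_congr_ae ?_
    filter_upwards [hf.coeFn_toLp] with x hx
    rw [hx, map_mul, Complex.conj_ofReal, ← sub_eq_add_neg]
    ring
  rw [e1, ← Lp.inner_fourier_eq, L2.inner_def, ← integral_const_mul]
  refine integral_congr_ae ?_
  have hq : ∀ᵐ ξ : Plane, (𝓕 ψ : Lp ℂ 2 (volume : Measure Plane)) (act (halfM ^ J) ξ) =
      h (act (halfM ^ J) ξ) := by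
    simpa using (quasiMeasurePreserving_affine (det_halfM_pow_ne_zero J) 0).ae hψ
  filter_upwards [fourier_comp_affine hA (-lattice k) ψ (hgm.toLp _) hgm.coeFn_toLp, hq] with ξ h2 h3
  rw [RCLike.inner_apply, h2, toReal_quincunxM_pow_inv_transpose, h3, inner_act,
    toReal_quincunxM_pow_inv_transpose, inner_neg_left, det_toReal_quincunxM_pow, abs_inv, abs_pow]
  unfold fourierAtom
  have h4 : (√2 ^ J : ℝ) * (|-2| ^ J)⁻¹ = (√2)⁻¹ ^ J := by
    rw [← inv_pow, ← mul_pow]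
    congr 1
    rw [abs_neg, abs_two, mul_inv_eq_iff_eq_mul₀ two_ne_zero, eq_comm,
      inv_mul_eq_iff_eq_mul₀ (by positivity), Real.mul_self_sqrt zero_le_two]
  rw [← h4]
  simp only [map_mul, Complex.conj_ofReal, Complex.ofReal_mul]
  ring

lemma abs_det_quincunxM_rpow (j : ℕ) :
    (((|quincunxM.det| : ℤ) : ℝ) ^ ((j : ℝ) / 2) : ℝ) = √2 ^ j := by
  have h : quincunxM.det = -2 := by
    rw [Matrix.det_fin_two]
    norm_num [quincunxM]
  rw [h, Real.sqrt_eq_rpow, ← Real.rpow_natCast, ← Real.rpow_mul (by norm_num)]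
  norm_num
  congr 1
  ring

/-- The unitary extension principle: a tight filter bank with `a(0) = 1` generates a tight
framelet. -/
lemma exists_isTightFramelet {L : ℕ} {a : Filter2} {b : Fin L → Filter2} (ha : symbol2 a 0 = 1)
    (hc : IsParaunitary fun i : Option (Fin L) => i.elim a b) :
    ∃ (φ : Lp ℂ 2 (volume : Measure Plane)) (ψ : Fin L → Lp ℂ 2 (volume : Measure Plane)),
      (𝓕 φ : Lp ℂ 2 (volume : Measure Plane)) =ᵐ[volume] phiHat a ∧
      (∀ ℓ, (𝓕 (ψ ℓ) : Lp ℂ 2 (volume : Measure Plane)) =ᵐ[volume] psiHat a (b ℓ)) ∧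
      IsTightFramelet quincunxM φ fun ℓ => (ψ ℓ : Plane → ℂ) := by
  have h1 : ∀ ω, ‖symbol2 a ω‖ ≤ 1 := hc.norm_symbol2_le_one none
  have hφ := memLp_phiHat ha h1 hc
  have hψ : ∀ ℓ, MemLp (psiHat a (b ℓ)) 2 := fun ℓ =>
    memLp_psiHat _ (hc.norm_symbol2_le_one (some ℓ)) hφ
  have e1 : (𝓕 (𝓕⁻ (hφ.toLp _) : Lp ℂ 2 (volume : Measure Plane)) :
      Lp ℂ 2 (volume : Measure Plane)) =ᵐ[volume] phiHat a := by
    rw [FourierTransform.fourier_fourierInv_eq]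
    exact hφ.coeFn_toLp
  have e2 : ∀ ℓ, (𝓕 (𝓕⁻ ((hψ ℓ).toLp _) : Lp ℂ 2 (volume : Measure Plane)) :
      Lp ℂ 2 (volume : Measure Plane)) =ᵐ[volume] psiHat a (b ℓ) := by
    intro ℓ
    rw [FourierTransform.fourier_fourierInv_eq]
    exact (hψ ℓ).coeFn_toLp
  refine ⟨𝓕⁻ (hφ.toLp _), fun ℓ => 𝓕⁻ ((hψ ℓ).toLp _), e1, e2, Lp.memLp _, fun ℓ => Lp.memLp _,
    fun f hf => ?_⟩
  have hid := frame_identity ha hc (𝓕 (hf.toLp f))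
  rw [← enorm_sq_eq_lintegral, ← ofReal_norm, Lp.norm_fourier_eq, ofReal_norm,
    enorm_sq_eq_lintegral] at hid
  have hff : ∫⁻ x, ‖hf.toLp f x‖ₑ ^ 2 = ∫⁻ x, ‖f x‖ₑ ^ 2 := by
    refine lintegral_congr_ae ?_
    filter_upwards [hf.coeFn_toLp] with x hx
    rw [hx]
  rw [← hff, ← hid]
  simp only [← integral_conj_framelet _ e1 hf, ← fun ℓ => integral_conj_framelet _ (e2 ℓ) hf,
    abs_det_quincunxM_rpow]
  simp only [pow_zero, act_one, Complex.ofReal_one, one_mul]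

/-! ### Symmetry of the framelets -/

/-- A symmetry of the Fourier transform under an orthogonal matrix gives a symmetry of the
function under an isometry of the plane. -/
lemma ae_comp_affine_eq {A : Matrix (Fin 2) (Fin 2) ℝ} (hA : A * Aᵀ = 1) (b : Plane) (χ : ℂ)
    (f : Lp ℂ 2 (volume : Measure Plane)) {h : Plane → ℂ}
    (hf : (𝓕 f : Lp ℂ 2 (volume : Measure Plane)) =ᵐ[volume] h)
    (hsym : ∀ ξ, unitExp (inner ℝ b (act A ξ)) * h (act A ξ) = χ * h ξ) :
    ∀ᵐ x : Plane, f (act A x + b) = χ * f x := by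
  have hinv : A⁻¹ = Aᵀ := Matrix.inv_eq_right_inv hA
  have hdet : A.det * A.det = 1 := by
    have := congrArg Matrix.det hA
    rwa [Matrix.det_mul, Matrix.det_transpose, Matrix.det_one] at this
  have hd : A.det ≠ 0 := fun h0 => by simp [h0] at hdet
  have habs : |A.det⁻¹| = 1 := by
    rw [abs_inv, inv_eq_one]
    exact (mul_self_eq_one_iff.1 hdet).elim (fun h => by simp [h]) (fun h => by simp [h])
  have hgm := memLp_comp_affine hd b (Lp.memLp f)
  have hF : (𝓕 (hgm.toLp _) : Lp ℂ 2 (volume : Measure Plane)) = 𝓕 (χ • f) := by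
    rw [FourierTransform.fourier_smul]
    apply Lp.ext
    have hq : ∀ᵐ ξ : Plane, (𝓕 f : Lp ℂ 2 (volume : Measure Plane)) (act A ξ) = h (act A ξ) := by
      simpa using (quasiMeasurePreserving_affine hd 0).ae hf
    filter_upwards [fourier_comp_affine hd b f (hgm.toLp _) hgm.coeFn_toLp, hq, hf,
      Lp.coeFn_smul χ (𝓕 f : Lp ℂ 2 (volume : Measure Plane))] with ξ h1 h2 h3 h4
    rw [h1, h4, Pi.smul_apply, h3, smul_eq_mul, ← hsym ξ, habs, Complex.ofReal_one, one_mul,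
      inner_act, hinv, Matrix.transpose_transpose, h2]
  have hg : hgm.toLp _ = χ • f := by
    have := congrArg (fun F : Lp ℂ 2 (volume : Measure Plane) =>
      (𝓕⁻ F : Lp ℂ 2 (volume : Measure Plane))) hF
    simpa only [FourierTransform.fourierInv_fourier_eq] using this
  filter_upwards [hgm.coeFn_toLp, Lp.coeFn_smul χ f] with x h1 h2
  rw [← h1, hg, h2, Pi.smul_apply, smul_eq_mul]

lemma toReal_mul_transpose_of_mem_D4 {E : Matrix (Fin 2) (Fin 2) ℤ} (hE : E ∈ D4) :
    toReal E * (toReal E)ᵀ = 1 := by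
  rcases hE with rfl | rfl | rfl | rfl | rfl | rfl | rfl | rfl <;>
  · ext i j
    fin_cases i <;> fin_cases j <;> simp [Matrix.mul_apply, Fin.sum_univ_two]

/-- If `f^(2πξ) = exp(-2πi c·ξ) B(ξ)` and `B ∘ E = χ(E) B` on `D₄`, then `f` has the symmetry `χ`
about the centre `c`. -/
lemma functionSymmetric_of_fourier (f : Lp ℂ 2 (volume : Measure Plane))
    (χ : Matrix (Fin 2) (Fin 2) ℤ → ℤ) (c : Plane) {h : Plane → ℂ} (B : Plane → ℂ)
    (hf : (𝓕 f : Lp ℂ 2 (volume : Measure Plane)) =ᵐ[volume] h)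
    (hh : ∀ ξ, h ξ = unitExp (-inner ℝ c ξ) * B ξ)
    (hB : ∀ E ∈ D4, ∀ ξ, B (act (toReal E) ξ) = χ E * B ξ) : FunctionSymmetric f χ c := by
  intro E hE
  have hA := toReal_mul_transpose_of_mem_D4 hE
  have hA' : (toReal E)ᵀ * toReal E = 1 := mul_eq_one_comm.1 hA
  have := ae_comp_affine_eq hA (c - act (toReal E) c) (χ E) f hf fun ξ => by
    rw [hh, hh, hB E hE, inner_sub_left, inner_act _ c, ← act_mul, hA', act_one, ← mul_assoc,
      ← unitExp_add, mul_left_comm]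
    congr 2
    ring_nf
  filter_upwards [this] with x hx
  rw [← hx, act_sub]
  congr 1
  abel

/-- The dilation matrix normalizes `D₄`: it interchanges the diagonal and the antidiagonal
reflections and inverts the rotations. -/
lemma exists_mem_D4_halfM_mul {E : Matrix (Fin 2) (Fin 2) ℤ} (hE : E ∈ D4) :
    ∃ E' ∈ D4, halfM * toReal E = toReal E' * halfM := by
  have key : ∀ E' : Matrix (Fin 2) (Fin 2) ℤ, quincunxM * E = E' * quincunxM →
      halfM * toReal E = toReal E' * halfM := by
    intro E' h
    have h2 : halfM = (1 / 2 : ℝ) • toReal quincunxM := by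
      rw [toReal_quincunxM]
      ext i j
      fin_cases i <;> fin_cases j <;> norm_num [halfM]
    have h3 := congrArg toReal h
    simp only [toReal, Matrix.map_mul_intCast] at h3
    rw [h2, Matrix.smul_mul, Matrix.mul_smul, h3]
  rcases hE with rfl | rfl | rfl | rfl | rfl | rfl | rfl | rfl
  · exact ⟨!![1, 0; 0, 1], by simp [D4], key _ (by decide)⟩
  · exact ⟨-!![1, 0; 0, 1], by simp [D4], key _ (by decide)⟩
  · exact ⟨!![0, 1; 1, 0], by simp [D4], key _ (by decide)⟩
  · exact ⟨-!![0, 1; 1, 0], by simp [D4], key _ (by decide)⟩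
  · exact ⟨!![1, 0; 0, -1], by simp [D4], key _ (by decide)⟩
  · exact ⟨-!![1, 0; 0, -1], by simp [D4], key _ (by decide)⟩
  · exact ⟨-!![0, 1; -1, 0], by simp [D4], key _ (by decide)⟩
  · exact ⟨!![0, 1; -1, 0], by simp [D4], key _ (by decide)⟩

lemma exists_mem_D4_halfM_pow_mul {E : Matrix (Fin 2) (Fin 2) ℤ} (hE : E ∈ D4) (j : ℕ) :
    ∃ E' ∈ D4, halfM ^ j * toReal E = toReal E' * halfM ^ j := by
  induction j with
  | zero => exact ⟨E, hE, by simp⟩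
  | succ j ih =>
    obtain ⟨E₁, h1, h2⟩ := ih
    obtain ⟨E₂, h3, h4⟩ := exists_mem_D4_halfM_mul h1
    exact ⟨E₂, h3, by rw [pow_succ', Matrix.mul_assoc, h2, ← Matrix.mul_assoc, h4,
      Matrix.mul_assoc]⟩

/-- The elements of `D₄` are the signed permutations of the coordinates, and `diagSign` tells
whether the coordinates are interchanged. -/
lemma toReal_mulVec_of_mem_D4 {E : Matrix (Fin 2) (Fin 2) ℤ} (hE : E ∈ D4) :
    ∃ σ τ : ℝ, (σ = 1 ∨ σ = -1) ∧ (τ = 1 ∨ τ = -1) ∧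
      ((diagSign E = 1 ∧ ∀ ω, toReal E *ᵥ ω = ![σ * ω 0, τ * ω 1]) ∨
        (diagSign E = -1 ∧ ∀ ω, toReal E *ᵥ ω = ![σ * ω 1, τ * ω 0])) := by
  rcases hE with rfl | rfl | rfl | rfl | rfl | rfl | rfl | rfl
  · exact ⟨1, 1, by simp, by simp, Or.inl ⟨by decide, fun ω => by simp⟩⟩
  · exact ⟨-1, -1, by simp, by simp, Or.inl ⟨by decide, fun ω => by simp⟩⟩
  · exact ⟨1, -1, by simp, by simp, Or.inl ⟨by decide, fun ω => by simp⟩⟩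
  · exact ⟨-1, 1, by simp, by simp, Or.inl ⟨by decide, fun ω => by simp⟩⟩
  · exact ⟨1, 1, by simp, by simp, Or.inr ⟨by decide, fun ω => by simp⟩⟩
  · exact ⟨-1, -1, by simp, by simp, Or.inr ⟨by decide, fun ω => by simp⟩⟩
  · exact ⟨1, -1, by simp, by simp, Or.inr ⟨by decide, fun ω => by simp⟩⟩
  · exact ⟨-1, 1, by simp, by simp, Or.inr ⟨by decide, fun ω => by simp⟩⟩

lemma zeroPhase_swap (n : ℕ) (x y : ℝ) : zeroPhase n ![y, x] = zeroPhase n ![x, y] := by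
  unfold zeroPhase
  simp only [Matrix.cons_val_zero, Matrix.cons_val_one]
  rw [← halfbandDiff_neg n ((x - y) / 2), add_comm x y, ← neg_div, neg_sub]

lemma zeroPhase_neg_right (n : ℕ) (x y : ℝ) : zeroPhase n ![x, -y] = zeroPhase n ![x, y] := by
  unfold zeroPhase
  simp only [Matrix.cons_val_zero, Matrix.cons_val_one]
  rw [sub_neg_eq_add, ← sub_eq_add_neg, add_comm (halfbandDiff n _)]

lemma zeroPhase_neg_left (n : ℕ) (x y : ℝ) : zeroPhase n ![-x, y] = zeroPhase n ![x, y] := by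
  rw [zeroPhase_swap, zeroPhase_neg_right, zeroPhase_swap]

lemma zeroPhase_toReal_mulVec (n : ℕ) {E : Matrix (Fin 2) (Fin 2) ℤ} (hE : E ∈ D4)
    (ω : Fin 2 → ℝ) : zeroPhase n (toReal E *ᵥ ω) = zeroPhase n ω := by
  have hω : zeroPhase n ω = zeroPhase n ![ω 0, ω 1] := rfl
  obtain ⟨σ, τ, rfl | rfl, rfl | rfl, ⟨-, h⟩ | ⟨-, h⟩⟩ := toReal_mulVec_of_mem_D4 hE <;>
  simp only [h, hω, one_mul, neg_one_mul, zeroPhase_neg_left, zeroPhase_neg_right,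
    zeroPhase_swap n (ω 0) (ω 1)]

/-- The infinite product of the zero-phase parts of the factors: `φ^` without its linear phase. -/
def centredHat (n : ℕ) (ω : Fin 2 → ℝ) : ℂ :=
  Complex.exp (-Complex.I * (-(3 / 2 * ω 0 + 1 / 2 * ω 1) : ℝ)) *
    refinableHat quincunxM (lowpass n) ω

lemma refinableHat_lowpass (n : ℕ) (ω : Fin 2 → ℝ) :
    refinableHat quincunxM (lowpass n) ω =
      Complex.exp (-Complex.I * (3 / 2 * ω 0 + 1 / 2 * ω 1 : ℝ)) * centredHat n ω := by
  unfold centredHat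
  rw [← mul_assoc, ← Complex.exp_add, ← mul_add, ← Complex.ofReal_add, add_neg_cancel]
  simp

/-- The phases `exp(-i ((Nʲω)₁ + (Nʲω)₂) / 2)` of the factors telescope, because
`(x + y) / 2 = c·((M - 1)(x, y))` with `c = (3/2, 1/2)`. -/
lemma prod_zeroPhase {n : ℕ} (hn : 0 < n) (ω : Fin 2 → ℝ) (m : ℕ) :
    ((∏ j ∈ Finset.range m, zeroPhase n (halfM ^ (j + 1) *ᵥ ω) : ℝ) : ℂ) =
      Complex.exp (-Complex.I * (3 / 2 * (halfM ^ m *ᵥ ω) 0 + 1 / 2 * (halfM ^ m *ᵥ ω) 1 -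
        (3 / 2 * ω 0 + 1 / 2 * ω 1) : ℝ)) *
      ∏ j ∈ Finset.range m, refinableFactor quincunxM (lowpass n) ω j := by
  induction m with
  | zero => simp
  | succ m ih =>
    rw [Finset.prod_range_succ, Finset.prod_range_succ, Complex.ofReal_mul, ih, refinableFactor_eq,
      symbol2_lowpass_eq hn]
    set η := halfM ^ m *ᵥ ω with hη
    have hη' : halfM ^ (m + 1) *ᵥ ω = ![(η 0 + η 1) / 2, (η 0 - η 1) / 2] := by
      rw [pow_succ', ← Matrix.mulVec_mulVec, halfM_mulVec]
    have he : ∀ s t u : ℝ, s = t + u → Complex.exp (-Complex.I * (s : ℂ)) =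
        Complex.exp (-Complex.I * (t : ℂ)) * Complex.exp (-Complex.I * (u : ℂ)) := by
      rintro s t u rfl
      rw [← Complex.exp_add, Complex.ofReal_add, mul_add]
    rw [hη', he (3 / 2 * η 0 + 1 / 2 * η 1 - (3 / 2 * ω 0 + 1 / 2 * ω 1)) (3 / 2 *
      (![(η 0 + η 1) / 2, (η 0 - η 1) / 2] : Fin 2 → ℝ) 0 + 1 / 2 *
      (![(η 0 + η 1) / 2, (η 0 - η 1) / 2] : Fin 2 → ℝ) 1 - (3 / 2 * ω 0 + 1 / 2 * ω 1))
      (((![(η 0 + η 1) / 2, (η 0 - η 1) / 2] : Fin 2 → ℝ) 0 +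
      (![(η 0 + η 1) / 2, (η 0 - η 1) / 2] : Fin 2 → ℝ) 1) / 2) (by simp; ring)]
    ring

lemma tendsto_halfM_pow_mulVec (ω : Fin 2 → ℝ) (i : Fin 2) :
    Filter.Tendsto (fun m : ℕ => (halfM ^ m *ᵥ ω) i) Filter.atTop (nhds 0) := by
  have h1 : Filter.Tendsto (fun J : ℕ => √(sqLength (halfM ^ J *ᵥ ω))) Filter.atTop (nhds 0) := by
    simp only [sqrt_sqLength_halfM_pow]
    have := (tendsto_pow_atTop_nhds_zero_of_lt_one (Real.sqrt_nonneg _) sqrt_half_lt_one).mul_const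
      (√(sqLength ω))
    simpa using this
  exact squeeze_zero_norm (fun m => abs_apply_le_sqrt_sqLength _ i) h1

lemma tendsto_prod_zeroPhase {n : ℕ} (hn : 0 < n) (ω : Fin 2 → ℝ) :
    Filter.Tendsto (fun m : ℕ =>
      ((∏ j ∈ Finset.range m, zeroPhase n (halfM ^ (j + 1) *ᵥ ω) : ℝ) : ℂ)) Filter.atTop
      (nhds (centredHat n ω)) := by
  simp only [prod_zeroPhase hn]
  refine Filter.Tendsto.mul ?_ (tendsto_prod_refinableFactor (symbol2_lowpass_zero hn) ω)
  have hc : Continuous fun t : ℝ => Complex.exp (-Complex.I * (t : ℂ)) := by fun_prop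
  refine (hc.tendsto _).comp ?_
  have := (((tendsto_halfM_pow_mulVec ω 0).const_mul (3 / 2)).add
    ((tendsto_halfM_pow_mulVec ω 1).const_mul (1 / 2))).sub_const (3 / 2 * ω 0 + 1 / 2 * ω 1)
  simpa using this

/-- Since `D₄` is normalized by the dilation, `φ^` is invariant under it up to its phase. -/
lemma centredHat_toReal_mulVec {n : ℕ} (hn : 0 < n) {E : Matrix (Fin 2) (Fin 2) ℤ} (hE : E ∈ D4)
    (ω : Fin 2 → ℝ) : centredHat n (toReal E *ᵥ ω) = centredHat n ω := by
  refine tendsto_nhds_unique (tendsto_prod_zeroPhase hn _)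
    ((tendsto_prod_zeroPhase hn ω).congr fun m => ?_)
  congr 1
  refine Finset.prod_congr rfl fun j _ => ?_
  obtain ⟨E', h1, h2⟩ := exists_mem_D4_halfM_pow_mul hE (j + 1)
  rw [Matrix.mulVec_mulVec, h2, ← Matrix.mulVec_mulVec, zeroPhase_toReal_mulVec n h1]

lemma centredHat_halfM_toReal_mulVec {n : ℕ} (hn : 0 < n) {E : Matrix (Fin 2) (Fin 2) ℤ}
    (hE : E ∈ D4) (ω : Fin 2 → ℝ) :
    centredHat n (halfM *ᵥ (toReal E *ᵥ ω)) = centredHat n (halfM *ᵥ ω) := by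
  obtain ⟨E', h1, h2⟩ := exists_mem_D4_halfM_mul hE
  rw [Matrix.mulVec_mulVec, h2, ← Matrix.mulVec_mulVec, centredHat_toReal_mulVec hn h1]

lemma exp_neg_I_mul_mul_exp {s t u : ℝ} (h : s + t = u) :
    Complex.exp (-Complex.I * (s : ℂ)) * Complex.exp (-Complex.I * (t : ℂ)) =
      Complex.exp (-Complex.I * (u : ℂ)) := by
  rw [← Complex.exp_add, ← h, Complex.ofReal_add, mul_add]

lemma conj_exp_neg_I_mul (t : ℝ) :
    conj (Complex.exp (-Complex.I * (t : ℂ))) = Complex.exp (-Complex.I * ((-t : ℝ) : ℂ)) := by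
  rw [← Complex.exp_conj]
  simp

lemma unitExp_eq (t : ℝ) :
    unitExp t = Complex.exp (-Complex.I * ((-(2 * Real.pi * t) : ℝ) : ℂ)) := by
  unfold unitExp
  congr 1
  push_cast
  ring

lemma frameletHat_eq (a b : Filter2) (ω : Fin 2 → ℝ) :
    frameletHat quincunxM a b ω = symbol2 b (halfM *ᵥ ω) * refinableHat quincunxM a (halfM *ᵥ ω) := by
  unfold frameletHat
  rw [toReal_quincunxM_transpose_inv]

/-- The shift by `(π, π)` turns the sum of the two branches of the zero-phase factor into their
difference, which is odd under interchange of the coordinates; the phase is that of the centre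
`(1, 1)`. -/
lemma frameletHat_mate_lowpass {n : ℕ} (hn : 0 < n) (ω : Fin 2 → ℝ) :
    frameletHat quincunxM (lowpass n) (mate (lowpass n)) ω =
      Complex.exp (-Complex.I * (ω 0 + ω 1 : ℝ)) *
        (((halfbandDiff n (ω 0 / 2) - halfbandDiff n (ω 1 / 2)) / 2 : ℝ) *
          centredHat n (halfM *ᵥ ω)) := by
  rw [frameletHat_eq, isCanonicalPair_mate, symbol2_lowpass_eq hn, zeroPhase_add_pi hn,
    refinableHat_lowpass]
  set C := centredHat n (halfM *ᵥ ω)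
  rw [halfM_mulVec]
  simp only [Pi.add_apply, Matrix.cons_val_zero, Matrix.cons_val_one]
  rw [show ((ω 0 + ω 1) / 2 + Real.pi + ((ω 0 - ω 1) / 2 + Real.pi)) / 2 = ω 0 / 2 + Real.pi by ring,
    exp_neg_I_mul_add_pi, map_mul, map_neg, conj_exp_neg_I_mul, Complex.conj_ofReal,
    show ((ω 0 + ω 1) / 2 - (ω 0 - ω 1) / 2) / 2 = ω 1 / 2 by ring,
    show ((ω 0 + ω 1) / 2 + (ω 0 - ω 1) / 2) / 2 = ω 0 / 2 by ring]
  have hZ : (((halfbandDiff n (ω 1 / 2) - halfbandDiff n (ω 0 / 2)) / 2 : ℝ) : ℂ) =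
      -(((halfbandDiff n (ω 0 / 2) - halfbandDiff n (ω 1 / 2)) / 2 : ℝ) : ℂ) := by
    push_cast
    ring
  have h1 := exp_neg_I_mul_mul_exp
    (show (ω 0 + ω 1) / 2 + -(ω 0 / 2) = ω 1 / 2 by ring)
  have h2 := exp_neg_I_mul_mul_exp (show ω 1 / 2 +
    (3 / 2 * ((ω 0 + ω 1) / 2) + 1 / 2 * ((ω 0 - ω 1) / 2)) = ω 0 + ω 1 by ring)
  rw [hZ, ← h2, ← h1]
  ring

lemma frameletHat_highpass (n : ℕ) (aD : Filter1) (ω : Fin 2 → ℝ) :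
    frameletHat quincunxM (lowpass n) (highpass aD) ω =
      1 / 2 * (symbol1 (highpassV aD) (ω 0) * Complex.exp (-Complex.I * (ω 0 + ω 1 / 2 : ℝ)) +
        symbol1 (highpassV aD) (ω 1) * Complex.exp (-Complex.I * (3 / 2 * ω 0 : ℝ))) *
          centredHat n (halfM *ᵥ ω) := by
  rw [frameletHat_eq, symbol2_highpass, refinableHat_lowpass]
  set C := centredHat n (halfM *ᵥ ω)
  rw [halfM_mulVec]
  simp only [Matrix.cons_val_zero, Matrix.cons_val_one]
  rw [show (ω 0 + ω 1) / 2 + (ω 0 - ω 1) / 2 = ω 0 by ring,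
    show (ω 0 + ω 1) / 2 - (ω 0 - ω 1) / 2 = ω 1 by ring,
    show 3 / 2 * ((ω 0 + ω 1) / 2) + 1 / 2 * ((ω 0 - ω 1) / 2) = ω 0 + ω 1 / 2 by ring,
    ← exp_neg_I_mul_mul_exp (show (ω 0 - ω 1) / 2 + (ω 0 + ω 1 / 2) = 3 / 2 * ω 0 by ring)]
  ring

lemma frameletHat_mate_highpass (n : ℕ) (aD : Filter1) (ω : Fin 2 → ℝ) :
    frameletHat quincunxM (lowpass n) (mate (highpass aD)) ω =
      1 / 2 * (conj (symbol1 (highpassV aD) (ω 0)) *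
          Complex.exp (-Complex.I * (3 / 2 * ω 0 + ω 1 : ℝ)) -
        conj (symbol1 (highpassV aD) (ω 1)) *
          Complex.exp (-Complex.I * (ω 0 + 3 / 2 * ω 1 : ℝ))) *
          centredHat n (halfM *ᵥ ω) := by
  rw [frameletHat_eq, isCanonicalPair_mate, highpass, symbol2_cross_add_pi, refinableHat_lowpass]
  set C := centredHat n (halfM *ᵥ ω)
  rw [halfM_mulVec]
  simp only [Matrix.cons_val_zero, Matrix.cons_val_one]
  rw [show (ω 0 + ω 1) / 2 + (ω 0 - ω 1) / 2 = ω 0 by ring,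
    show (ω 0 + ω 1) / 2 - (ω 0 - ω 1) / 2 = ω 1 by ring, map_mul, map_sub, map_mul,
    conj_exp_neg_I_mul]
  have h1 := exp_neg_I_mul_mul_exp (show (ω 0 + ω 1) / 2 + -((ω 0 - ω 1) / 2) = ω 1 by ring)
  have h2 := exp_neg_I_mul_mul_exp (show ω 1 +
    (3 / 2 * ((ω 0 + ω 1) / 2) + 1 / 2 * ((ω 0 - ω 1) / 2)) = ω 0 + 3 / 2 * ω 1 by ring)
  have h3 := exp_neg_I_mul_mul_exp (show (ω 0 + ω 1) / 2 +
    (3 / 2 * ((ω 0 + ω 1) / 2) + 1 / 2 * ((ω 0 - ω 1) / 2)) = 3 / 2 * ω 0 + ω 1 by ring)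
  rw [← h3, ← h2, ← h1]
  simp only [map_div₀, map_one, map_ofNat]
  ring

lemma two_pi_smul_act (A : Matrix (Fin 2) (Fin 2) ℝ) (ξ : Plane) :
    (2 * Real.pi) • (act A ξ).ofLp = A *ᵥ ((2 * Real.pi) • ξ.ofLp) := by
  unfold act
  rw [Matrix.mulVec_smul]

lemma functionSymmetric_phi {n : ℕ} (hn : 0 < n) (φ : Lp ℂ 2 (volume : Measure Plane))
    (hφ : (𝓕 φ : Lp ℂ 2 (volume : Measure Plane)) =ᵐ[volume] phiHat (lowpass n)) :
    FunctionSymmetric φ (fun _ => 1) !₂[3 / 2, 1 / 2] := by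
  refine functionSymmetric_of_fourier φ _ _
    (fun ξ => centredHat n ((2 * Real.pi) • ξ.ofLp)) hφ (fun ξ => ?_) fun E hE ξ => ?_
  · rw [phiHat, refinableHat_lowpass, unitExp_eq, inner_plane]
    congr 4
    simp
    ring
  · rw [two_pi_smul_act, centredHat_toReal_mulVec hn hE]
    simp

lemma functionSymmetric_psi_mate_lowpass {n : ℕ} (hn : 0 < n)
    (ψ : Lp ℂ 2 (volume : Measure Plane))
    (hψ : (𝓕 ψ : Lp ℂ 2 (volume : Measure Plane)) =ᵐ[volume]
      psiHat (lowpass n) (mate (lowpass n))) :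
    FunctionSymmetric ψ diagSign !₂[1, 1] := by
  refine functionSymmetric_of_fourier ψ _ _ (fun ξ =>
    (fun ω : Fin 2 → ℝ => ((halfbandDiff n (ω 0 / 2) - halfbandDiff n (ω 1 / 2)) / 2 : ℝ) *
      centredHat n (halfM *ᵥ ω)) ((2 * Real.pi) • ξ.ofLp)) hψ (fun ξ => ?_) fun E hE ξ => ?_
  · rw [psiHat, frameletHat_mate_lowpass hn, unitExp_eq, inner_plane]
    congr 4
    simp
    ring
  · beta_reduce
    rw [two_pi_smul_act, centredHat_halfM_toReal_mulVec hn hE]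
    set ω : Fin 2 → ℝ := (2 * Real.pi) • ξ.ofLp
    have hsign : ∀ σ x : ℝ, (σ = 1 ∨ σ = -1) →
        halfbandDiff n (σ * x / 2) = halfbandDiff n (x / 2) := by
      rintro σ x (rfl | rfl)
      · rw [one_mul]
      · rw [neg_one_mul, neg_div, halfbandDiff_neg]
    obtain ⟨σ, τ, hσ, hτ, ⟨hd, h⟩ | ⟨hd, h⟩⟩ := toReal_mulVec_of_mem_D4 hE
    · rw [h, hd]
      simp [hsign _ _ hσ, hsign _ _ hτ]
    · rw [h, hd]
      simp [hsign _ _ hσ, hsign _ _ hτ]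
      ring

lemma swap_mem_D4 : (!![0, 1; 1, 0] : Matrix (Fin 2) (Fin 2) ℤ) ∈ D4 := by simp [D4]

lemma toReal_swap_mulVec (ω : Fin 2 → ℝ) : toReal !![0, 1; 1, 0] *ᵥ ω = ![ω 1, ω 0] := by simp

lemma act_toReal_swap (x : Plane) : act (toReal !![0, 1; 1, 0]) x = !₂[x 1, x 0] := by
  unfold act
  rw [toReal_swap_mulVec]

lemma psi_highpass_symmetric {n : ℕ} (hn : 0 < n) (aD : Filter1)
    (ψ : Lp ℂ 2 (volume : Measure Plane))
    (hψ : (𝓕 ψ : Lp ℂ 2 (volume : Measure Plane)) =ᵐ[volume] psiHat (lowpass n) (highpass aD)) :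
    ∀ᵐ x : Plane, ψ !₂[x 1 + 1, x 0 - 1] = ψ x := by
  have := ae_comp_affine_eq (toReal_mul_transpose_of_mem_D4 swap_mem_D4) !₂[1, -1] 1 ψ hψ
    fun ξ => by
      rw [psiHat, psiHat, two_pi_smul_act, frameletHat_highpass, frameletHat_highpass,
        centredHat_halfM_toReal_mulVec hn swap_mem_D4, toReal_swap_mulVec, unitExp_eq,
        inner_plane, act_toReal_swap]
      set ω : Fin 2 → ℝ := (2 * Real.pi) • ξ.ofLp with hω
      have h0 : ω 0 = 2 * Real.pi * ξ 0 := rfl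
      have h1 : ω 1 = 2 * Real.pi * ξ 1 := rfl
      have e : (-(2 * Real.pi * ((!₂[1, -1] : Plane) 0 * (!₂[ξ 1, ξ 0] : Plane) 0 +
          (!₂[1, -1] : Plane) 1 * (!₂[ξ 1, ξ 0] : Plane) 1)) : ℝ) = ω 0 - ω 1 := by
        rw [h0, h1]
        simp
        ring
      rw [e]
      simp only [Matrix.cons_val_zero, Matrix.cons_val_one]
      -- The translation by `(1, -1)` moves the phase of each branch to that of the other one.
      rw [← exp_neg_I_mul_mul_exp (show ω 0 - ω 1 + 3 / 2 * ω 1 = ω 0 + ω 1 / 2 by ring),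
        ← exp_neg_I_mul_mul_exp (show ω 0 - ω 1 + (ω 1 + ω 0 / 2) = 3 / 2 * ω 0 by ring)]
      ring
  filter_upwards [this] with x hx
  rw [one_mul, act_toReal_swap] at hx
  rw [← hx]
  congr 1
  ext i
  fin_cases i
  · simp
  · simp [sub_eq_add_neg]

lemma psi_mate_highpass_antisymmetric {n : ℕ} (hn : 0 < n) (aD : Filter1)
    (ψ : Lp ℂ 2 (volume : Measure Plane))
    (hψ : (𝓕 ψ : Lp ℂ 2 (volume : Measure Plane)) =ᵐ[volume]
      psiHat (lowpass n) (mate (highpass aD))) :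
    ∀ᵐ x : Plane, ψ !₂[x 1, x 0] = -ψ x := by
  have := ae_comp_affine_eq (toReal_mul_transpose_of_mem_D4 swap_mem_D4) 0 (-1) ψ hψ
    fun ξ => by
      rw [psiHat, psiHat, two_pi_smul_act, frameletHat_mate_highpass, frameletHat_mate_highpass,
        centredHat_halfM_toReal_mulVec hn swap_mem_D4, toReal_swap_mulVec, inner_zero_left]
      set ω : Fin 2 → ℝ := (2 * Real.pi) • ξ.ofLp with hω
      simp only [Matrix.cons_val_zero, Matrix.cons_val_one]
      rw [add_comm (ω 0) (3 / 2 * ω 1), add_comm (3 / 2 * ω 0) (ω 1)]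
      simp only [unitExp, mul_zero, Complex.ofReal_zero, zero_mul, Complex.exp_zero]
      ring
  filter_upwards [this] with x hx
  rwa [neg_one_mul, act_toReal_swap, add_zero] at hx

/-! ### The framelet filter bank and its framelets -/

/-- A tight `M`-framelet filter bank, in the sense of `IsTightFilterBank`, is paraunitary. -/
lemma isParaunitary_of_isTightFilterBank {L : ℕ} {a : Filter2} {b : Fin L → Filter2}
    (h : IsTightFilterBank quincunxM a b) :
    IsParaunitary fun i : Option (Fin L) => i.elim a b := by
  refine ⟨fun ω => ?_, fun ω => ?_⟩
  · rw [Fintype.sum_option]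
    exact h.1 ω
  · rw [Fintype.sum_option]
    -- `(1/2, 1/2) = (Mᵀ)⁻¹ (1, 0)` is the point of `Ω_M` that gives the shift by `(π, π)`.
    have h2 := h.2 ![1 / 2, 1 / 2] ⟨⟨![1, 0], ?_⟩, fun i => ?_⟩ (fun h0 => ?_) ω
    · rw [two_pi_smul_half] at h2
      exact h2
    · rw [toReal_quincunxM_transpose_inv, halfM_mulVec]
      simp
    · fin_cases i <;> norm_num
    · simpa using congrFun h0 0

end

end Quincunx

open Quincunx in
theorem theorem2p2 (n : ℕ) (hn : 0 < n) (aD : Filter1) (hreal : IsRealFilter aD)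
    (hD : ∀ ω : ℝ, ‖symbol1 aD ω‖ ^ 2 = interpolatorySymbol n ω)
    (a b₁ b₂ b₃ : Filter2) (ha : a = lowpass n) (hb₂ : b₂ = highpass aD)
    (hb₁ : b₁ = mate a) (hb₃ : b₃ = mate b₂) :
    IsDoubleCanonical a b₁ b₂ b₃ ∧
    (IsRealFilter a ∧ IsRealFilter b₁ ∧ IsRealFilter b₂ ∧ IsRealFilter b₃) ∧
    (FilterSymmetric b₁ (fun E => diagSign E * E.det) ![1 / 2, -1 / 2] ∧
      (∀ k₁ k₂ : ℤ, b₂ ![k₁, 1 - k₂] = b₂ ![k₁, k₂]) ∧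
      (∀ k₁ k₂ : ℤ, b₃ ![k₁, -1 - k₂] = -b₃ ![k₁, k₂])) ∧
    (HasVanishingMoments b₁ n ∧ HasVanishingMoments b₂ n ∧ HasVanishingMoments b₃ n) ∧
    ((b₁.support.card ≤ a.support.card ∧ b₂.support.card ≤ a.support.card ∧
        b₃.support.card ≤ a.support.card) ∧
      (∀ k, b₁ k ≠ 0 → a (k + ![0, 1]) ≠ 0) ∧
      ((∀ k : ℤ, aD k ≠ 0 → 1 - (n : ℤ) ≤ k ∧ k ≤ n) →
        (∀ k, b₂ k ≠ 0 → a k ≠ 0) ∧ (∀ k, b₃ k ≠ 0 → a (k + ![0, 1]) ≠ 0))) ∧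
    (∀ ω, Multipliable (refinableFactor quincunxM a ω)) ∧
    ∃ φ ψ₁ ψ₂ ψ₃ : MeasureTheory.Lp ℂ 2 (MeasureTheory.volume : MeasureTheory.Measure Plane),
      HasFourierTransform φ (refinableHat quincunxM a) ∧
      HasFourierTransform ψ₁ (frameletHat quincunxM a b₁) ∧
      HasFourierTransform ψ₂ (frameletHat quincunxM a b₂) ∧
      HasFourierTransform ψ₃ (frameletHat quincunxM a b₃) ∧
      IsTightFramelet quincunxM φ ![(ψ₁ : Plane → ℂ), ψ₂, ψ₃] ∧
      FunctionSymmetric φ (fun _ => 1) !₂[3 / 2, 1 / 2] ∧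
      FunctionSymmetric ψ₁ diagSign !₂[1, 1] ∧
      (∀ᵐ x : Plane, ψ₂ !₂[x 1 + 1, x 0 - 1] = ψ₂ x) ∧
      (∀ᵐ x : Plane, ψ₃ !₂[x 1, x 0] = -ψ₃ x) := by
  subst ha hb₁ hb₂ hb₃
  have hbank := isDoubleCanonical_lowpass_highpass hn hD
  have h0 := symbol2_lowpass_zero hn
  have hreal₂ : IsRealFilter (highpass aD) := (isRealFilter_highpassV hreal).cross
  have hreal₀ : IsRealFilter (lowpass n) := (isRealFilter_lowpassU n).cross
  have hcard : (highpass aD).support.card ≤ (lowpass n).support.card := by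
    unfold highpass lowpass
    rw [card_support_cross, card_support_cross]
    exact Nat.mul_le_mul_left 2 (card_support_highpassV_le hn hD)
  obtain ⟨φ, ψ, hφ, hψ, hframe⟩ :=
    exists_isTightFramelet h0 (isParaunitary_of_isTightFilterBank hbank.1)
  refine ⟨hbank, ⟨hreal₀, hreal₀.mate, hreal₂, hreal₂.mate⟩,
    ⟨filterSymmetric_mate_lowpass n, cross_reflect_snd _, mate_reflect_snd (cross_reflect_snd _)⟩,
    ⟨hasVanishingMoments_mate_lowpass hn, (hasVanishingMoments_highpass hn hD).1,
      (hasVanishingMoments_highpass hn hD).2⟩,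
    ⟨⟨(card_support_mate _).le, hcard, (card_support_mate _).trans_le hcard⟩,
      mate_lowpass_support n, fun h => ⟨highpass_support hn h, fun k hk => ?_⟩⟩,
    multipliable_refinableFactor h0, φ, ψ 0, ψ 1, ψ 2, hφ, hψ 0, hψ 1, hψ 2, ?_,
    functionSymmetric_phi hn φ hφ, functionSymmetric_psi_mate_lowpass hn _ (hψ 0),
    psi_highpass_symmetric hn aD _ (hψ 1), psi_mate_highpass_antisymmetric hn aD _ (hψ 2)⟩
  · exact lowpass_reflect_ne_zero n (highpass_support hn h _ ((mate_ne_zero_iff _ _).1 hk))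
  · convert hframe using 1
    ext ℓ
    fin_cases ℓ <;> rfl
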